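/- Let $d,p\ge 1$ be integers, let $\Delta$ be the discrete Laplacian $(\Delta u)_n=\sum_{j=1}^d(u_{n+e_j}+u_{n-e_j}-2u_n)$ on $\ell^2(\mathbb Z^d)$, and let $\gamma_p=\binom{2p+1}{p+1}$. Let $\Omega\in\mathbb R\setminus[-4d,0]$, and let $\mathcal A\in\ell^2(\mathbb Z^d)$ be a real solution of $$\Omega\mathcal A+\gamma_p|\mathcal A|^{2p}\mathcal A=\Delta\mathcal A$$ such that $L_+:=\Omega-\Delta+(1+2p)\gamma_p|\mathcal A|^{2p}$ has trivial kernel in $\ell^2(\mathbb Z^d)$. Put $L_-:=\Omega-\Delta+\gamma_p|\mathcal A|^{2p}$ and $\mathcal J\mathcal H''(\mathcal A)(b_+,b_-):=(-L_-b_-,\,L_+b_+)$ on $\ell^2(\mathbb Z^d)\times\ell^2(\mathbb Z^d)$. Let $\Lambda\in\mathbb C$ be such that $2\Lambda$ is an (algebraically) simple eigenvalue of $\mathcal J\mathcal H''(\mathcal A)$, isolated in its spectrum, with eigenvector $(b_+,b_-)$, and such that $2\Lambda$ does not lie in the continuous spectrum $i[\Omega,\Omega+4d]\cup -i[\Omega,\Omega+4d]$.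 Denote by $\ell^{2,2}(\mathbb Z;\ell^2(\mathbb Z^d))$ the space of sequences $B=\{B^{(m)}\}_{m\in\mathbb Z}$ with norm $\big(\sum_m(1+m^2)^2\|B^{(m)}\|_{\ell^2}^2\big)^{1/2}<\infty$. A breather branch is a pair of analytic functions $\omega(\epsilon)\in\mathbb R$, $A(\epsilon)\in\ell^{2,2}(\mathbb Z;\ell^2(\mathbb Z^d))$ on an interval $(0,\epsilon_1)$, $\epsilon_1>0$, with $A^{(m)}=A^{(-m)}$ real, such that, with $U(\tau)=\sum_mA^{(m)}e^{im\tau}$ and componentwise products, $$(1-m^2\omega^2)A^{(m)}+\frac{\epsilon}{2\pi}\int_{-\pi}^{\pi}U^{1+2p}(\tau)e^{-im\tau}\,d\tau=\epsilon\Delta A^{(m)},\quad m\in\mathbb Z,$$ and such that for some constant $C_1$ and all $\epsilon\in(0,\epsilon_1)$ $$|\omega(\epsilon)-1+\tfrac12\epsilon\Omega|\le C_1\epsilon^2,\qquad \|A^{(0)}\|_{\ell^2}+\|A^{(1)}-\mathcal A\|_{\ell^2}+\sum_{m\ge2}\|A^{(m)}\|_{\ell^2}\le C_1\epsilon .$$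 Then a breather branch exists, and one can choose it analytic also at $\epsilon=0$. Moreover, for every breather branch there are $\epsilon_0\in(0,\epsilon_1]$, $C_0>0$, $\delta\ge C_0\epsilon_0$ and analytic functions $\lambda(\epsilon)\in\mathbb C$, $B(\epsilon)\in\ell^{2,2}(\mathbb Z;\ell^2(\mathbb Z^d))\setminus\{0\}$ on $(0,\epsilon_0)$ (analytic also at $\epsilon=0$ if $\omega$ and $A$ are) such that, for every $\epsilon\in(0,\epsilon_0)$, the pair $(\lambda,B)=(\lambda(\epsilon),B(\epsilon))$ solves the Floquet spectral problem $$\big[1+(\lambda+im\omega)^2\big]B^{(m)}+\frac{\epsilon(1+2p)}{2\pi}\int_{-\pi}^{\pi}U^{2p}(\tau)W(\tau)e^{-im\tau}\,d\tau=\epsilon\Delta B^{(m)},\quad m\in\mathbb Z,\qquad W(\tau)=\sum_mB^{(m)}e^{im\tau},$$ and satisfies $$|\lambda(\epsilon)-\epsilon\Lambda|\le C_0\epsilon^2,\qquad \|B^{(1)}-b_+-ib_-\|_{\ell^2}+\|B^{(-1)}-b_++ib_-\|_{\ell^2}\le C_0\epsilon,\qquad \sum_{m\ne\pm1}\|B^{(m)}\|_{\ell^2}\le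 C_0\epsilon .$$ The branch is unique, the eigenvector up to a scalar factor: for every $\epsilon\in(0,\epsilon_0)$, if $(\mu,D)$ with $0\ne D\in\ell^{2,2}(\mathbb Z;\ell^2(\mathbb Z^d))$ solves the Floquet spectral problem at $\epsilon$ and $|\mu-\epsilon\Lambda|\le\delta\epsilon$, then $\mu=\lambda(\epsilon)$ and $D=c\,B(\epsilon)$ for some $c\in\mathbb C$. -/

import Mathlib

open scoped Topology

noncomputable section

namespace KGBreather

/-- The space `ℓ²(ℤ^d)` of square-summable complex sequences. -/
abbrev L2Z (d : ℕ) : Type := lp (fun _ : Fin d → ℤ => ℂ) 2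

/-- The discrete Laplacian on sequences:
`(Δ u)_n = ∑_j (u_{n+e_j} + u_{n-e_j} - 2 u_n)`. -/
def lap {d : ℕ} (u : (Fin d → ℤ) → ℂ) (n : Fin d → ℤ) : ℂ :=
  ∑ j : Fin d, (u (n + Pi.single j 1) + u (n - Pi.single j 1) - 2 * u n)

/-- Translation `f ↦ f(· + k)` as a bounded operator on `ℓ²(ℤ^d)`. -/
def shiftOp {d : ℕ} (k : Fin d → ℤ) : L2Z d →L[ℂ] L2Z d :=
  LinearMap.mkContinuous
    { toFun := fun f => ⟨fun n => f (n + k), by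
        have h2 : 0 < (2 : ENNReal).toReal := by norm_num
        refine memℓp_gen ?_
        exact ((lp.memℓp f).summable h2).comp_injective (add_left_injective k)⟩
      map_add' := fun _ _ => rfl
      map_smul' := fun _ _ => rfl }
    1
    (fun f => by
      have h2 : 0 < (2 : ENNReal).toReal := by norm_num
      rw [one_mul]
      refine lp.norm_le_of_tsum_le h2 (norm_nonneg _) ?_
      rw [lp.norm_rpow_eq_tsum h2 f]
      exact ((Equiv.addRight k).tsum_eq (fun n => ‖f n‖ ^ (2 : ENNReal).toReal)).le)

/-- The discrete Laplacian as a bounded operator on `ℓ²(ℤ^d)`. -/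
def lapOp (d : ℕ) : L2Z d →L[ℂ] L2Z d :=
  ∑ j : Fin d, (shiftOp (Pi.single j 1) + shiftOp (-Pi.single j 1)
    - (2 : ℂ) • ContinuousLinearMap.id ℂ (L2Z d))

theorem lapOp_apply {d : ℕ} (f : L2Z d) (n : Fin d → ℤ) : lapOp d f n = lap f n := by
  simp only [lapOp, lap, sum_apply, lp.coeFn_sum, Finset.sum_apply]
  refine Finset.sum_congr rfl fun j _ => ?_
  rw [sub_eq_add_neg n]
  rfl

/-- Multiplication by the bounded sequence `|A|^{2p}` on `ℓ²(ℤ^d)`. -/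
def potOp {d : ℕ} (p : ℕ) (A : L2Z d) : L2Z d →L[ℂ] L2Z d :=
  lp.mapCLM 2
    (fun n => ((‖A n‖ ^ (2 * p) : ℝ) : ℂ) • ContinuousLinearMap.id ℂ ℂ)
    (K := ‖A‖ ^ (2 * p)) (by positivity)
    (fun n => by
      have h : ‖A n‖ ≤ ‖A‖ := lp.norm_apply_le_norm two_ne_zero A n
      simpa [norm_smul] using pow_le_pow_left₀ (norm_nonneg _) h (2 * p))

theorem potOp_apply {d : ℕ} (p : ℕ) (A f : L2Z d) (n : Fin d → ℤ) :
    potOp p A f n = ((‖A n‖ ^ (2 * p) : ℝ) : ℂ) * f n := by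
  simp [potOp]

/-- `γ_p = (2p+1)! / (p! (p+1)!)`. -/
def gam (p : ℕ) : ℕ := Nat.choose (1 + 2 * p) (1 + p)

/-- The stationary dNLS equation `Ω A + γ_p |A|^{2p} A = Δ A`. -/
def IsSoliton {d : ℕ} (p : ℕ) (Ω : ℝ) (A : L2Z d) : Prop :=
  ∀ n, (Ω : ℂ) * A n + (gam p : ℂ) * ((‖A n‖ ^ (2 * p) : ℝ) : ℂ) * A n = lap A n

/-- `L₊ = Ω - Δ + (1+2p) γ_p |A|^{2p}`, the Jacobian operator of the stationary dNLS equation. -/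
def Lplus {d : ℕ} (p : ℕ) (Ω : ℝ) (A : L2Z d) : L2Z d →L[ℂ] L2Z d :=
  (Ω : ℂ) • ContinuousLinearMap.id ℂ (L2Z d) + ((1 + 2 * p) * gam p : ℂ) • potOp p A - lapOp d

/-- `L₋ = Ω - Δ + γ_p |A|^{2p}`. -/
def Lminus {d : ℕ} (p : ℕ) (Ω : ℝ) (A : L2Z d) : L2Z d →L[ℂ] L2Z d :=
  (Ω : ℂ) • ContinuousLinearMap.id ℂ (L2Z d) + (gam p : ℂ) • potOp p A - lapOp d

/-- The dNLS linearization `𝒥ℋ''(A) (b₊, b₋) = (-L₋ b₋, L₊ b₊)` on `ℓ² × ℓ²`. -/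
def JH {d : ℕ} (p : ℕ) (Ω : ℝ) (A : L2Z d) : (L2Z d × L2Z d) →L[ℂ] (L2Z d × L2Z d) :=
  (-(Lminus p Ω A ∘L ContinuousLinearMap.snd ℂ (L2Z d) (L2Z d))).prod
    (Lplus p Ω A ∘L ContinuousLinearMap.fst ℂ (L2Z d) (L2Z d))

/-- The continuous spectrum `i[Ω, Ω+4d] ∪ -i[Ω, Ω+4d]` of `𝒥ℋ''(A)`. -/
def contSpectrum (d : ℕ) (Ω : ℝ) : Set ℂ :=
  {z | ∃ s ∈ Set.Icc Ω (Ω + 4 * d), z = Complex.I * s ∨ z = -(Complex.I * s)}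

/-- `Λ` is a simple isolated eigenvalue of `𝒥ℋ''(A) f = 2 Λ f` with eigenvector `f`:
the generalized eigenspace of the eigenvalue `2Λ` is one-dimensional, and `2Λ` is an isolated
point of the spectrum. -/
structure IsSimpleIsolatedEigenpair {d : ℕ} (p : ℕ) (Ω : ℝ) (A : L2Z d) (Lam : ℂ)
    (f : L2Z d × L2Z d) : Prop where
  ne_zero : f ≠ 0
  eigen : JH p Ω A f = (2 * Lam) • f
  simple : Module.finrank ℂ (Module.End.maxGenEigenspace
    (JH p Ω A : Module.End ℂ (L2Z d × L2Z d)) (2 * Lam)) = 1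
  isolated : ∀ᶠ z in 𝓝[≠] (2 * Lam), z ∉ spectrum ℂ (JH p Ω A)

/-- The sequences of harmonics `(B^{(m)})_{m ∈ ℤ}` in `ℓ²(ℤ^d)` with
`((1+m²) B^{(m)})_m ∈ ℓ²(ℤ; ℓ²(ℤ^d))`. -/
def harmonicsSubmodule (d : ℕ) : Submodule ℂ (ℤ → L2Z d) where
  carrier := {B | Memℓp (fun m : ℤ => (1 + (m : ℂ) ^ 2) • B m) 2}
  add_mem' := fun {B C} hB hC => by
    have h := Memℓp.add hB hC
    have e : (fun m : ℤ => (1 + (m : ℂ) ^ 2) • (B + C) m)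
        = (fun m : ℤ => (1 + (m : ℂ) ^ 2) • B m) + fun m : ℤ => (1 + (m : ℂ) ^ 2) • C m := by
      funext m
      simp
    simpa only [Set.mem_ofPred_eq, e] using h
  zero_mem' := by
    have e : (fun m : ℤ => (1 + (m : ℂ) ^ 2) • (0 : ℤ → L2Z d) m) = 0 := by
      funext m
      simp
    simpa only [Set.mem_ofPred_eq, e] using zero_memℓp
  smul_mem' := fun c B hB => by
    have h := Memℓp.const_smul hB c
    have e : (fun m : ℤ => (1 + (m : ℂ) ^ 2) • (c • B) m)
        = c • fun m : ℤ => (1 + (m : ℂ) ^ 2) • B m := by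
      funext m
      simp [smul_comm c]
    simpa only [Set.mem_ofPred_eq, e] using h

/-- The space `ℓ^{2,2}(ℤ; ℓ²(ℤ^d))`, as a type of its own so that it carries its weighted norm
and not the product topology. -/
def X2 (d : ℕ) : Type := harmonicsSubmodule d

instance (d : ℕ) : AddCommGroup (X2 d) := inferInstanceAs (AddCommGroup (harmonicsSubmodule d))

instance (d : ℕ) : Module ℂ (X2 d) := inferInstanceAs (Module ℂ (harmonicsSubmodule d))

/-- The `m`-th harmonic `B^{(m)}`. -/
def X2.harm {d : ℕ} (B : X2 d) (m : ℤ) : L2Z d := B.1 m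

/-- The map `B ↦ ((1+m²) B^{(m)})_m` into `ℓ²(ℤ; ℓ²(ℤ^d))`. -/
def X2.weight (d : ℕ) : X2 d →ₗ[ℂ] lp (fun _ : ℤ => L2Z d) 2 where
  toFun B := ⟨fun m => (1 + (m : ℂ) ^ 2) • B.harm m, B.2⟩
  map_add' _ _ := by
    apply lp.ext
    funext m
    exact smul_add _ _ _
  map_smul' c B := by
    apply lp.ext
    funext m
    exact smul_comm (1 + (m : ℂ) ^ 2) c (B.harm m)

theorem X2.weight_injective (d : ℕ) : Function.Injective (X2.weight d) := by
  intro B C h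
  apply Subtype.ext
  funext m
  have h1 : (1 + (m : ℂ) ^ 2) • B.harm m = (1 + (m : ℂ) ^ 2) • C.harm m :=
    congrArg (fun F : lp (fun _ : ℤ => L2Z d) 2 => F m) h
  have h2 : (1 + (m : ℂ) ^ 2) ≠ 0 := by
    have h3 : (1 + (m : ℝ) ^ 2) ≠ 0 := by positivity
    exact_mod_cast h3
  exact smul_right_injective _ h2 h1

/-- The norm `‖B‖ = (∑_m (1+m²)² ‖B^{(m)}‖²)^{1/2}`. -/
instance (d : ℕ) : NormedAddCommGroup (X2 d) :=
  NormedAddCommGroup.induced (X2 d) (lp (fun _ : ℤ => L2Z d) 2) (X2.weight d)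
    (X2.weight_injective d)

instance (d : ℕ) : NormedSpace ℂ (X2 d) :=
  NormedSpace.induced ℂ (X2 d) (lp (fun _ : ℤ => L2Z d) 2) (X2.weight d)

/-- The `n`-th component of the periodic function with harmonics `B`:
`τ ↦ ∑_m B^{(m)}_n e^{imτ}`. -/
def profile {d : ℕ} (B : X2 d) (n : Fin d → ℤ) (τ : ℝ) : ℂ :=
  ∑' m : ℤ, B.harm m n * Complex.exp (Complex.I * m * τ)

/-- The breather equation in Fourier coefficients, for real harmonics that are even in `m`. -/
structure IsBreather {d : ℕ} (p : ℕ) (ε ω : ℝ) (A : X2 d) : Prop where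
  real : ∀ m n, (A.harm m n).im = 0
  even : ∀ m, A.harm (-m) = A.harm m
  eq : ∀ (m : ℤ) (n : Fin d → ℤ),
    (1 - (m : ℂ) ^ 2 * (ω : ℂ) ^ 2) * A.harm m n
      + (ε : ℂ) / (2 * Real.pi) * (∫ τ in (-Real.pi)..Real.pi,
          profile A n τ ^ (1 + 2 * p) * Complex.exp (-(Complex.I * m * τ)))
      = (ε : ℂ) * lap (A.harm m) n

/-- `ω(ε)`, `A(ε)` is an analytic branch of breathers on `(0, ε₁)` that bifurcates from the dNLS
soliton `A₀` with frequency parameter `Ω`. -/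
structure IsBreatherBranch {d : ℕ} (p : ℕ) (Ω : ℝ) (A₀ : L2Z d) (ε₁ C₁ : ℝ)
    (ω : ℝ → ℝ) (A : ℝ → X2 d) : Prop where
  analytic_freq : AnalyticOnNhd ℝ ω (Set.Ioo 0 ε₁)
  analytic_harm : AnalyticOnNhd ℝ A (Set.Ioo 0 ε₁)
  breather : ∀ ε ∈ Set.Ioo 0 ε₁, IsBreather p ε (ω ε) (A ε)
  freq_bound : ∀ ε ∈ Set.Ioo 0 ε₁, |ω ε - 1 + ε * Ω / 2| ≤ C₁ * ε ^ 2
  harm_bound : ∀ ε ∈ Set.Ioo 0 ε₁,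
    ‖(A ε).harm 0‖ + ‖(A ε).harm 1 - A₀‖ + ∑' m : ℕ, ‖(A ε).harm (m + 2)‖ ≤ C₁ * ε

/-- The Floquet spectral problem of the breather `A` in Fourier coefficients, with eigenvalue
`lam` and eigenvector `B`. -/
structure IsFloquetEigenpair {d : ℕ} (p : ℕ) (ε ω : ℝ) (A : X2 d) (lam : ℂ) (B : X2 d) :
    Prop where
  ne_zero : B ≠ 0
  eq : ∀ (m : ℤ) (n : Fin d → ℤ),
    (1 + (lam + Complex.I * m * ω) ^ 2) * B.harm m n
      + (ε : ℂ) * (1 + 2 * p) / (2 * Real.pi) * (∫ τ in (-Real.pi)..Real.pi,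
          profile A n τ ^ (2 * p) * profile B n τ * Complex.exp (-(Complex.I * m * τ)))
      = (ε : ℂ) * lap (B.harm m) n

end KGBreather

end

open scoped Topology

noncomputable section

namespace KGBreather

/-! The theorem is a Lyapunov-Schmidt reduction arranged so that the limit ε → 0 becomes regular. In
the weighted unknown y_m = (1 + m²) B^{(m)} the space ℓ^{2,2} becomes ℓ², and multiplication by a
periodic function becomes the bounded convolution operator `conv`, because ∑ 1/(1 + m²) converges;
`integral_profile_pow_mul` translates the integrals.

Put λ = εη and σ = (1 - ω²)/ε. For m = ±1 the symbol 1 + (λ + imω)² contains a factor ε. Dividing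
only these two equations by ε gives `floq`, which is polynomial in (ε, ω, σ, η) and the potential W,
and is equivalent to the original problem for ε ≠ 0 (`floq_eq_zero_iff`). At ε = 0 it is diagonal
with symbol 1 - m² ≠ 0 off m = ±1, up to the weight. On m = ±1, in the variables b₊ ± i b₋, it is
𝒥ℋ'' - 2η (`floq_zero_resEmb`).

The eigenvalue 2Λ lies off the continuous spectrum and the potential is compact, so the Fredholm
alternative applies. Simplicity then makes 𝒥ℋ'' - 2Λ, bordered by its eigenvector, bijective
(`exists_bordering`), and so is the bordered Floquet operator (`bordered_floq_bijective`). The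
implicit function theorem gives the eigenvector and η as analytic functions of the parameters (ε, ω,
σ, W), and an a priori bound makes the kernel unique in a fixed η-disc (`exists_kernel_branch`).
Along a breather branch the parameters are O(ε) away from their limit (`pathParams_isBigO`), which
yields every estimate.

Breathers come from the same rescaled operator with η = 0 and the choice ω = 1 - εΩ/2. Time
translation puts an odd vector, b = (0, 𝒜), in the kernel of the linearization. On even sequences
only L₊ remains, and it is invertible (`symmetrized_bijective`). Reality follows from conjugation
symmetry and uniqueness in the implicit function theorem. -/

/-! ### Operators on sequences of harmonics -/

/-- The space `ℓ²(ℤ; ℓ²(ℤ^d))`. -/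
abbrev Harm (d : ℕ) : Type := lp (fun _ : ℤ => L2Z d) 2

/-- The inverse weight `1 / (1 + m²)`. -/
def winv (m : ℤ) : ℝ := (1 + (m : ℝ) ^ 2)⁻¹

theorem winv_pos (m : ℤ) : 0 < winv m := by unfold winv; positivity

theorem winv_ne_zero (m : ℤ) : ((winv m : ℝ) : ℂ) ≠ 0 := by
  exact_mod_cast (winv_pos m).ne'

theorem winv_neg (m : ℤ) : winv (-m) = winv m := by simp [winv]

theorem winv_le_one (m : ℤ) : winv m ≤ 1 := by
  unfold winv
  exact inv_le_one_of_one_le₀ (by nlinarith [sq_nonneg (m : ℝ)])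

theorem weight_mul_winv (m : ℤ) : (1 + (m : ℂ) ^ 2) * (winv m : ℂ) = 1 := by
  have h : (1 + (m : ℝ) ^ 2) * winv m = 1 := by
    unfold winv
    exact mul_inv_cancel₀ (by positivity)
  exact_mod_cast h

theorem winv_mul_weight (m : ℤ) : (winv m : ℂ) * (1 + (m : ℂ) ^ 2) = 1 := by
  rw [mul_comm, weight_mul_winv]

theorem norm_winv (m : ℤ) : ‖(winv m : ℂ)‖ = winv m := by
  rw [Complex.norm_real, Real.norm_of_nonneg (winv_pos m).le]

theorem summable_winv : Summable winv := by
  have h : Summable fun m : ℤ => 1 / (m : ℝ) ^ 2 := Real.summable_one_div_int_pow.mpr one_lt_two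
  refine Summable.of_norm_bounded_eventually h ?_
  have : ({0} : Set ℤ)ᶜ ∈ Filter.cofinite := (Set.finite_singleton 0).compl_mem_cofinite
  filter_upwards [this] with m hm
  have hm' : (0 : ℝ) < (m : ℝ) ^ 2 := by
    have : m ≠ 0 := by simpa using hm
    positivity
  rw [Real.norm_of_nonneg (winv_pos m).le, winv, ← one_div]
  exact one_div_le_one_div_of_le hm' (by linarith)

theorem norm_harm_apply_le {d : ℕ} (y : Harm d) (m : ℤ) : ‖y m‖ ≤ ‖y‖ :=
  lp.norm_apply_le_norm two_ne_zero y m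

theorem norm_seq_apply_le {d : ℕ} (f : L2Z d) (n : Fin d → ℤ) : ‖f n‖ ≤ ‖f‖ :=
  lp.norm_apply_le_norm two_ne_zero f n

/-- The pointwise product of `ℓ²(ℤ^d)` as a bounded bilinear map. -/
def mulOp (d : ℕ) : L2Z d →L[ℂ] L2Z d →L[ℂ] L2Z d :=
  LinearMap.mkContinuous
    { toFun := fun f => lp.mapCLM 2 (fun n => f n • ContinuousLinearMap.id ℂ ℂ) (K := ‖f‖)
        (norm_nonneg _) (fun n => by simpa [norm_smul] using norm_seq_apply_le f n)
      map_add' := fun f g => by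
        ext h n
        simp [add_mul]
      map_smul' := fun c f => by
        ext h n
        simp [mul_assoc] }
    1 (fun f => by
      rw [one_mul]
      exact lp.norm_mapCLM_le 2 (fun n => f n • ContinuousLinearMap.id ℂ ℂ) (norm_nonneg _)
        (fun n => by simpa [norm_smul] using norm_seq_apply_le f n))

@[simp] theorem mulOp_apply {d : ℕ} (f g : L2Z d) (n : Fin d → ℤ) :
    mulOp d f g n = f n * g n := by
  simp [mulOp]

theorem norm_mulOp_le {d : ℕ} (f : L2Z d) : ‖mulOp d f‖ ≤ ‖f‖ := by
  simpa using (mulOp d).le_of_opNorm_le (LinearMap.mkContinuous_norm_le _ zero_le_one _) f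

/-- The operator on sequences of harmonics that acts as `T` on each harmonic. -/
def diagOp {d : ℕ} (T : L2Z d →L[ℂ] L2Z d) : Harm d →L[ℂ] Harm d :=
  lp.mapCLM 2 (fun _ => T) (norm_nonneg T) (fun _ => le_rfl)

@[simp] theorem diagOp_apply {d : ℕ} (T : L2Z d →L[ℂ] L2Z d) (y : Harm d) (m : ℤ) :
    diagOp T y m = T (y m) := by
  simp [diagOp]

theorem norm_diagOp_le {d : ℕ} (T : L2Z d →L[ℂ] L2Z d) : ‖diagOp T‖ ≤ ‖T‖ :=
  lp.norm_mapCLM_le 2 _ _ _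

/-- The Fourier multiplier with a bounded symbol. -/
def multOp (d : ℕ) (a : ℤ → ℂ) (K : ℝ) (ha : ∀ m, ‖a m‖ ≤ K) : Harm d →L[ℂ] Harm d :=
  lp.mapCLM 2 (fun m => a m • ContinuousLinearMap.id ℂ (L2Z d)) (K := K)
    ((norm_nonneg _).trans (ha 0))
    (fun m => by
      rw [norm_smul]
      exact (mul_le_of_le_one_right (norm_nonneg _) ContinuousLinearMap.norm_id_le).trans (ha m))

@[simp] theorem multOp_apply {d : ℕ} (a : ℤ → ℂ) (K : ℝ) (ha : ∀ m, ‖a m‖ ≤ K) (y : Harm d)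
    (m : ℤ) : multOp d a K ha y m = a m • y m := by
  simp [multOp]

/-- Relabelling of the harmonics. -/
def reindexOp (d : ℕ) (e : ℤ ≃ ℤ) : Harm d →L[ℂ] Harm d :=
  LinearMap.mkContinuous
    { toFun := fun y => ⟨fun m => y (e m), by
        have h2 : 0 < (2 : ENNReal).toReal := by norm_num
        refine memℓp_gen ?_
        exact ((lp.memℓp y).summable h2).comp_injective e.injective⟩
      map_add' := fun _ _ => rfl
      map_smul' := fun _ _ => rfl }
    1
    (fun y => by
      have h2 : 0 < (2 : ENNReal).toReal := by norm_num
      rw [one_mul]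
      refine lp.norm_le_of_tsum_le h2 (norm_nonneg _) ?_
      rw [lp.norm_rpow_eq_tsum h2 y]
      exact (e.tsum_eq (fun n => ‖y n‖ ^ (2 : ENNReal).toReal)).le)

theorem norm_reindexOp_le {d : ℕ} (e : ℤ ≃ ℤ) : ‖reindexOp d e‖ ≤ 1 :=
  LinearMap.mkContinuous_norm_le _ zero_le_one _

/-- The shift `(y_m) ↦ (y_{m-k})` of harmonics. -/
def shiftHarm (d : ℕ) (k : ℤ) : Harm d →L[ℂ] Harm d := reindexOp d (Equiv.subRight k)

@[simp] theorem shiftHarm_apply {d : ℕ} (k : ℤ) (y : Harm d) (m : ℤ) :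
    shiftHarm d k y m = y (m - k) := rfl

theorem shiftHarm_mul {d : ℕ} (k l : ℤ) :
    shiftHarm d k * shiftHarm d l = shiftHarm d (k + l) := by
  ext y m
  simp [sub_sub]

theorem shiftHarm_zero {d : ℕ} : shiftHarm d 0 = 1 := by
  ext y m
  simp

/-- The contribution of the harmonic `y_k / (1 + k²)` to a convolution. -/
def convTerm {d : ℕ} (y : Harm d) (k : ℤ) : Harm d →L[ℂ] Harm d :=
  (winv k : ℂ) • (shiftHarm d k * diagOp (mulOp d (y k)))

theorem convTerm_apply {d : ℕ} (y z : Harm d) (k m : ℤ) (n : Fin d → ℤ) :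
    convTerm y k z m n = (winv k : ℂ) * y k n * z (m - k) n := by
  have h : convTerm y k z m n = (winv k : ℂ) * (mulOp d (y k) (z (m - k)) n) := rfl
  rw [h, mulOp_apply, mul_assoc]

theorem norm_convTerm_le {d : ℕ} (y : Harm d) (k : ℤ) : ‖convTerm y k‖ ≤ winv k * ‖y k‖ := by
  rw [convTerm, norm_smul, norm_winv]
  refine mul_le_mul_of_nonneg_left ?_ (winv_pos k).le
  refine (norm_mul_le _ _).trans ?_
  refine (mul_le_of_le_one_left (norm_nonneg _) (norm_reindexOp_le _)).trans ?_
  exact (norm_diagOp_le _).trans (norm_mulOp_le _)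

theorem summable_winv_mul_norm {d : ℕ} (y : Harm d) : Summable fun k => winv k * ‖y k‖ :=
  Summable.of_nonneg_of_le (fun k => mul_nonneg (winv_pos k).le (norm_nonneg _))
    (fun k => mul_le_mul_of_nonneg_left (norm_harm_apply_le y k) (winv_pos k).le)
    (summable_winv.mul_right _)

theorem tsum_winv_mul_norm_le {d : ℕ} (y : Harm d) :
    ∑' k, winv k * ‖y k‖ ≤ (∑' k, winv k) * ‖y‖ := by
  rw [← tsum_mul_right]
  exact (summable_winv_mul_norm y).tsum_le_tsum
    (fun k => mul_le_mul_of_nonneg_left (norm_harm_apply_le y k) (winv_pos k).le)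
    (summable_winv.mul_right _)

/-- Summability in operator norm makes the convolution a series of bounded operators, so that
evaluations and commutation can be handled term by term. -/
theorem summable_convTerm {d : ℕ} (y : Harm d) : Summable (convTerm y) :=
  Summable.of_norm_bounded (summable_winv_mul_norm y) (norm_convTerm_le y)

theorem norm_tsum_convTerm_le {d : ℕ} (y : Harm d) :
    ‖∑' k, convTerm y k‖ ≤ ∑' k, winv k * ‖y k‖ :=
  tsum_of_norm_bounded (summable_winv_mul_norm y).hasSum (norm_convTerm_le y)

/-- Multiplication, on the level of Fourier coefficients, by the function whose harmonics are
`y_m / (1 + m²)`. -/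
def conv (d : ℕ) : Harm d →L[ℂ] Harm d →L[ℂ] Harm d :=
  LinearMap.mkContinuous
    { toFun := fun y => ∑' k, convTerm y k
      map_add' := fun y z => by
        rw [← (summable_convTerm y).tsum_add (summable_convTerm z)]
        refine tsum_congr fun k => ?_
        ext x m n
        simp only [add_apply, lp.coeFn_add, Pi.add_apply, convTerm_apply]
        ring
      map_smul' := fun c y => by
        rw [RingHom.id_apply, ← tsum_const_smul'']
        refine tsum_congr fun k => ?_
        ext x m n
        simp only [smul_apply, lp.coeFn_smul, Pi.smul_apply, convTerm_apply,
          smul_eq_mul]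
        ring }
    (∑' k, winv k) (fun y => (norm_tsum_convTerm_le y).trans (tsum_winv_mul_norm_le y))

/-- The bound by the ℓ¹ norm of the unweighted harmonics is the useful one: a breather branch is
assumed close to the soliton only in that norm, not in ℓ^{2,2}. -/
theorem norm_conv_le {d : ℕ} (y : Harm d) : ‖conv d y‖ ≤ ∑' k, winv k * ‖y k‖ :=
  norm_tsum_convTerm_le y

/-- The value of the `m`-th harmonic at `n` as a bounded functional. -/
def evalAt (d : ℕ) (m : ℤ) (n : Fin d → ℤ) : Harm d →L[ℂ] ℂ :=
  (lp.evalCLM ℂ (fun _ : Fin d → ℤ => ℂ) 2 n).comp (lp.evalCLM ℂ (fun _ : ℤ => L2Z d) 2 m)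

theorem evalAt_apply {d : ℕ} (m : ℤ) (n : Fin d → ℤ) (y : Harm d) : evalAt d m n y = y m n := rfl

theorem hasSum_conv_apply {d : ℕ} (y z : Harm d) (m : ℤ) (n : Fin d → ℤ) :
    HasSum (fun k => (winv k : ℂ) * y k n * z (m - k) n) (conv d y z m n) := by
  have h := (summable_convTerm y).hasSum
  have h1 := (ContinuousLinearMap.apply ℂ (Harm d) z).hasSum h
  have h2 := (evalAt d m n).hasSum h1
  simp only [ContinuousLinearMap.apply_apply, evalAt_apply,
    convTerm_apply] at h2
  exact h2

theorem conv_apply {d : ℕ} (y z : Harm d) (m : ℤ) (n : Fin d → ℤ) :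
    conv d y z m n = ∑' k, (winv k : ℂ) * y k n * z (m - k) n :=
  (hasSum_conv_apply y z m n).tsum_eq.symm

theorem harm_ext {d : ℕ} {y z : Harm d} (h : ∀ m n, y m n = z m n) : y = z := by
  ext m n
  exact h m n

/-! ### Absolutely convergent Fourier series -/

/-- The sum of the Fourier series with coefficients `c`. -/
def fourierSum (c : ℤ → ℂ) (τ : ℝ) : ℂ := ∑' m : ℤ, c m * Complex.exp (Complex.I * m * τ)

theorem norm_exp_I_mul_int_mul (m : ℤ) (τ : ℝ) : ‖Complex.exp (Complex.I * m * τ)‖ = 1 := by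
  have h : Complex.I * m * τ = ((m * τ : ℝ) : ℂ) * Complex.I := by push_cast; ring
  rw [h, Complex.norm_exp_ofReal_mul_I]

/-- The change of variables `(m, k) ↦ (k, m - k)`. -/
def convEquiv : ℤ × ℤ ≃ ℤ × ℤ where
  toFun x := (x.2, x.1 - x.2)
  invFun x := (x.1 + x.2, x.1)
  left_inv x := by simp
  right_inv x := by simp

theorem summable_norm_mul_sub {a c : ℤ → ℂ} (ha : Summable fun k => ‖a k‖)
    (hc : Summable fun k => ‖c k‖) :
    Summable fun x : ℤ × ℤ => ‖a x.2 * c (x.1 - x.2)‖ :=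
  (convEquiv.summable_iff (f := fun x : ℤ × ℤ => ‖a x.1 * c x.2‖)).mpr (ha.mul_norm hc)

theorem summable_norm_convolution {a c : ℤ → ℂ} (ha : Summable fun k => ‖a k‖)
    (hc : Summable fun k => ‖c k‖) : Summable fun m => ‖∑' k, a k * c (m - k)‖ := by
  have h := summable_norm_mul_sub ha hc
  refine Summable.of_nonneg_of_le (fun m => norm_nonneg _) (fun m => ?_) h.prod
  exact norm_tsum_le_tsum_norm (h.prod_factor m)

/-- Cauchy product: absolute convergence allows the double sum over (k, l) to be regrouped by m = k
+ l. -/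
theorem fourierSum_convolution {a c : ℤ → ℂ} (ha : Summable fun k => ‖a k‖)
    (hc : Summable fun k => ‖c k‖) (τ : ℝ) :
    fourierSum (fun m => ∑' k, a k * c (m - k)) τ = fourierSum a τ * fourierSum c τ := by
  have key : ∀ {b : ℤ → ℂ}, (Summable fun k => ‖b k‖) →
      Summable fun k : ℤ => ‖b k * Complex.exp (Complex.I * k * τ)‖ := by
    intro b hb
    simpa only [norm_mul, norm_exp_I_mul_int_mul, mul_one] using hb
  have h := summable_norm_mul_sub (key ha) (key hc)
  unfold fourierSum
  rw [tsum_mul_tsum_of_summable_norm (key ha) (key hc), ← convEquiv.tsum_eq]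
  have h' : Summable fun x : ℤ × ℤ => (fun z : ℤ × ℤ =>
      a z.1 * Complex.exp (Complex.I * z.1 * τ) * (c z.2 * Complex.exp (Complex.I * z.2 * τ)))
        (convEquiv x) := h.of_norm
  rw [h'.tsum_prod]
  refine tsum_congr fun m => ?_
  rw [← tsum_mul_right]
  refine tsum_congr fun k => ?_
  have e : Complex.exp (Complex.I * m * τ)
      = Complex.exp (Complex.I * k * τ) * Complex.exp (Complex.I * (m - k : ℤ) * τ) := by
    rw [← Complex.exp_add]
    congr 1
    push_cast
    ring
  simp only [convEquiv, Equiv.coe_fn_mk]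
  rw [e]
  ring

theorem integral_exp_I_mul_int_mul (k : ℤ) :
    ∫ τ in (-Real.pi)..Real.pi, Complex.exp (Complex.I * k * τ)
      = if k = 0 then 2 * (Real.pi : ℂ) else 0 := by
  split_ifs with h
  · subst h
    simp
    ring
  · have hk : Complex.I * k ≠ 0 := mul_ne_zero Complex.I_ne_zero (by exact_mod_cast h)
    rw [integral_exp_mul_complex hk, div_eq_zero_iff]
    left
    rw [sub_eq_zero, Complex.exp_eq_exp_iff_exists_int]
    -- The exponents ikπ and -ikπ differ by k periods 2πi.
    refine ⟨k, ?_⟩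
    push_cast
    ring

/-- Uniform absolute convergence permits termwise integration, and orthogonality keeps only k = m.
-/
theorem integral_fourierSum_mul_exp {c : ℤ → ℂ} (hc : Summable fun k => ‖c k‖) (m : ℤ) :
    ∫ τ in (-Real.pi)..Real.pi, fourierSum c τ * Complex.exp (-(Complex.I * m * τ))
      = 2 * (Real.pi : ℂ) * c m := by
  let f : ℤ → C(ℝ, ℂ) := fun k =>
    ⟨fun τ => c k * Complex.exp (Complex.I * (k - m : ℤ) * τ), by fun_prop⟩
  have hf : Summable fun k => ‖(f k).restrict
      (⟨Set.uIcc (-Real.pi) Real.pi, isCompact_uIcc⟩ : TopologicalSpace.Compacts ℝ)‖ := by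
    refine Summable.of_nonneg_of_le (fun _ => norm_nonneg _) (fun k => ?_) hc
    refine (ContinuousMap.norm_le _ (norm_nonneg _)).mpr fun x => ?_
    simp only [f, ContinuousMap.restrict_apply, ContinuousMap.coe_mk]
    rw [norm_mul, norm_exp_I_mul_int_mul, mul_one]
  have h := intervalIntegral.hasSum_intervalIntegral_of_summable_norm hf
  have e : ∀ τ : ℝ, ∑' k, f k τ = fourierSum c τ * Complex.exp (-(Complex.I * m * τ)) := by
    intro τ
    rw [fourierSum, ← tsum_mul_right]
    refine tsum_congr fun k => ?_
    simp only [f, ContinuousMap.coe_mk]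
    rw [mul_assoc (c k), ← Complex.exp_add]
    congr 2
    push_cast
    ring
  simp only [e] at h
  have hs : HasSum (fun k => ∫ τ in (-Real.pi)..Real.pi, f k τ) (2 * (Real.pi : ℂ) * c m) := by
    have : (fun k => ∫ τ in (-Real.pi)..Real.pi, f k τ)
        = fun k => if k = m then 2 * (Real.pi : ℂ) * c m else 0 := by
      funext k
      simp only [f, ContinuousMap.coe_mk, intervalIntegral.integral_const_mul,
        integral_exp_I_mul_int_mul, sub_eq_zero]
      split_ifs with hk
      · rw [hk]; ring
      · simp
    rw [this]
    exact hasSum_ite_eq m _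
  exact h.unique hs

/-! ### The weighted space of harmonics and the convolution -/

/-- The multiplier `1 / (1 + m²)`. -/
def jOp (d : ℕ) : Harm d →L[ℂ] Harm d :=
  multOp d (fun m => (winv m : ℂ)) 1 (fun m => (norm_winv m).trans_le (winv_le_one m))

@[simp] theorem jOp_apply {d : ℕ} (y : Harm d) (m : ℤ) :
    jOp d y m = (winv m : ℂ) • y m := multOp_apply _ _ _ _ _

theorem jOp_apply_apply {d : ℕ} (y : Harm d) (m : ℤ) (n : Fin d → ℤ) :
    jOp d y m n = (winv m : ℂ) * y m n := by
  rw [jOp_apply]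
  rfl

/-- Multiplication by the weight identifies `ℓ^{2,2}(ℤ; ℓ²(ℤ^d))` with `ℓ²(ℤ; ℓ²(ℤ^d))`. -/
def weightEquiv (d : ℕ) : X2 d ≃ₗᵢ[ℂ] Harm d where
  toLinearEquiv := LinearEquiv.ofBijective (X2.weight d) ⟨X2.weight_injective d, fun y => by
    have e : (fun m : ℤ => (1 + (m : ℂ) ^ 2) • ((winv m : ℂ) • y m)) = fun m => y m := by
      funext m
      rw [smul_smul, weight_mul_winv, one_smul]
    have hm : (fun m : ℤ => (winv m : ℂ) • y m) ∈ harmonicsSubmodule d := by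
      change Memℓp (fun m : ℤ => (1 + (m : ℂ) ^ 2) • ((winv m : ℂ) • y m)) 2
      rw [e]
      exact lp.memℓp y
    refine ⟨⟨_, hm⟩, ?_⟩
    apply lp.ext
    exact e⟩
  norm_map' _ := rfl

theorem weightEquiv_apply {d : ℕ} (B : X2 d) (m : ℤ) :
    weightEquiv d B m = (1 + (m : ℂ) ^ 2) • B.harm m := rfl

theorem harm_eq_jOp {d : ℕ} (B : X2 d) (m : ℤ) : B.harm m = jOp d (weightEquiv d B) m := by
  rw [jOp_apply, weightEquiv_apply, smul_smul, winv_mul_weight, one_smul]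

theorem harm_symm {d : ℕ} (y : Harm d) (m : ℤ) :
    ((weightEquiv d).symm y).harm m = (winv m : ℂ) • y m := by
  rw [harm_eq_jOp, LinearIsometryEquiv.apply_symm_apply, jOp_apply]

theorem summable_norm_jOp {d : ℕ} (y : Harm d) : Summable fun m => ‖jOp d y m‖ := by
  simpa only [jOp_apply, norm_smul, norm_winv] using summable_winv_mul_norm y

theorem summable_norm_jOp_apply {d : ℕ} (y : Harm d) (n : Fin d → ℤ) :
    Summable fun m => ‖jOp d y m n‖ :=
  Summable.of_nonneg_of_le (fun _ => norm_nonneg _) (fun _ => norm_seq_apply_le _ n)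
    (summable_norm_jOp y)

theorem conv_apply_eq {d : ℕ} (y z : Harm d) (m : ℤ) (n : Fin d → ℤ) :
    conv d y z m n = ∑' k, jOp d y k n * z (m - k) n := by
  simp only [conv_apply, jOp_apply_apply]

theorem profile_eq_fourierSum {d : ℕ} (B : X2 d) (n : Fin d → ℤ) (τ : ℝ) :
    profile B n τ = fourierSum (fun m => jOp d (weightEquiv d B) m n) τ := by
  unfold profile fourierSum
  simp only [harm_eq_jOp]

/-- `conv` removes the weight from its first argument only; the second enters as it is, and its
absolute summability has to be carried separately. -/
theorem fourierSum_conv {d : ℕ} (y z : Harm d) (n : Fin d → ℤ)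
    (hz : Summable fun m => ‖z m n‖) :
    (Summable fun m => ‖conv d y z m n‖) ∧
      ∀ τ, fourierSum (fun m => conv d y z m n) τ
        = fourierSum (fun m => jOp d y m n) τ * fourierSum (fun m => z m n) τ := by
  simp only [conv_apply_eq]
  exact ⟨summable_norm_convolution (c := fun m => z m n) (summable_norm_jOp_apply y n) hz,
    fourierSum_convolution (c := fun m => z m n) (summable_norm_jOp_apply y n) hz⟩

theorem fourierSum_conv_pow {d : ℕ} (y z : Harm d) (n : Fin d → ℤ) (k : ℕ) :
    (Summable fun m => ‖((conv d y) ^ k) (jOp d z) m n‖) ∧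
      ∀ τ, fourierSum (fun m => ((conv d y) ^ k) (jOp d z) m n) τ
        = fourierSum (fun m => jOp d y m n) τ ^ k * fourierSum (fun m => jOp d z m n) τ := by
  induction k with
  | zero => simpa only [pow_zero, one_mul] using ⟨summable_norm_jOp_apply z n, fun _ => rfl⟩
  | succ k ih =>
    have e : ((conv d y) ^ (k + 1)) (jOp d z) = conv d y (((conv d y) ^ k) (jOp d z)) := by
      rw [pow_succ']
      rfl
    rw [e]
    obtain ⟨h1, h2⟩ := fourierSum_conv y (((conv d y) ^ k) (jOp d z)) n ih.1
    refine ⟨h1, fun τ => ?_⟩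
    rw [h2, ih.2, pow_succ', mul_assoc]

theorem integral_profile_pow_mul {d : ℕ} (A B : X2 d) (k : ℕ) (m : ℤ) (n : Fin d → ℤ) :
    ∫ τ in (-Real.pi)..Real.pi,
        profile A n τ ^ k * profile B n τ * Complex.exp (-(Complex.I * m * τ))
      = 2 * (Real.pi : ℂ) * ((conv d (weightEquiv d A)) ^ k) (jOp d (weightEquiv d B)) m n := by
  obtain ⟨h1, h2⟩ := fourierSum_conv_pow (weightEquiv d A) (weightEquiv d B) n k
  rw [← integral_fourierSum_mul_exp h1]
  simp only [profile_eq_fourierSum, h2]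

/-! ### Spectrum of the discrete Laplacian -/

theorem inner_shiftOp_left {d : ℕ} (k : Fin d → ℤ) (f g : L2Z d) :
    inner ℂ (shiftOp k f) g = inner ℂ f (shiftOp (-k) g) := by
  rw [lp.inner_eq_tsum, lp.inner_eq_tsum,
    ← (Equiv.addRight k).tsum_eq (fun n => inner ℂ (f n) (shiftOp (-k) g n))]
  refine tsum_congr fun n => ?_
  change inner ℂ (f (n + k)) (g n) = inner ℂ (f (n + k)) (g (n + k + -k))
  rw [add_neg_cancel_right]

theorem adjoint_shiftOp {d : ℕ} (k : Fin d → ℤ) :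
    star (shiftOp k : L2Z d →L[ℂ] L2Z d) = shiftOp (-k) := by
  rw [ContinuousLinearMap.star_eq_adjoint]
  symm
  rw [ContinuousLinearMap.eq_adjoint_iff]
  intro x y
  rw [inner_shiftOp_left, neg_neg]

theorem isSelfAdjoint_lapOp (d : ℕ) : IsSelfAdjoint (lapOp d) := by
  unfold IsSelfAdjoint lapOp
  rw [star_sum]
  refine Finset.sum_congr rfl fun j _ => ?_
  rw [star_sub, star_add, adjoint_shiftOp, adjoint_shiftOp, neg_neg, star_smul,
    ← ContinuousLinearMap.one_def, star_one, add_comm]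
  simp

theorem norm_shiftOp_le {d : ℕ} (k : Fin d → ℤ) : ‖(shiftOp k : L2Z d →L[ℂ] L2Z d)‖ ≤ 1 :=
  LinearMap.mkContinuous_norm_le _ zero_le_one _

/-- Adding 2d cancels the diagonal of Δ and leaves 2d shifts of norm at most 1. The spectrum of Δ
therefore lies in the disc of radius 2d about -2d. -/
theorem norm_lapOp_add_le (d : ℕ) : ‖lapOp d + ((2 * d : ℂ) • 1 : L2Z d →L[ℂ] L2Z d)‖ ≤ 2 * d := by
  have e : lapOp d + ((2 * d : ℂ) • 1 : L2Z d →L[ℂ] L2Z d)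
      = ∑ j : Fin d, (shiftOp (Pi.single j 1) + shiftOp (-Pi.single j 1)) := by
    rw [lapOp, Finset.sum_sub_distrib, ← ContinuousLinearMap.one_def, Finset.sum_const,
      Finset.card_univ, Fintype.card_fin, ← Nat.cast_smul_eq_nsmul ℂ, smul_smul,
      mul_comm (d : ℂ), sub_add_cancel]
  rw [e]
  refine (norm_sum_le _ _).trans ?_
  refine (Finset.sum_le_card_nsmul _ _ 2 fun j _ => ?_).trans ?_
  · refine (norm_add_le _ _).trans ?_
    have h1 := norm_shiftOp_le (d := d) (Pi.single j 1)
    have h2 := norm_shiftOp_le (d := d) (-Pi.single j 1)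
    linarith
  · simp [mul_comm]

/-- `z - Δ` is invertible for `z` outside `[-4d, 0]`. -/
theorem isUnit_sub_lapOp {d : ℕ} {z : ℂ}
    (hz : ∀ x : ℝ, x ∈ Set.Icc (-(4 * (d : ℝ))) 0 → z ≠ x) :
    IsUnit (z • (1 : L2Z d →L[ℂ] L2Z d) - lapOp d) := by
  by_contra hcon
  have hmem : z ∈ spectrum ℂ (lapOp d) := by
    rw [spectrum.mem_iff, Algebra.algebraMap_eq_smul_one]
    exact hcon
  -- The spectrum is real by self-adjointness, and the disc about -2d meets the real axis in [-4d,
  -- 0].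
  have hre : z = z.re := (isSelfAdjoint_lapOp d).mem_spectrum_eq_re hmem
  have hmem2 : z + 2 * d ∈ spectrum ℂ (lapOp d + ((2 * d : ℂ) • 1 : L2Z d →L[ℂ] L2Z d)) := by
    rw [spectrum.mem_iff, Algebra.algebraMap_eq_smul_one, add_smul, add_sub_add_right_eq_sub]
    exact hcon
  have hn : ‖z + 2 * d‖ ≤ 2 * d := by
    refine (spectrum.norm_le_norm_mul_of_mem hmem2).trans ?_
    have h1 : ‖(1 : L2Z d →L[ℂ] L2Z d)‖ ≤ 1 := ContinuousLinearMap.norm_id_le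
    have h2 := norm_lapOp_add_le d
    calc _ ≤ ‖lapOp d + ((2 * d : ℂ) • 1 : L2Z d →L[ℂ] L2Z d)‖ * 1 := by gcongr
      _ ≤ 2 * d := by rwa [mul_one]
  have hn' : |z.re + 2 * d| ≤ 2 * d := by
    rw [hre] at hn
    have : ((z.re : ℂ) + 2 * d) = ((z.re + 2 * d : ℝ) : ℂ) := by push_cast; ring
    rwa [this, Complex.norm_real, Real.norm_eq_abs] at hn
  rw [abs_le] at hn'
  exact hz z.re ⟨by linarith, by linarith⟩ hre

/-! ### Compactness of the potential and the Fredholm alternative -/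

theorem isCompactOperator_mulOp_single {d : ℕ} (n : Fin d → ℤ) (c : ℂ) :
    IsCompactOperator (mulOp d (lp.single 2 n c)) := by
  have e : mulOp d (lp.single 2 n c)
      = ((lp.singleContinuousLinearMap ℂ (fun _ : Fin d → ℤ => ℂ) 2 n).comp
          (c • ContinuousLinearMap.id ℂ ℂ)).comp
        (lp.evalCLM ℂ (fun _ : Fin d → ℤ => ℂ) 2 n) := by
    ext f k
    have h1 : mulOp d (lp.single 2 n c) f k = (Pi.single n c : (Fin d → ℤ) → ℂ) k * f k :=
      mulOp_apply _ _ _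
    rw [h1]
    change _ = (Pi.single n (c * f n) : (Fin d → ℤ) → ℂ) k
    by_cases hk : k = n
    · subst hk; simp
    · simp [hk]
  rw [e]
  exact (isCompactOperator_of_locallyCompactSpace_rng
    ((lp.singleContinuousLinearMap ℂ (fun _ : Fin d → ℤ => ℂ) 2 n).comp
      (c • ContinuousLinearMap.id ℂ ℂ))).comp_clm _

/-- The finitely supported truncations of f converge in ℓ², hence their multiplication operators, of
finite rank, converge in operator norm. -/
theorem isCompactOperator_mulOp {d : ℕ} (f : L2Z d) : IsCompactOperator (mulOp d f) := by
  have h := (mulOp d).hasSum (lp.hasSum_single (by norm_num : (2 : ENNReal) ≠ ⊤) f)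
  refine isCompactOperator_of_tendsto h (Filter.Eventually.of_forall fun s => ?_)
  refine Finset.sum_induction _ (fun T : L2Z d →L[ℂ] L2Z d => IsCompactOperator T)
    (fun a b ha hb => ha.add hb) isCompactOperator_zero
    (fun n _ => isCompactOperator_mulOp_single n (f n))

theorem mulOp_pow_apply {d : ℕ} (f g : L2Z d) (k : ℕ) (n : Fin d → ℤ) :
    ((mulOp d f) ^ k) g n = f n ^ k * g n := by
  induction k with
  | zero => simp
  | succ k ih =>
    have e : ((mulOp d f) ^ (k + 1)) g = mulOp d f (((mulOp d f) ^ k) g) := by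
      rw [pow_succ']
      rfl
    rw [e, mulOp_apply, ih]
    ring

/-- For real A the absolute value disappears, |A|^{2p} = A^{2p}. This links the potential both to
compactness and to powers of the convolution. -/
theorem potOp_eq_mulOp_pow {d : ℕ} (p : ℕ) {A : L2Z d} (hA : ∀ n, (A n).im = 0) :
    potOp p A = (mulOp d A) ^ (2 * p) := by
  ext f n
  rw [potOp_apply, mulOp_pow_apply]
  congr 1
  have h : A n = ((A n).re : ℂ) := by
    apply Complex.ext <;> simp [hA n]
  rw [h, Complex.norm_real, Real.norm_eq_abs, pow_mul, sq_abs, pow_mul]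
  push_cast
  rfl

/-- With p ≥ 1 the product contains at least one compact factor. -/
theorem isCompactOperator_potOp {d p : ℕ} (hp : 1 ≤ p) {A : L2Z d} (hA : ∀ n, (A n).im = 0) :
    IsCompactOperator (potOp p A) := by
  rw [potOp_eq_mulOp_pow p hA]
  obtain ⟨k, hk⟩ : ∃ k, 2 * p = k + 1 := ⟨2 * p - 1, by omega⟩
  rw [hk, pow_succ]
  exact (isCompactOperator_mulOp A).clm_comp _

/-- Fredholm alternative for compact perturbations of invertible operators. -/
theorem isUnit_add_of_isCompactOperator {E : Type*} [NormedAddCommGroup E] [NormedSpace ℂ E]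
    [CompleteSpace E] {S K : E →L[ℂ] E} (hS : IsUnit S) (hK : IsCompactOperator K)
    (hinj : ∀ x, S x + K x = 0 → x = 0) : IsUnit (S + K) := by
  obtain ⟨u, rfl⟩ := hS
  set R : E →L[ℂ] E := ((u⁻¹ : (E →L[ℂ] E)ˣ) : E →L[ℂ] E) with hR
  have hRK : IsCompactOperator (-(R * K)) := (hK.clm_comp R).neg
  have huR : (u : E →L[ℂ] E) * R = 1 := u.mul_inv
  -- Write S + K = S(1 + S⁻¹K). An eigenvector of the compact operator -S⁻¹K for the eigenvalue 1
  -- would lie in the kernel of S + K.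
  rcases hRK.hasEigenvalue_or_mem_resolventSet (one_ne_zero (α := ℂ)) with h | h
  · exfalso
    obtain ⟨x, hx⟩ := h.exists_hasEigenvector
    have h1 : -(R (K x)) = x := by simpa using hx.apply_eq_smul
    apply hx.2
    apply hinj
    have h2 : (u : E →L[ℂ] E) (R (K x)) = K x := by
      change ((u : E →L[ℂ] E) * R) (K x) = K x
      rw [huR]
      rfl
    conv_lhs => rw [← h1]
    rw [map_neg, h2, h1, neg_add_cancel]
  · rw [spectrum.mem_resolventSet_iff, map_one, sub_neg_eq_add] at h
    have : (u : E →L[ℂ] E) + K = u * (1 + R * K) := by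
      rw [mul_add, mul_one, ← mul_assoc, huR, one_mul]
    rw [this]
    exact u.isUnit.mul h

theorem isUnit_Lplus {d p : ℕ} (hp : 1 ≤ p) {Ω : ℝ} (hΩ : Ω ∉ Set.Icc (-(4 * (d : ℝ))) 0)
    {A : L2Z d} (hA : ∀ n, (A n).im = 0) (hker : ∀ f : L2Z d, Lplus p Ω A f = 0 → f = 0) :
    IsUnit (Lplus p Ω A) := by
  have e : Lplus p Ω A = ((Ω : ℂ) • (1 : L2Z d →L[ℂ] L2Z d) - lapOp d)
      + ((1 + 2 * p) * gam p : ℂ) • potOp p A := by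
    rw [Lplus, ContinuousLinearMap.one_def]
    abel
  rw [e]
  refine isUnit_add_of_isCompactOperator (isUnit_sub_lapOp ?_)
    (K := ((1 + 2 * p) * gam p : ℂ) • potOp p A)
    ((isCompactOperator_potOp hp hA).smul ((1 + 2 * p) * gam p : ℂ)) fun x hx => hker x ?_
  · intro x hx h
    exact hΩ (by rwa [Complex.ofReal_injective h])
  · rw [e]
    exact hx

/-! ### The linearized dNLS operator bordered by its eigenvector -/

/-- `𝒥ℋ''` for the zero potential, shifted by a spectral parameter. -/
def freeJH (d : ℕ) (Ω : ℝ) (z : ℂ) : (L2Z d × L2Z d) →L[ℂ] (L2Z d × L2Z d) :=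
  (-(((Ω : ℂ) • (1 : L2Z d →L[ℂ] L2Z d) - lapOp d) ∘L ContinuousLinearMap.snd ℂ (L2Z d) (L2Z d))
      - z • ContinuousLinearMap.fst ℂ (L2Z d) (L2Z d)).prod
    (((Ω : ℂ) • (1 : L2Z d →L[ℂ] L2Z d) - lapOp d) ∘L ContinuousLinearMap.fst ℂ (L2Z d) (L2Z d)
      - z • ContinuousLinearMap.snd ℂ (L2Z d) (L2Z d))

theorem freeJH_apply {d : ℕ} (Ω : ℝ) (z : ℂ) (x y : L2Z d) :
    freeJH d Ω z (x, y) = (-((Ω : ℂ) • y - lapOp d y) - z • x, (Ω : ℂ) • x - lapOp d x - z • y) :=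
  rfl

/-- The combinations x ± iy decouple the system into the scalar operators Ω ± iz - Δ, whose
invertibility off [-4d, 0] is known. -/
theorem isUnit_freeJH {d : ℕ} {Ω : ℝ} {z : ℂ} (hz : z ∉ contSpectrum d Ω) :
    IsUnit (freeJH d Ω z) := by
  have hU : ∀ s : ℂ, s = 1 ∨ s = -1 →
      IsUnit (((Ω : ℂ) + s * Complex.I * z) • (1 : L2Z d →L[ℂ] L2Z d) - lapOp d) := by
    intro s hs
    refine isUnit_sub_lapOp fun x hx h => hz ⟨Ω - x, ⟨by linarith [hx.2], by linarith [hx.1]⟩, ?_⟩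
    have hI := Complex.I_mul_I
    rcases hs with rfl | rfl
    · left
      push_cast
      linear_combination (-Complex.I) * h + z * hI
    · right
      push_cast
      linear_combination (Complex.I) * h + z * hI
  obtain ⟨inj1, sur1⟩ := ContinuousLinearMap.isUnit_iff_bijective.mp (hU 1 (Or.inl rfl))
  obtain ⟨inj2, sur2⟩ := ContinuousLinearMap.isUnit_iff_bijective.mp (hU (-1) (Or.inr rfl))
  have ap : ∀ (s : ℂ) (x : L2Z d),
      (((Ω : ℂ) + s * Complex.I * z) • (1 : L2Z d →L[ℂ] L2Z d) - lapOp d) x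
        = ((Ω : ℂ) + s * Complex.I * z) • x - lapOp d x := fun _ _ => rfl
  have hI := Complex.I_mul_I
  rw [ContinuousLinearMap.isUnit_iff_bijective]
  constructor
  · rw [injective_iff_map_eq_zero]
    rintro ⟨x, y⟩ h
    rw [freeJH_apply, Prod.mk_eq_zero] at h
    obtain ⟨h1, h2⟩ := h
    have e1 : x + Complex.I • y = 0 := by
      apply (injective_iff_map_eq_zero _).mp inj1
      rw [ap, map_add, map_smul]
      have : ((Ω : ℂ) + 1 * Complex.I * z) • (x + Complex.I • y)
          - (lapOp d x + Complex.I • lapOp d y)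
        = ((Ω : ℂ) • x - lapOp d x - z • y)
          - Complex.I • (-((Ω : ℂ) • y - lapOp d y) - z • x) := by
        linear_combination (norm := module) (z * hI) • y
      rw [this, h1, h2]
      simp
    have e2 : x - Complex.I • y = 0 := by
      apply (injective_iff_map_eq_zero _).mp inj2
      rw [ap, map_sub, map_smul]
      have : ((Ω : ℂ) + -1 * Complex.I * z) • (x - Complex.I • y)
          - (lapOp d x - Complex.I • lapOp d y)
        = ((Ω : ℂ) • x - lapOp d x - z • y)
          + Complex.I • (-((Ω : ℂ) • y - lapOp d y) - z • x) := by
        linear_combination (norm := module) (z * hI) • y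
      rw [this, h1, h2]
      simp
    have hx : x = 0 := by
      have : (2 : ℂ) • x = 0 := by
        linear_combination (norm := module) e1 + e2
      exact (smul_eq_zero.mp this).resolve_left two_ne_zero
    have hy : y = 0 := by
      rw [hx, zero_add] at e1
      exact (smul_eq_zero.mp e1).resolve_left Complex.I_ne_zero
    rw [hx, hy]
    rfl
  · rintro ⟨c1, c2⟩
    obtain ⟨u, hu⟩ := sur1 (c2 - Complex.I • c1)
    obtain ⟨v, hv⟩ := sur2 (c2 + Complex.I • c1)
    rw [ap] at hu hv
    -- This inverts u = x + iy, v = x - iy.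
    refine ⟨((2 : ℂ)⁻¹ • (u + v), (-(2 : ℂ)⁻¹ * Complex.I) • (u - v)), ?_⟩
    rw [freeJH_apply, Prod.mk.injEq]
    simp only [map_smul, map_add, map_sub]
    constructor
    · linear_combination (norm := module) (Complex.I / 2) • hu - (Complex.I / 2) • hv
        - (z / 2 * hI) • (u + v) - hI • c1
    · linear_combination (norm := module) (1 / 2 : ℂ) • hu + (1 / 2 : ℂ) • hv

theorem JH_apply {d : ℕ} (p : ℕ) (Ω : ℝ) (A x y : L2Z d) :
    JH p Ω A (x, y) = (-(Lminus p Ω A y), Lplus p Ω A x) := rfl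

theorem Lplus_apply {d : ℕ} (p : ℕ) (Ω : ℝ) (A x : L2Z d) :
    Lplus p Ω A x = (Ω : ℂ) • x + ((1 + 2 * p) * gam p : ℂ) • potOp p A x - lapOp d x := rfl

theorem Lminus_apply {d : ℕ} (p : ℕ) (Ω : ℝ) (A x : L2Z d) :
    Lminus p Ω A x = (Ω : ℂ) • x + (gam p : ℂ) • potOp p A x - lapOp d x := rfl

/-- Such x is killed by the square of 𝒥ℋ'' - 2Λ, so it lies in the one-dimensional generalized
eigenspace. The case c = 0 gives geometric simplicity; c ≠ 0 excludes a Jordan chain. -/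
theorem eq_smul_of_sub_sq_eq_zero {d p : ℕ} {Ω : ℝ} {A : L2Z d} {Lam : ℂ} {f : L2Z d × L2Z d}
    (heig : IsSimpleIsolatedEigenpair p Ω A Lam f) {x : L2Z d × L2Z d} {c : ℂ}
    (hx : JH p Ω A x - (2 * Lam) • x = c • f) : ∃ a : ℂ, x = a • f := by
  have hmem : ∀ z : L2Z d × L2Z d, ∀ c : ℂ, JH p Ω A z - (2 * Lam) • z = c • f →
      z ∈ Module.End.maxGenEigenspace (JH p Ω A : Module.End ℂ (L2Z d × L2Z d)) (2 * Lam) := by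
    intro z c hz
    rw [Module.End.mem_maxGenEigenspace]
    refine ⟨2, ?_⟩
    rw [pow_two, Module.End.mul_apply]
    have h1 : ((JH p Ω A : Module.End ℂ (L2Z d × L2Z d)) - (2 * Lam) • 1) z = c • f := hz
    rw [h1]
    change JH p Ω A (c • f) - (2 * Lam) • (c • f) = 0
    rw [map_smul, heig.eigen, smul_comm, sub_self]
  have hf := hmem f 0 (by rw [heig.eigen, sub_self, zero_smul])
  obtain ⟨a, ha⟩ := (finrank_eq_one_iff_of_nonzero' (⟨f, hf⟩ : Module.End.maxGenEigenspace
    (JH p Ω A : Module.End ℂ (L2Z d × L2Z d)) (2 * Lam))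
    (fun h => heig.ne_zero (congrArg Subtype.val h))).mp heig.simple ⟨x, hmem x c hx⟩
  exact ⟨a, (congrArg Subtype.val ha).symm⟩

/-- The linearized operator at a simple eigenvalue outside the continuous spectrum becomes
invertible when it is bordered by its eigenvector. -/
theorem exists_bordering {d p : ℕ} (hp : 1 ≤ p) {Ω : ℝ} {A : L2Z d} (hA : ∀ n, (A n).im = 0)
    {Lam : ℂ} {f : L2Z d × L2Z d} (heig : IsSimpleIsolatedEigenpair p Ω A Lam f)
    (hcont : 2 * Lam ∉ contSpectrum d Ω) :
    ∃ φ : (L2Z d × L2Z d) →L[ℂ] ℂ, φ f = 1 ∧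
      (∀ (b : L2Z d × L2Z d) (s : ℂ),
        JH p Ω A b - (2 * Lam) • b + s • f = 0 → φ b = 0 → b = 0 ∧ s = 0) ∧
      (∀ (c : L2Z d × L2Z d) (t : ℂ), ∃ (b : L2Z d × L2Z d) (s : ℂ),
        JH p Ω A b - (2 * Lam) • b + s • f = c ∧ φ b = t) := by
  obtain ⟨φ, hφ⟩ := SeparatingDual.exists_eq_one (R := ℂ) heig.ne_zero
  set pot : L2Z d →L[ℂ] L2Z d := potOp p A with hpot
  have hpotc : IsCompactOperator pot := isCompactOperator_potOp hp hA
  set K1 : (L2Z d × L2Z d) →L[ℂ] (L2Z d × L2Z d) :=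
    (ContinuousLinearMap.inl ℂ (L2Z d) (L2Z d)).comp
      ((-(gam p : ℂ)) • pot.comp (ContinuousLinearMap.snd ℂ (L2Z d) (L2Z d))) with hK1
  set K2 : (L2Z d × L2Z d) →L[ℂ] (L2Z d × L2Z d) :=
    (ContinuousLinearMap.inr ℂ (L2Z d) (L2Z d)).comp
      (((1 + 2 * p) * gam p : ℂ) • pot.comp (ContinuousLinearMap.fst ℂ (L2Z d) (L2Z d))) with hK2
  set K3 : (L2Z d × L2Z d) →L[ℂ] (L2Z d × L2Z d) :=
    (ContinuousLinearMap.toSpanSingleton ℂ f).comp φ with hK3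
  -- `K1` and `K2` are the two potential terms and `K3` is the rank-one map b ↦ φ(b) f; added to
  -- `freeJH` they give 𝒥ℋ'' - 2Λ + φ(·) f.
  have hK : IsCompactOperator (K1 + K2 + K3) := by
    refine IsCompactOperator.add (IsCompactOperator.add ?_ ?_) ?_
    · exact ((hpotc.comp_clm (ContinuousLinearMap.snd ℂ (L2Z d) (L2Z d))).smul
        (-(gam p : ℂ))).clm_comp (ContinuousLinearMap.inl ℂ (L2Z d) (L2Z d))
    · exact ((hpotc.comp_clm (ContinuousLinearMap.fst ℂ (L2Z d) (L2Z d))).smul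
        ((1 + 2 * p) * gam p : ℂ)).clm_comp (ContinuousLinearMap.inr ℂ (L2Z d) (L2Z d))
    · exact (isCompactOperator_of_locallyCompactSpace_dom φ).clm_comp
        (ContinuousLinearMap.toSpanSingleton ℂ f)
  have hM : ∀ b, freeJH d Ω (2 * Lam) b + (K1 + K2 + K3) b
      = JH p Ω A b - (2 * Lam) • b + φ b • f := by
    rintro ⟨x, y⟩
    have h3 : (K1 + K2 + K3) (x, y)
      = ((-(gam p : ℂ)) • pot y, (0 : L2Z d)) + ((0 : L2Z d), ((1 + 2 * p) * gam p : ℂ) • pot x)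
        + φ (x, y) • f := rfl
    rw [freeJH_apply, h3, JH_apply, Lplus_apply, Lminus_apply, ← hpot, ← add_assoc]
    congr 1
    rw [Prod.smul_mk, Prod.mk_sub_mk, Prod.mk_add_mk, Prod.mk_add_mk, Prod.mk.injEq]
    constructor <;> module
  have hunit : IsUnit (freeJH d Ω (2 * Lam) + (K1 + K2 + K3)) := by
    refine isUnit_add_of_isCompactOperator (isUnit_freeJH hcont) hK fun x hx => ?_
    rw [hM] at hx
    have hx' : JH p Ω A x - (2 * Lam) • x = (-φ x) • f := by
      rw [neg_smul]
      exact eq_neg_of_add_eq_zero_left hx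
    obtain ⟨a, rfl⟩ := eq_smul_of_sub_sq_eq_zero heig hx'
    rw [map_smul, heig.eigen, smul_comm, sub_self, zero_add, map_smul, hφ, smul_eq_mul,
      mul_one] at hx
    exact hx
  obtain ⟨hinj, hsur⟩ := ContinuousLinearMap.isUnit_iff_bijective.mp hunit
  -- The perturbed operator fixes f, so invertibility of this one operator already solves the
  -- bordered system.
  have hMf : JH p Ω A f - (2 * Lam) • f + φ f • f = f := by
    rw [heig.eigen, sub_self, zero_add, hφ, one_smul]
  refine ⟨φ, hφ, fun b s h0 hb => ?_, fun c t => ?_⟩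
  · have hbs : b = (-s) • f := by
      apply hinj
      rw [map_smul]
      change freeJH d Ω (2 * Lam) b + (K1 + K2 + K3) b
        = (-s) • (freeJH d Ω (2 * Lam) f + (K1 + K2 + K3) f)
      rw [hM, hM, hMf, hb, zero_smul, add_zero, neg_smul]
      exact eq_neg_of_add_eq_zero_left h0
    have hs : s = 0 := by
      rw [hbs, map_smul, hφ, smul_eq_mul, mul_one] at hb
      exact neg_eq_zero.mp hb
    rw [hbs, hs]
    simp
  · obtain ⟨b₀, hb₀⟩ := hsur c
    have hb₁ : JH p Ω A b₀ - (2 * Lam) • b₀ + φ b₀ • f = c := by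
      rw [← hM]
      exact hb₀
    -- Adding a multiple of f adjusts φ to the value t without affecting (𝒥ℋ'' - 2Λ) b.
    refine ⟨b₀ + (t - φ b₀) • f, φ b₀, ?_, ?_⟩
    · rw [map_add, map_smul, heig.eigen, ← hb₁]
      module
    · rw [map_add, map_smul, hφ, smul_eq_mul, mul_one]
      ring

/-! ### The rescaled linear operators of the breather and of the Floquet problem -/

theorem abs_int_mul_winv_le (m : ℤ) : ‖(m : ℂ) * (winv m : ℂ)‖ ≤ 1 := by
  rw [norm_mul, norm_winv, Complex.norm_intCast, winv, ← div_eq_mul_inv, div_le_one (by positivity)]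
  nlinarith [sq_nonneg (|(m : ℝ)| - 1), sq_abs (m : ℝ), abs_nonneg (m : ℝ)]

theorem abs_int_sq_mul_winv_le (m : ℤ) : ‖(m : ℂ) ^ 2 * (winv m : ℂ)‖ ≤ 1 := by
  rw [norm_mul, norm_winv, norm_pow, Complex.norm_intCast, winv, sq_abs, ← div_eq_mul_inv,
    div_le_one (by positivity)]
  linarith

/-- The multiplier `m / (1 + m²)`. -/
def pOp (d : ℕ) : Harm d →L[ℂ] Harm d := multOp d _ 1 abs_int_mul_winv_le

/-- The multiplier `m² / (1 + m²)`. -/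
def qOp (d : ℕ) : Harm d →L[ℂ] Harm d := multOp d _ 1 abs_int_sq_mul_winv_le

open Classical in
/-- The projection to the resonant harmonics `m = ±1`. -/
def piOp (d : ℕ) : Harm d →L[ℂ] Harm d :=
  multOp d (fun m => if m = 1 ∨ m = -1 then 1 else 0) 1 (fun m => by split_ifs <;> simp)

theorem pOp_apply {d : ℕ} (y : Harm d) (m : ℤ) : pOp d y m = ((m : ℂ) * (winv m : ℂ)) • y m :=
  multOp_apply _ _ _ _ _

theorem qOp_apply {d : ℕ} (y : Harm d) (m : ℤ) :
    qOp d y m = ((m : ℂ) ^ 2 * (winv m : ℂ)) • y m := multOp_apply _ _ _ _ _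

theorem piOp_apply_of {d : ℕ} (y : Harm d) {m : ℤ} (hm : m = 1 ∨ m = -1) :
    piOp d y m = y m := by
  rw [piOp, multOp_apply, if_pos hm, one_smul]

theorem piOp_apply_of_not {d : ℕ} (y : Harm d) {m : ℤ} (hm : ¬(m = 1 ∨ m = -1)) :
    piOp d y m = 0 := by
  rw [piOp, multOp_apply, if_neg hm, zero_smul]

/-- The Floquet operator, with the equations of the harmonics `m = ±1` divided by `ε`, for the
eigenvalue `ε η`, the frequency `ω`, the ratio `σ = (1 - ω²) / ε` and the potential `W`. -/
def floq (d : ℕ) (ε ω σ η : ℂ) (W : Harm d →L[ℂ] Harm d) : Harm d →L[ℂ] Harm d :=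
  (1 - piOp d) * ((1 + (ε * η) ^ 2) • jOp d + (2 * Complex.I * (ε * η) * ω) • pOp d
      - ω ^ 2 • qOp d)
    + piOp d * ((σ + ε * η ^ 2) • jOp d + (2 * Complex.I * η * ω) • pOp d)
    + (piOp d + ε • (1 - piOp d)) * ((W - diagOp (lapOp d)) * jOp d)

theorem floq_expand {d : ℕ} (ε ω σ η : ℂ) (W : Harm d →L[ℂ] Harm d) (y : Harm d) (m : ℤ) :
    floq d ε ω σ η W y m
      = ((1 + (ε * η) ^ 2) • jOp d y m + (2 * Complex.I * (ε * η) * ω) • pOp d y m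
          - ω ^ 2 • qOp d y m)
        - piOp d ((1 + (ε * η) ^ 2) • jOp d y + (2 * Complex.I * (ε * η) * ω) • pOp d y
          - ω ^ 2 • qOp d y) m
        + piOp d ((σ + ε * η ^ 2) • jOp d y + (2 * Complex.I * η * ω) • pOp d y) m
        + (piOp d (W (jOp d y) - diagOp (lapOp d) (jOp d y)) m
          + ε • ((W (jOp d y) m - diagOp (lapOp d) (jOp d y) m)
            - piOp d (W (jOp d y) - diagOp (lapOp d) (jOp d y)) m)) := rfl

theorem floq_apply_of {d : ℕ} (ε ω σ η : ℂ) (W : Harm d →L[ℂ] Harm d) (y : Harm d) {m : ℤ}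
    (hm : m = 1 ∨ m = -1) :
    floq d ε ω σ η W y m = (σ + ε * η ^ 2 + 2 * Complex.I * η * ω * m) • jOp d y m
      + W (jOp d y) m - lapOp d (jOp d y m) := by
  rw [floq_expand, piOp_apply_of _ hm, piOp_apply_of _ hm, piOp_apply_of _ hm]
  simp only [lp.coeFn_sub, lp.coeFn_add, lp.coeFn_smul, Pi.sub_apply, Pi.add_apply, Pi.smul_apply,
    diagOp_apply, pOp_apply, qOp_apply, jOp_apply]
  module

theorem floq_apply_of_not {d : ℕ} (ε ω σ η : ℂ) (W : Harm d →L[ℂ] Harm d) (y : Harm d) {m : ℤ}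
    (hm : ¬(m = 1 ∨ m = -1)) :
    floq d ε ω σ η W y m = (1 + (ε * η + Complex.I * m * ω) ^ 2) • jOp d y m
      + ε • (W (jOp d y) m - lapOp d (jOp d y m)) := by
  rw [floq_expand, piOp_apply_of_not _ hm, piOp_apply_of_not _ hm, piOp_apply_of_not _ hm]
  simp only [diagOp_apply, pOp_apply, qOp_apply, jOp_apply]
  linear_combination (norm := module) (-(m * ω) ^ 2 * winv m * Complex.I_mul_I) • y m

/-- No division by ε is left after the rescaling: the operator is polynomial in all parameters,
including the potential. -/
theorem contDiff_floq {d : ℕ} :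
    ContDiff ℂ ⊤ fun x : (ℂ × ℂ × ℂ × (Harm d →L[ℂ] Harm d)) × ℂ =>
      floq d x.1.1 x.1.2.1 x.1.2.2.1 x.2 x.1.2.2.2 := by
  unfold floq
  fun_prop

/-- The rescaled equations are equivalent to the unscaled ones. -/
theorem floq_eq_zero_iff {d : ℕ} {ε ω σ η : ℂ} (hε : ε ≠ 0) (hσ : ε * σ = 1 - ω ^ 2)
    (W : Harm d →L[ℂ] Harm d) (y : Harm d) :
    floq d ε ω σ η W y = 0 ↔ ∀ m n, (1 + (ε * η + Complex.I * m * ω) ^ 2) * jOp d y m n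
      + ε * W (jOp d y) m n = ε * lap (jOp d y m) n := by
  have key : ∀ m n, (1 + (ε * η + Complex.I * m * ω) ^ 2) * jOp d y m n
      + ε * W (jOp d y) m n - ε * lap (jOp d y m) n
      = (if m = 1 ∨ m = -1 then ε else 1) * floq d ε ω σ η W y m n := by
    intro m n
    split_ifs with hm
    · rw [floq_apply_of _ _ _ _ _ _ hm, ← lapOp_apply]
      simp only [lp.coeFn_sub, lp.coeFn_add, lp.coeFn_smul, Pi.sub_apply, Pi.add_apply,
        Pi.smul_apply, smul_eq_mul]
      -- With m² = 1 and εσ = 1 - ω², one has 1 + (εη + imω)² = ε(σ + εη² + 2imηω).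
      have hm2 : (m : ℂ) ^ 2 = 1 := by rcases hm with rfl | rfl <;> simp
      linear_combination (m ^ 2 * ω ^ 2 * Complex.I_mul_I - ω ^ 2 * hm2 - hσ) * jOp d y m n
    · rw [floq_apply_of_not _ _ _ _ _ _ hm, ← lapOp_apply]
      simp only [lp.coeFn_sub, lp.coeFn_add, lp.coeFn_smul, Pi.sub_apply, Pi.add_apply,
        Pi.smul_apply, smul_eq_mul]
      ring
  constructor
  · intro h m n
    have := key m n
    rw [h] at this
    simpa [sub_eq_zero] using this
  · intro h
    refine harm_ext fun m n => ?_
    have := key m n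
    rw [sub_eq_zero.mpr (h m n)] at this
    have hne : (if m = 1 ∨ m = -1 then ε else (1 : ℂ)) ≠ 0 := by
      split_ifs
      exacts [hε, one_ne_zero]
    exact (mul_eq_zero.mp this.symm).resolve_left hne

theorem isFloquetEigenpair_iff {d p : ℕ} {ε ω : ℝ} {σ η lam : ℂ} (hε : ε ≠ 0)
    (hσ : (ε : ℂ) * σ = 1 - (ω : ℂ) ^ 2) (hlam : lam = ε * η) (A B : X2 d) :
    IsFloquetEigenpair p ε ω A lam B ↔ weightEquiv d B ≠ 0 ∧
      floq d ε ω σ η ((1 + 2 * p : ℂ) • (conv d (weightEquiv d A)) ^ (2 * p)) (weightEquiv d B)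
        = 0 := by
  have hε' : (ε : ℂ) ≠ 0 := by exact_mod_cast hε
  have hpi : (Real.pi : ℂ) ≠ 0 := by exact_mod_cast Real.pi_ne_zero
  have hiff : (∀ (m : ℤ) (n : Fin d → ℤ),
    (1 + (lam + Complex.I * m * ω) ^ 2) * B.harm m n
      + (ε : ℂ) * (1 + 2 * p) / (2 * Real.pi) * (∫ τ in (-Real.pi)..Real.pi,
          profile A n τ ^ (2 * p) * profile B n τ * Complex.exp (-(Complex.I * m * τ)))
      = (ε : ℂ) * lap (B.harm m) n) ↔
      floq d ε ω σ η ((1 + 2 * p : ℂ) • (conv d (weightEquiv d A)) ^ (2 * p)) (weightEquiv d B)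
        = 0 := by
    rw [floq_eq_zero_iff hε' hσ]
    refine forall_congr' fun m => forall_congr' fun n => ?_
    rw [integral_profile_pow_mul, harm_eq_jOp, hlam]
    have : ((1 + 2 * p : ℂ) • (conv d (weightEquiv d A)) ^ (2 * p)) (jOp d (weightEquiv d B)) m n
      = (1 + 2 * p : ℂ)
        * ((conv d (weightEquiv d A)) ^ (2 * p)) (jOp d (weightEquiv d B)) m n := rfl
    rw [this]
    field_simp
  constructor
  · intro h
    exact ⟨fun h0 => h.ne_zero ((weightEquiv d).map_eq_zero_iff.mp h0), hiff.mp h.eq⟩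
  · rintro ⟨h0, h⟩
    exact ⟨fun hB => h0 (by rw [hB, map_zero]), hiff.mpr h⟩

/-- Splitting U^{1+2p} = U^{2p} · U makes the nonlinear equation a Floquet equation at η = 0 whose
potential lacks the factor 1 + 2p. -/
theorem breather_eq_iff {d p : ℕ} {ε ω : ℝ} {σ : ℂ} (hε : ε ≠ 0)
    (hσ : (ε : ℂ) * σ = 1 - (ω : ℂ) ^ 2) (A : X2 d) :
    (∀ (m : ℤ) (n : Fin d → ℤ),
      (1 - (m : ℂ) ^ 2 * (ω : ℂ) ^ 2) * A.harm m n
        + (ε : ℂ) / (2 * Real.pi) * (∫ τ in (-Real.pi)..Real.pi,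
            profile A n τ ^ (1 + 2 * p) * Complex.exp (-(Complex.I * m * τ)))
        = (ε : ℂ) * lap (A.harm m) n) ↔
      floq d ε ω σ 0 ((conv d (weightEquiv d A)) ^ (2 * p)) (weightEquiv d A) = 0 := by
  have hε' : (ε : ℂ) ≠ 0 := by exact_mod_cast hε
  have hpi : (Real.pi : ℂ) ≠ 0 := by exact_mod_cast Real.pi_ne_zero
  rw [floq_eq_zero_iff hε' hσ]
  refine forall_congr' fun m => forall_congr' fun n => ?_
  have e : ∀ τ, profile A n τ ^ (1 + 2 * p) = profile A n τ ^ (2 * p) * profile A n τ := by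
    intro τ
    rw [add_comm, pow_succ]
  simp only [e]
  rw [integral_profile_pow_mul, harm_eq_jOp]
  have h2 : (1 + ((ε : ℂ) * 0 + Complex.I * m * ω) ^ 2) = 1 - (m : ℂ) ^ 2 * (ω : ℂ) ^ 2 := by
    linear_combination (m * ω) ^ 2 * Complex.I_mul_I
  rw [h2]
  field_simp

/-! ### The resonant harmonics -/

/-- The sequence of harmonics with entries `u` at `m = 1` and `v` at `m = -1`. -/
def pairEmb (d : ℕ) : (L2Z d × L2Z d) →L[ℂ] Harm d :=
  (lp.singleContinuousLinearMap ℂ (fun _ : ℤ => L2Z d) 2 1).comp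
      (ContinuousLinearMap.fst ℂ (L2Z d) (L2Z d))
    + (lp.singleContinuousLinearMap ℂ (fun _ : ℤ => L2Z d) 2 (-1)).comp
      (ContinuousLinearMap.snd ℂ (L2Z d) (L2Z d))

theorem pairEmb_apply {d : ℕ} (u v : L2Z d) (m : ℤ) :
    pairEmb d (u, v) m = (Pi.single 1 u : ℤ → L2Z d) m + (Pi.single (-1) v : ℤ → L2Z d) m := rfl

@[simp] theorem pairEmb_one {d : ℕ} (u v : L2Z d) : pairEmb d (u, v) 1 = u := by
  simp [pairEmb_apply]

@[simp] theorem pairEmb_neg_one {d : ℕ} (u v : L2Z d) : pairEmb d (u, v) (-1) = v := by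
  simp [pairEmb_apply]

theorem pairEmb_of_not {d : ℕ} (u v : L2Z d) {m : ℤ} (hm : ¬(m = 1 ∨ m = -1)) :
    pairEmb d (u, v) m = 0 := by
  rw [not_or] at hm
  simp [pairEmb_apply, hm.1, hm.2]

theorem eq_pairEmb {d : ℕ} {y : Harm d} (hy : ∀ m, ¬(m = 1 ∨ m = -1) → y m = 0) :
    y = pairEmb d (y 1, y (-1)) := by
  ext1
  funext m
  by_cases hm : m = 1 ∨ m = -1
  · rcases hm with rfl | rfl
    · rw [pairEmb_one]
    · rw [pairEmb_neg_one]
  · rw [hy m hm, pairEmb_of_not _ _ hm]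

theorem winv_one : winv 1 = 2⁻¹ := by norm_num [winv]

theorem winv_neg_one : winv (-1) = 2⁻¹ := by norm_num [winv]

/-- The factor 2 is the weight 1 + m² at m = ±1. -/
theorem jOp_pairEmb {d : ℕ} (u v : L2Z d) :
    jOp d (pairEmb d ((2 : ℂ) • u, (2 : ℂ) • v)) = pairEmb d (u, v) := by
  ext1
  funext m
  rw [jOp_apply]
  by_cases hm : m = 1 ∨ m = -1
  · rcases hm with rfl | rfl
    · rw [pairEmb_one, pairEmb_one, smul_smul, winv_one]
      norm_num
    · rw [pairEmb_neg_one, pairEmb_neg_one, smul_smul, winv_neg_one]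
      norm_num
  · rw [pairEmb_of_not _ _ hm, pairEmb_of_not _ _ hm, smul_zero]

/-- The weighted harmonics of `τ ↦ A (e^{iτ} + e^{-iτ})`. -/
def solitonHarm {d : ℕ} (A : L2Z d) : Harm d := pairEmb d ((2 : ℂ) • A, (2 : ℂ) • A)

/-- Multiplication by A(e^{iτ} + e^{-iτ}) shifts harmonics by ±1. The binomial theorem then computes
its powers. -/
theorem conv_solitonHarm {d : ℕ} (A : L2Z d) :
    conv d (solitonHarm A) = diagOp (mulOp d A) * (shiftHarm d 1 + shiftHarm d (-1)) := by
  ext1 z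
  refine harm_ext fun m n => ?_
  have hr : (diagOp (mulOp d A) * (shiftHarm d 1 + shiftHarm d (-1))) z m n
      = A n * (z (m - 1) n + z (m - -1) n) := by
    change mulOp d A ((shiftHarm d 1 + shiftHarm d (-1)) z m) n = _
    rw [mulOp_apply]
    rfl
  rw [hr, conv_apply_eq, solitonHarm, jOp_pairEmb, tsum_eq_sum (s := {1, -1})]
  · rw [Finset.sum_pair (by norm_num), pairEmb_one, pairEmb_neg_one]
    ring
  · intro k hk
    rw [pairEmb_of_not _ _ (by simpa using hk)]
    simp

theorem shiftHarm_pow {d : ℕ} (k : ℤ) (j : ℕ) : (shiftHarm d k) ^ j = shiftHarm d (j * k) := by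
  induction j with
  | zero => simp [shiftHarm_zero]
  | succ j ih =>
    rw [pow_succ, ih, shiftHarm_mul]
    congr 1
    push_cast
    ring

theorem diagOp_mul {d : ℕ} (S T : L2Z d →L[ℂ] L2Z d) : diagOp (S * T) = diagOp S * diagOp T := rfl

theorem diagOp_pow {d : ℕ} (T : L2Z d →L[ℂ] L2Z d) (k : ℕ) :
    diagOp (T ^ k) = (diagOp T) ^ k := by
  induction k with
  | zero => rfl
  | succ k ih => rw [pow_succ, diagOp_mul, ih, pow_succ]

theorem shiftHarm_add_pow {d : ℕ} (k : ℕ) :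
    (shiftHarm d 1 + shiftHarm d (-1)) ^ k
      = ∑ j ∈ Finset.range (k + 1), (k.choose j : ℂ) • shiftHarm d (2 * j - k) := by
  have hc : Commute (shiftHarm d 1) (shiftHarm d (-1)) := by
    rw [Commute, SemiconjBy, shiftHarm_mul, shiftHarm_mul]
    rfl
  rw [hc.add_pow]
  refine Finset.sum_congr rfl fun j hj => ?_
  have hj' : j ≤ k := Nat.lt_succ_iff.mp (Finset.mem_range.mp hj)
  rw [shiftHarm_pow, shiftHarm_pow, shiftHarm_mul, ← nsmul_eq_mul', Nat.cast_smul_eq_nsmul ℂ]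
  congr 2
  push_cast [hj']
  ring

theorem commute_diagOp_shiftHarm {d : ℕ} (T : L2Z d →L[ℂ] L2Z d) (k : ℤ) :
    Commute (diagOp T) (shiftHarm d k) := by
  refine ContinuousLinearMap.ext fun y => lp.ext (funext fun m => ?_)
  change diagOp T (shiftHarm d k y) m = diagOp T y (m - k)
  rw [diagOp_apply, diagOp_apply, shiftHarm_apply]

theorem conv_solitonHarm_pow {d : ℕ} (A : L2Z d) (k : ℕ) :
    (conv d (solitonHarm A)) ^ k = diagOp ((mulOp d A) ^ k)
      * ∑ j ∈ Finset.range (k + 1), (k.choose j : ℂ) • shiftHarm d (2 * j - k) := by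
  have hc : Commute (diagOp (mulOp d A)) (shiftHarm d 1 + shiftHarm d (-1)) :=
    (commute_diagOp_shiftHarm _ _).add_right (commute_diagOp_shiftHarm _ _)
  rw [conv_solitonHarm, hc.mul_pow, diagOp_pow, shiftHarm_add_pow]

theorem sum_choose_shift {d : ℕ} (p : ℕ) (z : Harm d) (m : ℤ) :
    (∑ j ∈ Finset.range (2 * p + 1),
        ((2 * p).choose j : ℂ) • shiftHarm d (2 * j - (2 * p : ℕ))) z m
      = ∑ j ∈ Finset.range (2 * p + 1),
        ((2 * p).choose j : ℂ) • z (m - (2 * j - (2 * p : ℕ))) := by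
  rw [sum_apply, lp.coeFn_sum, Finset.sum_apply]
  rfl

/-- This and the next two identities convert binomial coefficients to γ_p. The resulting weights
(1+p)γ_p and pγ_p have sum (1+2p)γ_p, the coefficient in L₊, and difference γ_p, the coefficient in
L₋. -/
theorem choose_mul_eq (p : ℕ) :
    (1 + 2 * p : ℂ) * ((2 * p).choose p : ℂ) = (1 + p) * gam p := by
  have h := Nat.add_one_mul_choose_eq (2 * p) p
  have h' : (1 + 2 * p) * (2 * p).choose p = (1 + p) * gam p := by
    rw [gam, add_comm 1 (2 * p), add_comm 1 p, h, mul_comm]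
  exact_mod_cast h'

theorem gam_eq_choose_add (p : ℕ) :
    (gam p : ℂ) = ((2 * p).choose p : ℂ) + ((2 * p).choose (p + 1) : ℂ) := by
  have h : gam p = (2 * p).choose p + (2 * p).choose (p + 1) := by
    rw [gam, add_comm 1 (2 * p), add_comm 1 p, Nat.choose_succ_succ']
  exact_mod_cast h

theorem choose_succ_mul_eq (p : ℕ) :
    (1 + 2 * p : ℂ) * ((2 * p).choose (p + 1) : ℂ) = p * gam p := by
  linear_combination (-(1 + 2 * p : ℂ)) * gam_eq_choose_add p - choose_mul_eq p

/-- Only the shifts by 0 and 2 carry a resonant harmonic to m = 1; they are the terms j = p and j =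
p + 1. -/
theorem sum_choose_pairEmb_one {d p : ℕ} (hp : 1 ≤ p) (u v : L2Z d) :
    ∑ j ∈ Finset.range (2 * p + 1),
        ((2 * p).choose j : ℂ) • pairEmb d (u, v) (1 - (2 * j - (2 * p : ℕ)))
      = ((2 * p).choose p : ℂ) • u + ((2 * p).choose (p + 1) : ℂ) • v := by
  rw [← Finset.sum_subset (s₁ := {p, p + 1})]
  · rw [Finset.sum_pair (by omega)]
    have h1 : (1 - (2 * (p : ℤ) - (2 * p : ℕ))) = 1 := by push_cast; ring
    have h2 : (1 - (2 * ((p + 1 : ℕ) : ℤ) - (2 * p : ℕ))) = -1 := by push_cast; ring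
    rw [h1, h2, pairEmb_one, pairEmb_neg_one]
  · intro j hj
    simp only [Finset.mem_insert, Finset.mem_singleton] at hj
    rw [Finset.mem_range]
    omega
  · intro j _ hj
    simp only [Finset.mem_insert, Finset.mem_singleton] at hj
    rw [pairEmb_of_not _ _ (by push_cast; omega), smul_zero]

theorem sum_choose_pairEmb_neg_one {d p : ℕ} (hp : 1 ≤ p) (u v : L2Z d) :
    ∑ j ∈ Finset.range (2 * p + 1),
        ((2 * p).choose j : ℂ) • pairEmb d (u, v) (-1 - (2 * j - (2 * p : ℕ)))
      = ((2 * p).choose (p + 1) : ℂ) • u + ((2 * p).choose p : ℂ) • v := by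
  have hsymm : (2 * p).choose (p + 1) = (2 * p).choose (p - 1) :=
    Nat.choose_symm_of_eq_add (by omega)
  rw [← Finset.sum_subset (s₁ := {p - 1, p}), hsymm]
  · rw [Finset.sum_pair (by omega)]
    have h1 : (-1 - (2 * (p : ℤ) - (2 * p : ℕ))) = -1 := by push_cast; ring
    have h2 : (-1 - (2 * ((p - 1 : ℕ) : ℤ) - (2 * p : ℕ))) = 1 := by push_cast [hp]; ring
    rw [h1, h2, pairEmb_one, pairEmb_neg_one]
  · intro j hj
    simp only [Finset.mem_insert, Finset.mem_singleton] at hj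
    rw [Finset.mem_range]
    omega
  · intro j _ hj
    simp only [Finset.mem_insert, Finset.mem_singleton] at hj
    rw [pairEmb_of_not _ _ (by push_cast; omega), smul_zero]

/-- The potential of the linearization at the soliton. -/
def solitonPot {d : ℕ} (p : ℕ) (A : L2Z d) : Harm d →L[ℂ] Harm d :=
  (1 + 2 * p : ℂ) • (conv d (solitonHarm A)) ^ (2 * p)

theorem conv_pow_pairEmb_apply {d p : ℕ} {A : L2Z d} (hA : ∀ n, (A n).im = 0)
    (z : Harm d) (m : ℤ) : ((conv d (solitonHarm A)) ^ (2 * p)) z m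
      = potOp p A (∑ j ∈ Finset.range (2 * p + 1),
        ((2 * p).choose j : ℂ) • z (m - (2 * j - (2 * p : ℕ)))) := by
  rw [conv_solitonHarm_pow, ← sum_choose_shift, potOp_eq_mulOp_pow p hA]
  rfl

theorem solitonPot_pairEmb_one {d p : ℕ} (hp : 1 ≤ p) {A : L2Z d} (hA : ∀ n, (A n).im = 0)
    (u v : L2Z d) : solitonPot p A (pairEmb d (u, v)) 1
      = potOp p A (((1 + p) * gam p : ℂ) • u + (p * gam p : ℂ) • v) := by
  change (1 + 2 * p : ℂ) • ((conv d (solitonHarm A)) ^ (2 * p)) (pairEmb d (u, v)) 1 = _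
  rw [conv_pow_pairEmb_apply hA, sum_choose_pairEmb_one hp, ← map_smul, smul_add, smul_smul,
    smul_smul, choose_mul_eq, choose_succ_mul_eq]

theorem solitonPot_pairEmb_neg_one {d p : ℕ} (hp : 1 ≤ p) {A : L2Z d} (hA : ∀ n, (A n).im = 0)
    (u v : L2Z d) : solitonPot p A (pairEmb d (u, v)) (-1)
      = potOp p A ((p * gam p : ℂ) • u + ((1 + p) * gam p : ℂ) • v) := by
  change (1 + 2 * p : ℂ) • ((conv d (solitonHarm A)) ^ (2 * p)) (pairEmb d (u, v)) (-1) = _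
  rw [conv_pow_pairEmb_apply hA, sum_choose_pairEmb_neg_one hp, ← map_smul, smul_add, smul_smul,
    smul_smul, choose_mul_eq, choose_succ_mul_eq]

/-- The weighted harmonics `b₊ ± i b₋` at `m = ±1`. -/
def resEmb (d : ℕ) : (L2Z d × L2Z d) →L[ℂ] Harm d :=
  (pairEmb d).comp (((2 : ℂ) • (ContinuousLinearMap.fst ℂ (L2Z d) (L2Z d)
      + Complex.I • ContinuousLinearMap.snd ℂ (L2Z d) (L2Z d))).prod
    ((2 : ℂ) • (ContinuousLinearMap.fst ℂ (L2Z d) (L2Z d)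
      - Complex.I • ContinuousLinearMap.snd ℂ (L2Z d) (L2Z d))))

theorem resEmb_apply {d : ℕ} (x y : L2Z d) : resEmb d (x, y)
    = pairEmb d ((2 : ℂ) • (x + Complex.I • y), (2 : ℂ) • (x - Complex.I • y)) := rfl

/-- The left inverse of `resEmb`. -/
def resProj (d : ℕ) : Harm d →L[ℂ] (L2Z d × L2Z d) :=
  ((4 : ℂ)⁻¹ • (lp.evalCLM ℂ (fun _ : ℤ => L2Z d) 2 1
      + lp.evalCLM ℂ (fun _ : ℤ => L2Z d) 2 (-1))).prod
    ((-(4 : ℂ)⁻¹ * Complex.I) • (lp.evalCLM ℂ (fun _ : ℤ => L2Z d) 2 1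
      - lp.evalCLM ℂ (fun _ : ℤ => L2Z d) 2 (-1)))

theorem resProj_apply {d : ℕ} (y : Harm d) : resProj d y
    = ((4 : ℂ)⁻¹ • (y 1 + y (-1)), (-(4 : ℂ)⁻¹ * Complex.I) • (y 1 - y (-1))) := rfl

theorem resProj_resEmb {d : ℕ} (b : L2Z d × L2Z d) : resProj d (resEmb d b) = b := by
  obtain ⟨x, y⟩ := b
  rw [resProj_apply, resEmb_apply, pairEmb_one, pairEmb_neg_one, Prod.mk.injEq]
  constructor
  · module
  · linear_combination (norm := module) (-Complex.I_mul_I) • y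

theorem resEmb_resProj {d : ℕ} {y : Harm d} (hy : ∀ m, ¬(m = 1 ∨ m = -1) → y m = 0) :
    resEmb d (resProj d y) = y := by
  conv_rhs => rw [eq_pairEmb hy]
  rw [resProj_apply, resEmb_apply]
  congr 2
  · linear_combination (norm := module) (-(1 / 2 : ℂ) * Complex.I_mul_I) • (y 1 - y (-1))
  · linear_combination (norm := module) ((1 / 2 : ℂ) * Complex.I_mul_I) • (y 1 - y (-1))

/-- The residuals `c₂ ∓ i c₁` at `m = ±1`. -/
def rowEmb (d : ℕ) : (L2Z d × L2Z d) →L[ℂ] Harm d :=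
  (pairEmb d).comp ((ContinuousLinearMap.snd ℂ (L2Z d) (L2Z d)
      - Complex.I • ContinuousLinearMap.fst ℂ (L2Z d) (L2Z d)).prod
    (ContinuousLinearMap.snd ℂ (L2Z d) (L2Z d)
      + Complex.I • ContinuousLinearMap.fst ℂ (L2Z d) (L2Z d)))

theorem rowEmb_apply {d : ℕ} (x y : L2Z d) : rowEmb d (x, y)
    = pairEmb d (y - Complex.I • x, y + Complex.I • x) := rfl

theorem rowEmb_injective {d : ℕ} {c : L2Z d × L2Z d} (h : rowEmb d c = 0) : c = 0 := by
  obtain ⟨x, y⟩ := c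
  rw [rowEmb_apply] at h
  have h1 : y - Complex.I • x = 0 := by
    rw [← pairEmb_one (y - Complex.I • x) (y + Complex.I • x), h]
    rfl
  have h2 : y + Complex.I • x = 0 := by
    rw [← pairEmb_neg_one (y - Complex.I • x) (y + Complex.I • x), h]
    rfl
  have hy : (2 : ℂ) • y = 0 := by linear_combination (norm := module) h1 + h2
  have hy0 : y = 0 := (smul_eq_zero.mp hy).resolve_left two_ne_zero
  rw [hy0, zero_add] at h2
  rw [(smul_eq_zero.mp h2).resolve_left Complex.I_ne_zero, hy0]
  rfl

theorem eq_rowEmb {d : ℕ} {y : Harm d} (hy : ∀ m, ¬(m = 1 ∨ m = -1) → y m = 0) :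
    y = rowEmb d ((Complex.I / 2) • (y 1 - y (-1)), (2 : ℂ)⁻¹ • (y 1 + y (-1))) := by
  conv_lhs => rw [eq_pairEmb hy]
  rw [rowEmb_apply]
  congr 2
  · linear_combination (norm := module) ((1 / 2 : ℂ) * Complex.I_mul_I) • (y 1 - y (-1))
  · linear_combination (norm := module) (-(1 / 2 : ℂ) * Complex.I_mul_I) • (y 1 - y (-1))

/-! ### The operator at `ε = 0` -/

theorem floq_zero_apply_of_not {d : ℕ} (σ η : ℂ) (W : Harm d →L[ℂ] Harm d) (y : Harm d) {m : ℤ}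
    (hm : ¬(m = 1 ∨ m = -1)) :
    floq d 0 1 σ η W y m = ((1 - (m : ℂ) ^ 2) * winv m) • y m := by
  rw [floq_apply_of_not _ _ _ _ _ _ hm, jOp_apply]
  linear_combination (norm := module) ((m : ℂ) ^ 2 * winv m * Complex.I_mul_I) • y m

/-- The reduction to dNLS: half the sum and half the difference of the rows m = ±1 give L₊b₊ - 2ηb₋
and i(L₋b₋ + 2ηb₊). -/
theorem floq_zero_resEmb {d p : ℕ} (hp : 1 ≤ p) (Ω : ℝ) {A : L2Z d} (hA : ∀ n, (A n).im = 0)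
    (η : ℂ) (b : L2Z d × L2Z d) :
    floq d 0 1 Ω η (solitonPot p A) (resEmb d b)
      = rowEmb d (JH p Ω A b - (2 * η) • b) := by
  obtain ⟨x, y⟩ := b
  have hI := Complex.I_mul_I
  rw [JH_apply, Prod.smul_mk, Prod.mk_sub_mk, rowEmb_apply, resEmb_apply, Lplus_apply,
    Lminus_apply]
  ext1
  funext m
  by_cases hm : m = 1 ∨ m = -1
  · rw [floq_apply_of _ _ _ _ _ _ hm, jOp_pairEmb]
    rcases hm with rfl | rfl
    · rw [solitonPot_pairEmb_one hp hA, pairEmb_one, pairEmb_one]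
      simp only [map_add, map_sub, map_smul]
      push_cast
      linear_combination (norm := module) (2 * η * hI) • y
    · rw [solitonPot_pairEmb_neg_one hp hA, pairEmb_neg_one, pairEmb_neg_one]
      simp only [map_add, map_sub, map_smul]
      push_cast
      linear_combination (norm := module) (2 * η * hI) • y
  · rw [floq_zero_apply_of_not _ _ _ _ hm, pairEmb_of_not _ _ hm, pairEmb_of_not _ _ hm, smul_zero]

/-- There are no small divisors: (1 + m²)/|1 - m²| equals 1 at m = 0 and is at most 5/3 for |m| ≥ 2.
-/
theorem norm_nonresonant_symbol_le (m : ℤ) :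
    ‖(if m = 1 ∨ m = -1 then 0 else ((1 - (m : ℂ) ^ 2) * winv m)⁻¹)‖ ≤ 2 := by
  split_ifs with hm
  · simp
  · have e : ((1 - (m : ℂ) ^ 2) * winv m)⁻¹ = ((((1 - (m : ℝ) ^ 2) * winv m)⁻¹ : ℝ) : ℂ) := by
      push_cast
      rfl
    rw [e, Complex.norm_real, norm_inv, norm_mul, Real.norm_of_nonneg (winv_pos m).le, winv,
      mul_inv, inv_inv, Real.norm_eq_abs, ← div_eq_inv_mul]
    rw [not_or] at hm
    by_cases h0 : m = 0
    · subst h0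
      norm_num
    · have h2 : (4 : ℤ) ≤ m ^ 2 := by
        have : 2 ≤ |m| := by
          rcases abs_cases m with h | h <;> omega
        nlinarith [sq_abs m]
      have h3 : (4 : ℝ) ≤ (m : ℝ) ^ 2 := by exact_mod_cast h2
      rw [abs_of_nonpos (by linarith), div_le_iff₀ (by linarith)]
      linarith

/-- The inverse of the operator at `ε = 0` on the nonresonant harmonics. -/
def nonresInv (d : ℕ) : Harm d →L[ℂ] Harm d := multOp d _ 2 norm_nonresonant_symbol_le

theorem nonres_symbol_ne_zero {m : ℤ} (hm : ¬(m = 1 ∨ m = -1)) :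
    (1 - (m : ℂ) ^ 2) * winv m ≠ 0 := by
  refine mul_ne_zero (fun h => hm ?_) (winv_ne_zero m)
  have h1 : (m : ℂ) ^ 2 = 1 := (sub_eq_zero.mp h).symm
  have h2 : m ^ 2 = 1 := by exact_mod_cast h1
  exact sq_eq_one_iff.mp h2

theorem floq_zero_nonresInv {d : ℕ} (σ η : ℂ) (W : Harm d →L[ℂ] Harm d) (z : Harm d) {m : ℤ}
    (hm : ¬(m = 1 ∨ m = -1)) : floq d 0 1 σ η W (nonresInv d z) m = z m := by
  rw [floq_zero_apply_of_not _ _ _ _ hm, nonresInv, multOp_apply, if_neg hm, smul_smul,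
    mul_inv_cancel₀ (nonres_symbol_ne_zero hm), one_smul]

theorem nonresInv_apply_of {d : ℕ} (z : Harm d) {m : ℤ} (hm : m = 1 ∨ m = -1) :
    nonresInv d z m = 0 := by
  rw [nonresInv, multOp_apply, if_pos hm, zero_smul]

theorem resProj_nonresInv {d : ℕ} (z : Harm d) : resProj d (nonresInv d z) = 0 := by
  rw [resProj_apply, nonresInv_apply_of z (Or.inl rfl), nonresInv_apply_of z (Or.inr rfl)]
  simp

/-- The Floquet operator at `ε = 0`, bordered by its kernel, is bijective. -/
theorem bordered_floq_bijective {d p : ℕ} (hp : 1 ≤ p) {Ω : ℝ} {A : L2Z d}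
    (hA : ∀ n, (A n).im = 0) {Lam : ℂ} {f : L2Z d × L2Z d} {φ : (L2Z d × L2Z d) →L[ℂ] ℂ}
    (hinj : ∀ (b : L2Z d × L2Z d) (s : ℂ),
      JH p Ω A b - (2 * Lam) • b + s • f = 0 → φ b = 0 → b = 0 ∧ s = 0)
    (hsur : ∀ (c : L2Z d × L2Z d) (t : ℂ), ∃ (b : L2Z d × L2Z d) (s : ℂ),
      JH p Ω A b - (2 * Lam) • b + s • f = c ∧ φ b = t) :
    Function.Bijective fun x : Harm d × ℂ =>
      (floq d 0 1 Ω Lam (solitonPot p A) x.1 + x.2 • rowEmb d ((-2 : ℂ) • f),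
        φ (resProj d x.1)) := by
  constructor
  · have hadd : ∀ x y : Harm d × ℂ,
      (floq d 0 1 Ω Lam (solitonPot p A) x.1 + x.2 • rowEmb d ((-2 : ℂ) • f)
        = floq d 0 1 Ω Lam (solitonPot p A) y.1 + y.2 • rowEmb d ((-2 : ℂ) • f)) →
      φ (resProj d x.1) = φ (resProj d y.1) → x - y = 0 := by
      intro x y h1 h2
      set h := (x - y).1 with hh
      set n := (x - y).2 with hn
      have e1 : floq d 0 1 Ω Lam (solitonPot p A) h + n • rowEmb d ((-2 : ℂ) • f) = 0 := by
        rw [hh, hn, Prod.fst_sub, Prod.snd_sub, map_sub]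
        linear_combination (norm := module) h1
      have e2 : φ (resProj d h) = 0 := by
        rw [hh, Prod.fst_sub, map_sub, map_sub, h2, sub_self]
      -- The border is supported on m = ±1, so the nonresonant rows force those harmonics to vanish.
      have hsupp : ∀ m, ¬(m = 1 ∨ m = -1) → h m = 0 := by
        intro m hm
        have e3 : floq d 0 1 Ω Lam (solitonPot p A) h m + n • rowEmb d ((-2 : ℂ) • f) m = 0 :=
          congrArg (fun y : Harm d => y m) e1
        have e4 : rowEmb d ((-2 : ℂ) • f) m = 0 := pairEmb_of_not _ _ hm
        rw [e4, smul_zero, add_zero, floq_zero_apply_of_not _ _ _ _ hm] at e3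
        exact (smul_eq_zero.mp e3).resolve_left (nonres_symbol_ne_zero hm)
      rw [← resEmb_resProj hsupp, floq_zero_resEmb hp Ω hA, ← map_smul (rowEmb d),
        ← map_add] at e1
      have e5 := rowEmb_injective e1
      rw [smul_smul] at e5
      obtain ⟨hb, hs⟩ := hinj _ _ e5 e2
      have hh0 : h = 0 := by rw [← resEmb_resProj hsupp, hb, map_zero]
      have hn0 : n = 0 := (mul_eq_zero.mp hs).resolve_right (by norm_num)
      exact Prod.ext hh0 hn0
    intro x y hxy
    rw [Prod.mk.injEq] at hxy
    exact sub_eq_zero.mp (hadd x y hxy.1 hxy.2)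
  · rintro ⟨z, t⟩
    -- Solving the nonresonant rows first leaves a residual on m = ±1, which the bordered dNLS
    -- operator absorbs.
    set h' := nonresInv d z with hh'
    set r := z - floq d 0 1 Ω Lam (solitonPot p A) h' with hr
    have hsupp : ∀ m, ¬(m = 1 ∨ m = -1) → r m = 0 := by
      intro m hm
      rw [hr, lp.coeFn_sub, Pi.sub_apply, hh', floq_zero_nonresInv _ _ _ _ hm, sub_self]
    obtain ⟨b, s, hbs, hφ⟩ := hsur ((Complex.I / 2) • (r 1 - r (-1)), (2 : ℂ)⁻¹ • (r 1 + r (-1))) t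
    -- The border here is -2f, the η-derivative of (𝒥ℋ'' - 2η) f, hence the factor -1/2.
    refine ⟨(h' + resEmb d b, -s / 2), ?_⟩
    rw [Prod.mk.injEq]
    constructor
    · have hs : (-s / 2) • rowEmb d ((-2 : ℂ) • f) = rowEmb d (s • f) := by
        rw [← map_smul, smul_smul]
        congr 2
        ring
      rw [map_add, floq_zero_resEmb hp Ω hA, hs, add_assoc, ← map_add, hbs, ← eq_rowEmb hsupp, hr]
      abel
    · rw [map_add, map_add, resProj_resEmb, hh', resProj_nonresInv, map_zero, zero_add, hφ]

/-! ### The implicit function theorem -/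

/-- Analytic implicit function theorem with a bijective partial derivative. -/
theorem exists_implicitFunction {E₁ E₂ G : Type*} [NormedAddCommGroup E₁] [NormedSpace ℂ E₁]
    [CompleteSpace E₁] [NormedAddCommGroup E₂] [NormedSpace ℂ E₂] [CompleteSpace E₂]
    [NormedAddCommGroup G] [NormedSpace ℂ G] [CompleteSpace G] {F : E₁ × E₂ → G} {a : E₁} {b : E₂}
    (hF : ContDiffAt ℂ ⊤ F (a, b)) (h0 : F (a, b) = 0) {F₂ : E₂ →L[ℂ] G}
    (hF₂ : HasFDerivAt (fun x => F (a, x)) F₂ b) (hbij : Function.Bijective F₂) :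
    ∃ ψ : E₁ → E₂, AnalyticAt ℂ ψ a ∧ ψ a = b ∧
      ∀ᶠ v in 𝓝 (a, b), F v = 0 ↔ ψ v.1 = v.2 := by
  have hcomp : fderiv ℂ F (a, b) ∘L ContinuousLinearMap.inr ℂ E₁ E₂ = F₂ := by
    have h1 : HasFDerivAt F (fderiv ℂ F (a, b)) (a, b) :=
      (hF.differentiableAt (by simp)).hasFDerivAt
    exact (h1.comp b (hasFDerivAt_prodMk_right a b)).unique hF₂
  have hinv : (fderiv ℂ F (a, b) ∘L ContinuousLinearMap.inr ℂ E₁ E₂).IsInvertible := by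
    rw [hcomp]
    exact ⟨ContinuousLinearEquiv.ofBijective F₂ (LinearMap.ker_eq_bot.mpr hbij.1)
      (LinearMap.range_eq_top.mpr hbij.2), ContinuousLinearEquiv.coe_ofBijective _ _ _⟩
  have hn : (⊤ : WithTop ℕ∞) ≠ 0 := by simp
  refine ⟨hF.implicitFunction hn hinv, ?_, hF.implicitFunction_apply_self hn hinv, ?_⟩
  · exact (hF.contDiffAt_implicitFunction hn hinv).analyticAt
  · simpa only [h0] using hF.eventually_apply_eq_iff_implicitFunction hn hinv

/-! ### Perturbation of a simple eigenvalue -/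

/-- Analytic perturbation of a kernel vector of `L θ₀ 0`, under a nondegeneracy condition on the
bordered operator, with uniqueness among all kernel vectors of `L θ μ` for small `μ`. -/
theorem exists_kernel_branch {Θ Y : Type*} [NormedAddCommGroup Θ] [NormedSpace ℂ Θ]
    [CompleteSpace Θ] [NormedAddCommGroup Y] [NormedSpace ℂ Y] [CompleteSpace Y]
    {L : Θ × ℂ → Y →L[ℂ] Y} (hL : ContDiff ℂ ⊤ L) {θ₀ : Θ} {L₀ N : Y →L[ℂ] Y}
    (hLN : ∀ ν, L (θ₀, ν) = L₀ + ν • N) {y₀ : Y} (hL₀y : L₀ y₀ = 0) {Φ : Y →L[ℂ] ℂ}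
    (hΦy : Φ y₀ = 1)
    (hbij : Function.Bijective fun x : Y × ℂ => (L₀ x.1 + x.2 • N y₀, Φ x.1)) :
    ∃ ψ : Θ → Y × ℂ, AnalyticAt ℂ ψ θ₀ ∧ ψ θ₀ = (y₀, 0) ∧
      ∃ δ > 0, ∀ᶠ θ in 𝓝 θ₀, (ψ θ).1 ≠ 0 ∧ L (θ, (ψ θ).2) (ψ θ).1 = 0 ∧
        ∀ (μ : ℂ) (D : Y), D ≠ 0 → ‖μ‖ ≤ δ → L (θ, μ) D = 0 →
          μ = (ψ θ).2 ∧ ∃ c : ℂ, D = c • (ψ θ).1 := by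
  -- The second component normalizes the kernel vector by Φ = 1. The derivative in the unknowns
  -- (vector, spectral shift) is then exactly the bordered operator.
  let F : Θ × (Y × ℂ) → Y × ℂ := fun v =>
    (L (v.1, v.2.2) v.2.1, Φ v.2.1 - 1)
  have hF : ContDiff ℂ ⊤ F :=
    ((hL.comp (by fun_prop : ContDiff ℂ ⊤ fun v : Θ × (Y × ℂ) => (v.1, v.2.2))).clm_apply
      (by fun_prop)).prodMk (by fun_prop)
  have hF0 : F (θ₀, (y₀, 0)) = 0 := by
    simp only [F, hΦy, sub_self]
    rw [hLN, zero_smul, add_zero, hL₀y]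
    rfl
  let F₂ : Y × ℂ →L[ℂ] Y × ℂ :=
    (L₀.comp (ContinuousLinearMap.fst ℂ (Y) ℂ)
      + (ContinuousLinearMap.snd ℂ (Y) ℂ).smulRight (N y₀)).prod
    (Φ.comp (ContinuousLinearMap.fst ℂ (Y) ℂ))
  have hF₂ : HasFDerivAt (fun x => F (θ₀, x)) F₂ (y₀, 0) := by
    have e : (fun x : Y × ℂ => F (θ₀, x))
        = fun x => (L₀ x.1 + x.2 • N x.1, Φ x.1 - 1) := by
      funext x
      simp only [F]
      rw [hLN]
      rfl
    rw [e]
    have h1 : HasFDerivAt (fun x : Y × ℂ => L₀ x.1)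
        (L₀.comp (ContinuousLinearMap.fst ℂ (Y) ℂ)) (y₀, 0) :=
      (L₀.comp (ContinuousLinearMap.fst ℂ (Y) ℂ)).hasFDerivAt
    have h2 : HasFDerivAt (fun x : Y × ℂ => N x.1)
        (N.comp (ContinuousLinearMap.fst ℂ (Y) ℂ)) (y₀, 0) :=
      (N.comp (ContinuousLinearMap.fst ℂ (Y) ℂ)).hasFDerivAt
    have h3 : HasFDerivAt (fun x : Y × ℂ => Φ x.1)
        (Φ.comp (ContinuousLinearMap.fst ℂ (Y) ℂ)) (y₀, 0) :=
      (Φ.comp (ContinuousLinearMap.fst ℂ (Y) ℂ)).hasFDerivAt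
    have h4 : HasFDerivAt (fun x : Y × ℂ => x.2) (ContinuousLinearMap.snd ℂ (Y) ℂ)
      (y₀, 0) := hasFDerivAt_snd
    refine ((h1.add (h4.smul h2)).prodMk (h3.sub_const 1)).congr_fderiv ?_
    ext x <;> simp [F₂]
  have hF₂bij : Function.Bijective F₂ := hbij
  obtain ⟨ψ, hψa, hψ0, hψ⟩ := exists_implicitFunction hF.contDiffAt hF0 hF₂ hF₂bij
  refine ⟨ψ, hψa, hψ0, ?_⟩
  -- a priori bound from the bordered operator
  obtain ⟨K, hK0, hK⟩ : ∃ K > 0, ∀ x, ‖x‖ ≤ K * ‖F₂ x‖ := by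
    let e := ContinuousLinearEquiv.ofBijective F₂ (LinearMap.ker_eq_bot.mpr hF₂bij.1)
      (LinearMap.range_eq_top.mpr hF₂bij.2)
    obtain ⟨K, hK0, hK⟩ := (e.symm : Y × ℂ →L[ℂ] Y × ℂ).bound
    refine ⟨K, hK0, fun x => ?_⟩
    have := hK (F₂ x)
    rwa [show (e.symm : Y × ℂ →L[ℂ] Y × ℂ) (F₂ x) = x from e.symm_apply_apply x] at this
  -- The vector D - Φ(D) y₀ lies in the kernel of Φ and has the same image under `L₀` as D.
  have hbound : ∀ D : Y, ‖D - Φ D • y₀‖ ≤ K * ‖L₀ D‖ := by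
    intro D
    have h1 : F₂ (D - Φ D • y₀, 0) = (L₀ D, 0) := by
      change (L₀ (D - Φ D • y₀) + (0 : ℂ) • N y₀, Φ (D - Φ D • y₀)) = (L₀ D, 0)
      rw [map_sub, map_smul, hL₀y, map_sub, map_smul, hΦy]
      simp
    have h2 := hK (D - Φ D • y₀, 0)
    rw [h1, Prod.norm_mk, Prod.norm_mk, norm_zero, max_eq_left (norm_nonneg _),
      max_eq_left (norm_nonneg _)] at h2
    exact h2
  obtain ⟨r, hr0, hr⟩ := Metric.eventually_nhds_iff.mp hψ
  -- The first bound lets Kρ‖D‖ be absorbed by ‖D‖; the second puts every normalized kernel vector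
  -- in the r-ball where the implicit function theorem gives uniqueness.
  set ρ := min (1 / (2 * K)) (r / (4 * K * (‖y₀‖ + 1))) with hρ
  have hρ0 : 0 < ρ := by positivity
  have hρ1 : K * ρ ≤ 1 / 2 := by
    have := min_le_left (1 / (2 * K)) (r / (4 * K * (‖y₀‖ + 1)))
    calc K * ρ ≤ K * (1 / (2 * K)) := by gcongr
      _ = 1 / 2 := by field_simp
  have hρ2 : 2 * (K * ρ) * ‖y₀‖ < r := by
    have := min_le_right (1 / (2 * K)) (r / (4 * K * (‖y₀‖ + 1)))
    have h1 : K * ρ ≤ r / (4 * (‖y₀‖ + 1)) := by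
      calc K * ρ ≤ K * (r / (4 * K * (‖y₀‖ + 1))) := by gcongr
        _ = r / (4 * (‖y₀‖ + 1)) := by field_simp
    calc 2 * (K * ρ) * ‖y₀‖ ≤ 2 * (r / (4 * (‖y₀‖ + 1))) * (‖y₀‖ + 1) := by
          gcongr
          linarith
      _ = r / 2 := by field_simp; norm_num
      _ < r := by linarith
  have hclose : ∀ᶠ x in 𝓝 (θ₀, (0 : ℂ)), ‖L x - L₀‖ < ρ := by
    obtain ⟨s, hs0, hs⟩ := Metric.eventually_nhds_iff.mp
      (Metric.tendsto_nhds.mp (hL.continuous.tendsto (θ₀, (0 : ℂ))) ρ hρ0)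
    refine Metric.eventually_nhds_iff.mpr ⟨s, hs0, fun x hx => ?_⟩
    have h1 := hs hx
    rwa [dist_eq_norm, hLN, zero_smul, add_zero] at h1
  obtain ⟨s, hs0, hs⟩ := Metric.eventually_nhds_iff.mp hclose
  refine ⟨min (s / 2) (r / 2), by positivity, ?_⟩
  have hψc : Filter.Tendsto ψ (𝓝 θ₀) (𝓝 (y₀, 0)) := by
    rw [← hψ0]
    exact hψa.continuousAt
  have hsol : ∀ᶠ θ in 𝓝 θ₀, F (θ, ψ θ) = 0 := by
    have h1 : Filter.Tendsto (fun θ => (θ, ψ θ)) (𝓝 θ₀) (𝓝 (θ₀, (y₀, (0 : ℂ)))) := by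
      exact Filter.tendsto_id.prodMk_nhds hψc
    filter_upwards [h1.eventually hψ] with θ hθ
    exact hθ.mpr rfl
  filter_upwards [hsol, Metric.ball_mem_nhds θ₀ hs0, Metric.ball_mem_nhds θ₀ hr0]
    with θ hθ hθs hθr
  have hθ1 : L (θ, (ψ θ).2) (ψ θ).1 = 0 := congrArg Prod.fst hθ
  have hθ2 : Φ (ψ θ).1 - 1 = 0 := congrArg Prod.snd hθ
  refine ⟨fun h => ?_, hθ1, fun μ D hD hμ hfl => ?_⟩
  · rw [h, map_zero] at hθ2
    norm_num at hθ2
  · have hμs : ‖μ‖ < s := by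
      have := hμ.trans (min_le_left _ _)
      linarith
    have hμr : ‖μ‖ < r := by
      have := hμ.trans (min_le_right _ _)
      linarith
    have hcl : ‖L (θ, μ) - L₀‖ < ρ := by
      refine hs (y := (θ, μ)) ?_
      rw [Prod.dist_eq, max_lt_iff]
      exact ⟨hθs, by rwa [dist_zero_right]⟩
    have hLD : ∀ E : Y, L (θ, μ) E = 0 → ‖L₀ E‖ ≤ ρ * ‖E‖ := by
      intro E hE
      have h1 : L₀ E = -((L (θ, μ) - L₀) E) := by
        rw [sub_apply, hE, zero_sub, neg_neg]
      rw [h1, norm_neg]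
      exact (L (θ, μ) - L₀).le_of_opNorm_le hcl.le E
    have hnear : ∀ E : Y, L (θ, μ) E = 0 → ‖E - Φ E • y₀‖ ≤ K * ρ * ‖E‖ := by
      intro E hE
      refine (hbound E).trans ?_
      rw [mul_assoc]
      exact mul_le_mul_of_nonneg_left (hLD E hE) hK0.le
    -- Otherwise ‖D‖ ≤ ‖D‖/2. Hence a kernel vector of any size can be normalized.
    have hΦD : Φ D ≠ 0 := by
      intro h0
      have h1 := hnear D hfl
      rw [h0, zero_smul, sub_zero] at h1
      have h2 : 0 < ‖D‖ := norm_pos_iff.mpr hD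
      nlinarith
    set E := (Φ D)⁻¹ • D with hE
    have hΦE : Φ E = 1 := by
      rw [hE, map_smul, smul_eq_mul, inv_mul_cancel₀ hΦD]
    have hEfl : L (θ, μ) E = 0 := by rw [hE, map_smul, hfl, smul_zero]
    -- Absorbing half of ‖E - y₀‖ leaves ‖E - y₀‖ ≤ 2Kρ‖y₀‖ < r.
    have hEy : ‖E - y₀‖ < r := by
      have h1 := hnear E hEfl
      rw [hΦE, one_smul] at h1
      have h2 : ‖E‖ ≤ ‖E - y₀‖ + ‖y₀‖ := by simpa using norm_add_le (E - y₀) y₀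
      have h3 : K * ρ * ‖E‖ ≤ K * ρ * (‖E - y₀‖ + ‖y₀‖) := by gcongr
      have h4 : K * ρ * ‖E - y₀‖ ≤ 1 / 2 * ‖E - y₀‖ := by gcongr
      nlinarith
    have hiff := hr (y := (θ, (E, μ))) (by
      rw [Prod.dist_eq, max_lt_iff, Prod.dist_eq, max_lt_iff]
      exact ⟨hθr, by rwa [dist_eq_norm], by rwa [dist_zero_right]⟩)
    have hψE : ψ θ = (E, μ) := by
      refine hiff.mp ?_
      change (L (θ, μ) E, Φ E - 1) = 0
      rw [hEfl, hΦE, sub_self]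
      rfl
    refine ⟨by rw [hψE], Φ D, ?_⟩
    rw [hψE, hE, smul_smul, mul_inv_cancel₀ hΦD, one_smul]

/-! ### Solutions of the rescaled Floquet problem -/

/-- The parameters `(ε, ω, σ, W)` of the rescaled Floquet operator. -/
abbrev Params (d : ℕ) : Type := ℂ × ℂ × ℂ × (Harm d →L[ℂ] Harm d)

/-- The Floquet operator as a function of its parameters. -/
def floqAt {d : ℕ} (θ : Params d) (η : ℂ) : Harm d →L[ℂ] Harm d :=
  floq d θ.1 θ.2.1 θ.2.2.1 η θ.2.2.2

theorem contDiff_floqAt {d : ℕ} : ContDiff ℂ ⊤ fun x : Params d × ℂ => floqAt x.1 x.2 :=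
  contDiff_floq

/-- The parameters at `ε = 0`. -/
def params₀ {d : ℕ} (p : ℕ) (Ω : ℝ) (A : L2Z d) : Params d := (0, 1, Ω, solitonPot p A)

/-- Every η² carries a factor ε, so at ε = 0 the dependence on η is affine, as
`exists_kernel_branch` requires. -/
theorem floqAt_params₀_add {d p : ℕ} (Ω : ℝ) (A : L2Z d) (η ν : ℂ) :
    floqAt (params₀ p Ω A) (η + ν) = floqAt (params₀ p Ω A) η
      + ν • (2 * Complex.I) • (piOp d * pOp d) := by
  simp only [floqAt, params₀, floq, mul_add, mul_sub, mul_smul_comm]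
  module

theorem exists_floquet_solution {d p : ℕ} (hp : 1 ≤ p) {Ω : ℝ} {A : L2Z d}
    (hA : ∀ n, (A n).im = 0) {Lam : ℂ} {f : L2Z d × L2Z d}
    (heig : IsSimpleIsolatedEigenpair p Ω A Lam f) (hcont : 2 * Lam ∉ contSpectrum d Ω) :
    ∃ ψ : Params d → Harm d × ℂ, AnalyticAt ℂ ψ (params₀ p Ω A) ∧
      ψ (params₀ p Ω A) = (resEmb d f, 0) ∧
      ∃ δ > 0, ∀ᶠ θ in 𝓝 (params₀ p Ω A),
        (ψ θ).1 ≠ 0 ∧ floqAt θ (Lam + (ψ θ).2) (ψ θ).1 = 0 ∧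
        ∀ (μ : ℂ) (D : Harm d), D ≠ 0 → ‖μ‖ ≤ δ → floqAt θ (Lam + μ) D = 0 →
          μ = (ψ θ).2 ∧ ∃ c : ℂ, D = c • (ψ θ).1 := by
  obtain ⟨φ, hφ, hinj, hsur⟩ := exists_bordering hp hA heig hcont
  have hbij := bordered_floq_bijective hp hA hinj hsur
  set θ₀ := params₀ p Ω A with hθ₀
  set y₀ := resEmb d f with hy₀
  have hres : ∀ η, floqAt θ₀ η y₀ = rowEmb d (JH p Ω A f - (2 * η) • f) := fun η =>
    floq_zero_resEmb hp Ω hA η f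
  have hL₀y : floqAt θ₀ Lam y₀ = 0 := by rw [hres, heig.eigen, sub_self, map_zero]
  -- The slope in η is read off by comparing the values at Λ + 1 and Λ.
  have hNy : ((2 * Complex.I) • (piOp d * pOp d)) y₀ = rowEmb d ((-2 : ℂ) • f) := by
    have h1 : floqAt θ₀ (Lam + 1) y₀
        = floqAt θ₀ Lam y₀ + (1 : ℂ) • ((2 * Complex.I) • (piOp d * pOp d)) y₀ :=
      congrArg (fun T : Harm d →L[ℂ] Harm d => T y₀) (floqAt_params₀_add Ω A Lam 1)
    rw [hL₀y, zero_add, one_smul, hres, heig.eigen] at h1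
    rw [← h1]
    congr 1
    module
  refine exists_kernel_branch (L := fun x : Params d × ℂ => floqAt x.1 (Lam + x.2))
    (L₀ := floqAt θ₀ Lam) (N := (2 * Complex.I) • (piOp d * pOp d)) (Φ := φ.comp (resProj d))
    (contDiff_floqAt.comp (f := fun x : Params d × ℂ => (x.1, Lam + x.2)) (by fun_prop))
    (fun ν => floqAt_params₀_add Ω A Lam ν) hL₀y ?_ ?_
  · rw [ContinuousLinearMap.comp_apply, hy₀, resProj_resEmb, hφ]
  · rw [hNy]
    exact hbij

/-! ### The parameters along a branch of breathers -/

/-- The ratio `(1 - ω²) / ε`, with its limit value at `ε = 0`. -/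
def freqRatio (Ω : ℝ) (ω : ℝ → ℝ) (ε : ℝ) : ℝ := if ε = 0 then Ω else (1 - ω ε ^ 2) / ε

theorem mul_freqRatio {Ω : ℝ} {ω : ℝ → ℝ} {ε : ℝ} (hε : ε ≠ 0) :
    (ε : ℂ) * (freqRatio Ω ω ε : ℂ) = 1 - (ω ε : ℂ) ^ 2 := by
  have h : ε * freqRatio Ω ω ε = 1 - ω ε ^ 2 := by
    rw [freqRatio, if_neg hε]
    field_simp
  exact_mod_cast h

/-- With r = ω - 1 + εΩ/2, one has 1 - ω² = εΩ - 2r - (ω - 1)², where r and (ω - 1)² are both O(ε²).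
-/
theorem freqRatio_isBigO {Ω : ℝ} {ω : ℝ → ℝ} {ε₁ C₁ : ℝ} (hε₁ : 0 < ε₁)
    (h : ∀ ε ∈ Set.Ioo 0 ε₁, |ω ε - 1 + ε * Ω / 2| ≤ C₁ * ε ^ 2) :
    (fun ε => freqRatio Ω ω ε - Ω) =O[𝓝[>] 0] fun ε : ℝ => ε := by
  refine Asymptotics.IsBigO.of_bound (2 * C₁ + (|Ω| / 2 + C₁) ^ 2) ?_
  filter_upwards [Ioo_mem_nhdsGT (lt_min hε₁ one_pos)] with ε hε
  have hε0 : 0 < ε := hε.1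
  have hε1 : ε < 1 := hε.2.trans_le (min_le_right _ _)
  have hb := h ε ⟨hε.1, hε.2.trans_le (min_le_left _ _)⟩
  set r := ω ε - 1 + ε * Ω / 2 with hr
  have hC : 0 ≤ C₁ := by
    have : 0 ≤ C₁ * ε ^ 2 := (abs_nonneg _).trans hb
    exact nonneg_of_mul_nonneg_left this (by positivity)
  have hd : |ω ε - 1| ≤ (|Ω| / 2 + C₁) * ε := by
    have e : ω ε - 1 = r - ε * Ω / 2 := by rw [hr]; ring
    rw [e]
    have h2 : |ε * Ω / 2| = |Ω| / 2 * ε := by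
      rw [abs_div, abs_mul, abs_of_pos hε0, abs_two]
      ring
    calc |r - ε * Ω / 2| ≤ |r| + |ε * Ω / 2| := abs_sub _ _
      _ ≤ C₁ * ε ^ 2 + |Ω| / 2 * ε := by rw [h2]; gcongr
      _ ≤ C₁ * ε + |Ω| / 2 * ε := by
          gcongr
          nlinarith
      _ = _ := by ring
  have e : freqRatio Ω ω ε - Ω = (-(2 * r) - (ω ε - 1) ^ 2) / ε := by
    rw [freqRatio, if_neg hε0.ne', hr]
    field_simp
    ring
  rw [e, norm_div, Real.norm_eq_abs, Real.norm_eq_abs, abs_of_pos hε0, div_le_iff₀ hε0]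
  calc |-(2 * r) - (ω ε - 1) ^ 2| ≤ |-(2 * r)| + |(ω ε - 1) ^ 2| := abs_sub _ _
    _ = 2 * |r| + |ω ε - 1| ^ 2 := by rw [abs_neg, abs_mul, abs_two, abs_pow]
    _ ≤ 2 * (C₁ * ε ^ 2) + ((|Ω| / 2 + C₁) * ε) ^ 2 := by gcongr
    _ = _ := by ring

theorem freq_isBigO {Ω : ℝ} {ω : ℝ → ℝ} {ε₁ C₁ : ℝ} (hε₁ : 0 < ε₁)
    (h : ∀ ε ∈ Set.Ioo 0 ε₁, |ω ε - 1 + ε * Ω / 2| ≤ C₁ * ε ^ 2) :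
    (fun ε => ω ε - 1) =O[𝓝[>] 0] fun ε : ℝ => ε := by
  refine Asymptotics.IsBigO.of_bound (|Ω| / 2 + |C₁|) ?_
  filter_upwards [Ioo_mem_nhdsGT (lt_min hε₁ one_pos)] with ε hε
  have hε0 : 0 < ε := hε.1
  have hε1 : ε < 1 := hε.2.trans_le (min_le_right _ _)
  have hb := h ε ⟨hε.1, hε.2.trans_le (min_le_left _ _)⟩
  have h2 : |ε * Ω / 2| = |Ω| / 2 * ε := by
    rw [abs_div, abs_mul, abs_of_pos hε0, abs_two]
    ring
  rw [Real.norm_eq_abs, Real.norm_eq_abs, abs_of_pos hε0]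
  calc |ω ε - 1| = |(ω ε - 1 + ε * Ω / 2) - ε * Ω / 2| := by rw [add_sub_cancel_right]
    _ ≤ |ω ε - 1 + ε * Ω / 2| + |ε * Ω / 2| := abs_sub _ _
    _ ≤ |C₁| * ε + |Ω| / 2 * ε := by
        rw [h2]
        gcongr
        refine hb.trans ?_
        have := le_abs_self C₁
        have h3 : ε ^ 2 ≤ ε := by nlinarith
        calc C₁ * ε ^ 2 ≤ |C₁| * ε ^ 2 := by gcongr
          _ ≤ |C₁| * ε := by gcongr
    _ = _ := by ring

/-- Breather bounds are stated for m ≥ 0; evenness supplies the negative harmonics, whence the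
factor 2. -/
theorem tsum_norm_harm_sub_le {d : ℕ} (B : X2 d) (heven : ∀ m, B.harm (-m) = B.harm m)
    (A : L2Z d) :
    ∑' k, winv k * ‖(weightEquiv d B - solitonHarm A) k‖
      ≤ 2 * (‖B.harm 0‖ + ‖B.harm 1 - A‖ + ∑' m : ℕ, ‖B.harm (m + 2)‖) := by
  set g : ℤ → ℝ := fun k => ‖B.harm k - pairEmb d (A, A) k‖ with hg
  have e : (fun k => winv k * ‖(weightEquiv d B - solitonHarm A) k‖) = g := by
    funext k
    have h1 : (winv k : ℂ) • (weightEquiv d B - solitonHarm A) k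
        = jOp d (weightEquiv d B) k - jOp d (solitonHarm A) k := by
      rw [jOp_apply, jOp_apply, lp.coeFn_sub, Pi.sub_apply, smul_sub]
    rw [hg]
    simp only
    rw [harm_eq_jOp, ← jOp_pairEmb A A, ← solitonHarm, ← h1, norm_smul, norm_winv]
  have hsum : Summable g := by
    rw [← e]
    exact summable_winv_mul_norm _
  have heg : ∀ k, g (-k) = g k := by
    intro k
    simp only [hg, heven]
    congr 2
    by_cases hk : k = 1 ∨ k = -1
    · rcases hk with rfl | rfl
      · rw [pairEmb_one, pairEmb_neg_one]
      · rw [neg_neg, pairEmb_one, pairEmb_neg_one]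
    · rw [pairEmb_of_not _ _ hk, pairEmb_of_not _ _ (by omega)]
  have hs1 : Summable fun n : ℕ => g (n + 1) :=
    hsum.comp_injective (i := fun n : ℕ => (n : ℤ) + 1) (fun a b h => by simpa using h)
  have hg0 : g 0 = ‖B.harm 0‖ := by
    simp only [hg]
    rw [pairEmb_of_not _ _ (by norm_num), sub_zero]
  have hg1 : g 1 = ‖B.harm 1 - A‖ := by
    simp only [hg]
    rw [pairEmb_one]
  have hg2 : ∀ n : ℕ, g ((n : ℤ) + 2) = ‖B.harm (n + 2)‖ := by
    intro n
    simp only [hg]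
    rw [pairEmb_of_not _ _ (by omega), sub_zero]
  have hS : ∑' n : ℕ, g (n + 1) = ‖B.harm 1 - A‖ + ∑' m : ℕ, ‖B.harm (m + 2)‖ := by
    rw [hs1.tsum_eq_zero_add]
    refine congrArg₂ (· + ·) ?_ (tsum_congr fun n => ?_)
    · simpa using hg1
    · rw [← hg2]
      congr 1
  rw [e, tsum_of_add_one_of_neg_add_one hs1 (by simpa only [heg] using hs1)]
  simp only [heg]
  rw [hS, hg0]
  have := norm_nonneg (B.harm 0)
  linarith

/-- The potential of the Floquet problem of `A`. -/
def floqPot {d : ℕ} (p : ℕ) (A : X2 d) : Harm d →L[ℂ] Harm d :=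
  (1 + 2 * p : ℂ) • (conv d (weightEquiv d A)) ^ (2 * p)

/-- The parameters of the rescaled Floquet problem along a branch. -/
def pathParams {d : ℕ} (p : ℕ) (Ω : ℝ) (ω : ℝ → ℝ) (A : ℝ → X2 d) (ε : ℝ) : Params d :=
  ((ε : ℂ), (ω ε : ℂ), (freqRatio Ω ω ε : ℂ), floqPot p (A ε))

theorem floqPot_isBigO {d p : ℕ} {Ω : ℝ} {A₀ : L2Z d} {ε₁ C₁ : ℝ} {ω : ℝ → ℝ} {A : ℝ → X2 d}
    (hε₁ : 0 < ε₁) (h : IsBreatherBranch p Ω A₀ ε₁ C₁ ω A) :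
    (fun ε => floqPot p (A ε) - solitonPot p A₀) =O[𝓝[>] 0] fun ε : ℝ => ε := by
  have h1 : (fun ε => conv d (weightEquiv d (A ε)) - conv d (solitonHarm A₀))
      =O[𝓝[>] 0] fun ε : ℝ => ε := by
    refine Asymptotics.IsBigO.of_bound (2 * C₁) ?_
    filter_upwards [Ioo_mem_nhdsGT hε₁] with ε hε
    rw [← map_sub]
    refine (norm_conv_le _).trans ?_
    refine (tsum_norm_harm_sub_le (A ε) (h.breather ε hε).even A₀).trans ?_
    rw [Real.norm_of_nonneg hε.1.le, mul_assoc]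
    exact mul_le_mul_of_nonneg_left (h.harm_bound ε hε) zero_le_two
  have hid : Filter.Tendsto (fun ε : ℝ => ε) (𝓝[>] 0) (𝓝 0) :=
    tendsto_nhdsWithin_of_tendsto_nhds Filter.tendsto_id
  have h2 : Filter.Tendsto (fun ε => conv d (weightEquiv d (A ε))) (𝓝[>] 0)
      (𝓝 (conv d (solitonHarm A₀))) :=
    tendsto_sub_nhds_zero_iff.mp (h1.trans_tendsto hid)
  have h3 : DifferentiableAt ℂ (fun T : Harm d →L[ℂ] Harm d => (1 + 2 * p : ℂ) • T ^ (2 * p))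
      (conv d (solitonHarm A₀)) := by fun_prop
  exact (h3.isBigO_sub.comp_tendsto h2).trans h1

theorem pathParams_isBigO {d p : ℕ} {Ω : ℝ} {A₀ : L2Z d} {ε₁ C₁ : ℝ} {ω : ℝ → ℝ} {A : ℝ → X2 d}
    (hε₁ : 0 < ε₁) (h : IsBreatherBranch p Ω A₀ ε₁ C₁ ω A) :
    (fun ε => pathParams p Ω ω A ε - params₀ p Ω A₀) =O[𝓝[>] 0] fun ε : ℝ => ε := by
  have e : (fun ε => pathParams p Ω ω A ε - params₀ p Ω A₀) = fun ε =>
      (((ε : ℝ) : ℂ), ((ω ε - 1 : ℝ) : ℂ), ((freqRatio Ω ω ε - Ω : ℝ) : ℂ),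
        floqPot p (A ε) - solitonPot p A₀) := by
    funext ε
    simp [pathParams, params₀]
  rw [e]
  have hof : ∀ u : ℝ → ℝ, u =O[𝓝[>] 0] (fun ε : ℝ => ε) →
      (fun ε => (u ε : ℂ)) =O[𝓝[>] 0] fun ε : ℝ => ε := by
    intro u hu
    refine Asymptotics.IsBigO.of_norm_left ?_
    simpa only [Complex.norm_real] using hu.norm_left
  exact (hof _ (Asymptotics.isBigO_refl _ _)).prod_left
    ((hof _ (freq_isBigO hε₁ h.freq_bound)).prod_left
      ((hof _ (freqRatio_isBigO hε₁ h.freq_bound)).prod_left (floqPot_isBigO hε₁ h)))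

theorem pathParams_tendsto {d p : ℕ} {Ω : ℝ} {A₀ : L2Z d} {ε₁ C₁ : ℝ} {ω : ℝ → ℝ}
    {A : ℝ → X2 d} (hε₁ : 0 < ε₁) (h : IsBreatherBranch p Ω A₀ ε₁ C₁ ω A) :
    Filter.Tendsto (pathParams p Ω ω A) (𝓝[>] 0) (𝓝 (params₀ p Ω A₀)) :=
  tendsto_sub_nhds_zero_iff.mp ((pathParams_isBigO hε₁ h).trans_tendsto
    (tendsto_nhdsWithin_of_tendsto_nhds Filter.tendsto_id))

theorem freqRatio_analyticAt {Ω : ℝ} {ω : ℝ → ℝ} {ε : ℝ} (hε : ε ≠ 0) (hω : AnalyticAt ℝ ω ε) :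
    AnalyticAt ℝ (freqRatio Ω ω) ε := by
  have h1 : AnalyticAt ℝ (fun x => (1 - ω x ^ 2) / x) ε :=
    (analyticAt_const.sub (hω.pow 2)).div analyticAt_id hε
  refine h1.congr ?_
  filter_upwards [isOpen_ne.mem_nhds hε] with x hx
  rw [freqRatio, if_neg hx]

/-- The quotient has a removable singularity: `dslope` is its analytic extension, and the one-sided
limit identifies the value at 0 with Ω. -/
theorem freqRatio_analyticAt_zero {Ω : ℝ} {ω : ℝ → ℝ}
    (hlim : Filter.Tendsto (freqRatio Ω ω) (𝓝[>] 0) (𝓝 Ω)) (hω : AnalyticAt ℝ ω 0)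
    (h1 : ω 0 = 1) : AnalyticAt ℝ (freqRatio Ω ω) 0 := by
  set f : ℝ → ℝ := fun x => 1 - ω x ^ 2 with hf
  have hfa : AnalyticAt ℝ f 0 := analyticAt_const.sub (hω.pow 2)
  have hf0 : f 0 = 0 := by simp [hf, h1]
  obtain ⟨q, hq⟩ := hfa
  have hd : AnalyticAt ℝ (dslope f 0) 0 := ⟨_, hq.has_fpower_series_dslope_fslope⟩
  have hne : ∀ x, x ≠ 0 → dslope f 0 x = freqRatio Ω ω x := by
    intro x hx
    rw [dslope_of_ne _ hx, slope_def_field, hf0, freqRatio, if_neg hx, sub_zero, sub_zero]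
  have h0 : dslope f 0 0 = Ω := by
    have t1 : Filter.Tendsto (dslope f 0) (𝓝[>] 0) (𝓝 (dslope f 0 0)) :=
      tendsto_nhdsWithin_of_tendsto_nhds hd.continuousAt
    refine tendsto_nhds_unique t1 (hlim.congr' ?_)
    filter_upwards [self_mem_nhdsWithin] with x hx
    exact (hne x (ne_of_gt hx)).symm
  have : freqRatio Ω ω = dslope f 0 := by
    funext x
    by_cases hx : x = 0
    · rw [hx, h0, freqRatio, if_pos rfl]
    · rw [hne x hx]
  rw [this]
  exact hd

/-- The map from frequencies and breathers to parameters. -/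
def toParams (d p : ℕ) (v : ℂ × ℂ × ℂ × X2 d) : Params d := (v.1, v.2.1, v.2.2.1, floqPot p v.2.2.2)

theorem toParams_analyticAt {d p : ℕ} (v : ℂ × ℂ × ℂ × X2 d) : AnalyticAt ℂ (toParams d p) v := by
  have hw : ContDiff ℂ ⊤ (weightEquiv d) := (weightEquiv d).contDiff
  have h : ContDiff ℂ ⊤ (toParams d p) := by
    unfold toParams floqPot
    fun_prop
  exact h.contDiffAt.analyticAt

theorem analyticAt_comp_pathParams {d p : ℕ} {Ω : ℝ} {ω : ℝ → ℝ} {A : ℝ → X2 d} {ε : ℝ}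
    {E : Type*} [NormedAddCommGroup E] [NormedSpace ℂ E] {ψ : Params d → E}
    (hψ : AnalyticAt ℂ ψ (pathParams p Ω ω A ε)) (hω : AnalyticAt ℝ ω ε)
    (hσ : AnalyticAt ℝ (freqRatio Ω ω) ε) (hA : AnalyticAt ℝ A ε) :
    AnalyticAt ℝ (fun x => ψ (pathParams p Ω ω A x)) ε := by
  have hof : ∀ {u : ℝ → ℝ}, AnalyticAt ℝ u ε → AnalyticAt ℝ (fun x => (u x : ℂ)) ε :=
    fun hu => (Complex.ofRealCLM.analyticAt _).comp hu
  let path : ℝ → ℂ × ℂ × ℂ × X2 d := fun x => ((x : ℂ), (ω x : ℂ), (freqRatio Ω ω x : ℂ), A x)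
  have hpath : AnalyticAt ℝ path ε :=
    (hof analyticAt_id).prod ((hof hω).prod ((hof hσ).prod hA))
  have hcomp : AnalyticAt ℂ (ψ ∘ toParams d p) (path ε) :=
    AnalyticAt.comp (g := ψ) (f := toParams d p) hψ (toParams_analyticAt _)
  exact AnalyticAt.comp (g := ψ ∘ toParams d p) (f := path) hcomp.restrictScalars hpath

/-! ### The Floquet branch -/

theorem norm_harm_symm_sub_le {d : ℕ} (y y₀ : Harm d) (m : ℤ) :
    ‖((weightEquiv d).symm y).harm m - (winv m : ℂ) • y₀ m‖ ≤ ‖y - y₀‖ := by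
  rw [harm_symm, ← smul_sub, norm_smul, norm_winv]
  have h : ‖y m - y₀ m‖ ≤ ‖y - y₀‖ := norm_harm_apply_le (y - y₀) m
  have h1 := winv_le_one m
  have h2 := (winv_pos m).le
  nlinarith [norm_nonneg (y m - y₀ m)]

theorem tsum_nonresonant_le {d : ℕ} (y : Harm d) (f : L2Z d × L2Z d) :
    ∑' m : {m : ℤ // m ≠ 1 ∧ m ≠ -1}, ‖((weightEquiv d).symm y).harm m‖
      ≤ (∑' k, winv k) * ‖y - resEmb d f‖ := by
  have e : ∀ m : {m : ℤ // m ≠ 1 ∧ m ≠ -1}, ‖((weightEquiv d).symm y).harm m‖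
      = winv m * ‖(y - resEmb d f) (m : ℤ)‖ := by
    rintro ⟨m, hm⟩
    have h0 : resEmb d f m = 0 := pairEmb_of_not _ _ (by tauto)
    rw [harm_symm, norm_smul, norm_winv, lp.coeFn_sub, Pi.sub_apply, h0, sub_zero]
  simp only [e]
  refine le_trans ?_ (tsum_winv_mul_norm_le (y - resEmb d f))
  exact (summable_winv_mul_norm (y - resEmb d f)).tsum_subtype_le
    (fun k => winv k * ‖(y - resEmb d f) k‖) {m : ℤ | m ≠ 1 ∧ m ≠ -1}
    (fun k => mul_nonneg (winv_pos k).le (norm_nonneg _))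

theorem exists_floquet_branch {d p : ℕ} (hp : 1 ≤ p) {Ω : ℝ} {A₀ : L2Z d}
    (hreal : ∀ n, (A₀ n).im = 0) {Lam : ℂ} {bp bm : L2Z d}
    (heig : IsSimpleIsolatedEigenpair p Ω A₀ Lam (bp, bm))
    (hcont : 2 * Lam ∉ contSpectrum d Ω) {ε₁ C₁ : ℝ} {ω : ℝ → ℝ} {A : ℝ → X2 d} (hε₁ : 0 < ε₁)
    (hbr : IsBreatherBranch p Ω A₀ ε₁ C₁ ω A) :
    ∃ (ε₀ C₀ δ : ℝ) (lam : ℝ → ℂ) (B : ℝ → X2 d),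
      0 < ε₀ ∧ ε₀ ≤ ε₁ ∧ 0 < C₀ ∧ C₀ * ε₀ ≤ δ ∧
      AnalyticOnNhd ℝ lam (Set.Ioo 0 ε₀) ∧ AnalyticOnNhd ℝ B (Set.Ioo 0 ε₀) ∧
      (AnalyticAt ℝ ω 0 → AnalyticAt ℝ A 0 → AnalyticAt ℝ lam 0 ∧ AnalyticAt ℝ B 0) ∧
      ∀ ε ∈ Set.Ioo 0 ε₀,
        IsFloquetEigenpair p ε (ω ε) (A ε) (lam ε) (B ε) ∧
        ‖lam ε - ε * Lam‖ ≤ C₀ * ε ^ 2 ∧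
        ‖(B ε).harm 1 - bp - Complex.I • bm‖ + ‖(B ε).harm (-1) - bp + Complex.I • bm‖
          ≤ C₀ * ε ∧
        ∑' m : {m : ℤ // m ≠ 1 ∧ m ≠ -1}, ‖(B ε).harm m‖ ≤ C₀ * ε ∧
        ∀ (mu : ℂ) (D : X2 d), IsFloquetEigenpair p ε (ω ε) (A ε) mu D →
          ‖mu - ε * Lam‖ ≤ δ * ε → mu = lam ε ∧ ∃ c : ℂ, D = c • B ε := by
  obtain ⟨ψ, hψa, hψ0, δ, hδ0, hψ⟩ := exists_floquet_solution hp hreal heig hcont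
  set θ := pathParams p Ω ω A with hθ
  have hθlim : Filter.Tendsto θ (𝓝[>] 0) (𝓝 (params₀ p Ω A₀)) := pathParams_tendsto hε₁ hbr
  have hψO : (fun ε => ψ (θ ε) - (resEmb d (bp, bm), (0 : ℂ))) =O[𝓝[>] 0] fun ε : ℝ => ε := by
    rw [← hψ0]
    exact (hψa.differentiableAt.isBigO_sub.comp_tendsto hθlim).trans (pathParams_isBigO hε₁ hbr)
  obtain ⟨C, hC0, hC⟩ := hψO.exists_pos
  rw [Asymptotics.isBigOWith_iff] at hC
  set S := ∑' k, winv k with hS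
  have hS0 : 0 ≤ S := tsum_nonneg fun k => (winv_pos k).le
  -- S accounts for the sum over nonresonant harmonics, 2 for the harmonics m = ±1.
  set C₀ := (S + 2) * C with hC₀
  have hC₀0 : 0 < C₀ := by positivity
  have hev : ∀ᶠ ε in 𝓝[>] (0 : ℝ), ε < min ε₁ (δ / C₀) ∧
      ‖ψ (θ ε) - (resEmb d (bp, bm), (0 : ℂ))‖ ≤ C * ‖ε‖ ∧ AnalyticAt ℂ ψ (θ ε) ∧
      (ψ (θ ε)).1 ≠ 0 ∧ floqAt (θ ε) (Lam + (ψ (θ ε)).2) (ψ (θ ε)).1 = 0 ∧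
        ∀ (μ : ℂ) (D : Harm d), D ≠ 0 → ‖μ‖ ≤ δ → floqAt (θ ε) (Lam + μ) D = 0 →
          μ = (ψ (θ ε)).2 ∧ ∃ c : ℂ, D = c • (ψ (θ ε)).1 := by
    have h1 : ∀ᶠ ε in 𝓝[>] (0 : ℝ), ε < min ε₁ (δ / C₀) := by
      filter_upwards [Ioo_mem_nhdsGT (lt_min hε₁ (div_pos hδ0 hC₀0))] with ε hε
      exact hε.2
    exact h1.and (hC.and ((hθlim.eventually hψa.eventually_analyticAt).and
      (hθlim.eventually hψ)))
  obtain ⟨u, hu0, hu⟩ := mem_nhdsGT_iff_exists_Ioo_subset.mp hev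
  set ε₀ := min u (min ε₁ (δ / C₀)) with hε₀
  have hε₀0 : 0 < ε₀ := lt_min hu0 (lt_min hε₁ (div_pos hδ0 hC₀0))
  have hε₀1 : ε₀ ≤ ε₁ := (min_le_right _ _).trans (min_le_left _ _)
  have hmem : ∀ ε ∈ Set.Ioo 0 ε₀, ε ∈ Set.Ioo 0 u := fun ε hε =>
    ⟨hε.1, hε.2.trans_le (min_le_left _ _)⟩
  have hψan : ∀ ε, AnalyticAt ℂ ψ (θ ε) → AnalyticAt ℝ ω ε → AnalyticAt ℝ (freqRatio Ω ω) ε →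
      AnalyticAt ℝ A ε → AnalyticAt ℝ (fun x : ℝ => (x : ℂ) * (Lam + (ψ (θ x)).2)) ε ∧
        AnalyticAt ℝ (fun x => (weightEquiv d).symm (ψ (θ x)).1) ε := by
    intro ε h1 h2 h3 h4
    constructor
    · have h5 : AnalyticAt ℝ (fun x => (ψ (θ x)).2) ε :=
        analyticAt_comp_pathParams (ψ := fun v => (ψ v).2)
          (((ContinuousLinearMap.snd ℂ (Harm d) ℂ).analyticAt _).comp h1) h2 h3 h4
      exact (Complex.ofRealCLM.analyticAt ε).mul (analyticAt_const.add h5)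
    · exact analyticAt_comp_pathParams (ψ := fun v => (weightEquiv d).symm (ψ v).1)
          (((((weightEquiv d).symm : Harm d →L[ℂ] X2 d).comp
            (ContinuousLinearMap.fst ℂ (Harm d) ℂ)).analyticAt _).comp h1) h2 h3 h4
  have hpt : ∀ ε ∈ Set.Ioo 0 ε₀, AnalyticAt ℝ (fun x : ℝ => (x : ℂ) * (Lam + (ψ (θ x)).2)) ε ∧
        AnalyticAt ℝ (fun x => (weightEquiv d).symm (ψ (θ x)).1) ε := by
    intro ε hε
    have hε' : ε ∈ Set.Ioo 0 ε₁ := ⟨hε.1, hε.2.trans_le hε₀1⟩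
    exact hψan ε (hu (hmem ε hε)).2.2.1 (hbr.analytic_freq ε hε')
      (freqRatio_analyticAt hε.1.ne' (hbr.analytic_freq ε hε')) (hbr.analytic_harm ε hε')
  refine ⟨ε₀, C₀, δ, fun x : ℝ => (x : ℂ) * (Lam + (ψ (θ x)).2),
    fun x => (weightEquiv d).symm (ψ (θ x)).1, hε₀0, hε₀1, hC₀0, ?_, fun ε hε => (hpt ε hε).1,
    fun ε hε => (hpt ε hε).2, fun hω hA => ?_, fun ε hε => ?_⟩
  · have : ε₀ ≤ δ / C₀ := (min_le_right _ _).trans (min_le_right _ _)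
    rwa [le_div_iff₀ hC₀0, mul_comm] at this
  -- Values at ε = 0 are not prescribed by the branch; continuity there and the right limits show
  -- that the path starts at `params₀`.
  · have hω0 : ω 0 = 1 := by
      have t1 : Filter.Tendsto (fun ε => (θ ε).2.1) (𝓝[>] 0) (𝓝 (1 : ℂ)) :=
        ((continuous_fst.comp continuous_snd).tendsto _).comp hθlim
      have t2 : Filter.Tendsto (fun ε => (ω ε : ℂ)) (𝓝[>] 0) (𝓝 (ω 0 : ℂ)) :=
        (Complex.continuous_ofReal.tendsto _).comp
          (tendsto_nhdsWithin_of_tendsto_nhds hω.continuousAt)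
      exact_mod_cast tendsto_nhds_unique t2 t1
    have hlim : Filter.Tendsto (freqRatio Ω ω) (𝓝[>] 0) (𝓝 Ω) :=
      tendsto_sub_nhds_zero_iff.mp ((freqRatio_isBigO hε₁ hbr.freq_bound).trans_tendsto
        (tendsto_nhdsWithin_of_tendsto_nhds Filter.tendsto_id))
    have hpot : floqPot p (A 0) = solitonPot p A₀ := by
      have hc : Continuous fun B : X2 d => floqPot p B := by
        have hw : Continuous (weightEquiv d) := (weightEquiv d).continuous
        unfold floqPot
        fun_prop
      have t1 : Filter.Tendsto (fun ε => (θ ε).2.2.2) (𝓝[>] 0) (𝓝 (solitonPot p A₀)) :=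
        ((continuous_snd.comp (continuous_snd.comp continuous_snd)).tendsto
          (params₀ p Ω A₀)).comp hθlim
      have t2 : Filter.Tendsto (fun ε => floqPot p (A ε)) (𝓝[>] 0) (𝓝 (floqPot p (A 0))) :=
        (hc.tendsto _).comp (tendsto_nhdsWithin_of_tendsto_nhds hA.continuousAt)
      exact tendsto_nhds_unique t2 t1
    have hθ0 : θ 0 = params₀ p Ω A₀ := by
      simp [hθ, pathParams, params₀, hω0, hpot, freqRatio]
    exact hψan 0 (by rwa [hθ0]) hω (freqRatio_analyticAt_zero hlim hω hω0) hA
  · obtain ⟨-, hbd, -, hne, hsol, huniq⟩ := hu (hmem ε hε)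
    have hε0 : 0 < ε := hε.1
    rw [Real.norm_of_nonneg hε0.le] at hbd
    have hb1 : ‖(ψ (θ ε)).1 - resEmb d (bp, bm)‖ ≤ C * ε := (norm_fst_le _).trans hbd
    have hb2 : ‖(ψ (θ ε)).2‖ ≤ C * ε := by
      have := (norm_snd_le _).trans hbd
      rwa [Prod.snd_sub, sub_zero] at this
    have hCε : 0 ≤ C * ε := by positivity
    have hσ := mul_freqRatio (Ω := Ω) (ω := ω) hε0.ne'
    have hC₀C : C₀ * ε = S * (C * ε) + 2 * (C * ε) := by rw [hC₀]; ring
    refine ⟨?_, ?_, ?_, ?_, fun mu D hD hmu => ?_⟩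
    · rw [isFloquetEigenpair_iff hε0.ne' hσ rfl, LinearIsometryEquiv.apply_symm_apply]
      exact ⟨hne, hsol⟩
    · have e : (ε : ℂ) * (Lam + (ψ (θ ε)).2) - ε * Lam = ε * (ψ (θ ε)).2 := by ring
      rw [e, norm_mul, Complex.norm_real, Real.norm_of_nonneg hε0.le]
      have : C * ε ≤ C₀ * ε := by nlinarith
      calc ε * ‖(ψ (θ ε)).2‖ ≤ ε * (C₀ * ε) := by gcongr; exact hb2.trans this
        _ = C₀ * ε ^ 2 := by ring
    · have h1 := norm_harm_symm_sub_le (ψ (θ ε)).1 (resEmb d (bp, bm)) 1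
      have h2 := norm_harm_symm_sub_le (ψ (θ ε)).1 (resEmb d (bp, bm)) (-1)
      rw [resEmb_apply, pairEmb_one, winv_one, smul_smul] at h1
      rw [resEmb_apply, pairEmb_neg_one, winv_neg_one, smul_smul] at h2
      have e2 : (((2⁻¹ : ℝ) : ℂ) * 2) = 1 := by norm_num
      rw [e2, one_smul, ← sub_sub, ← resEmb_apply] at h1
      rw [e2, one_smul, ← sub_add, ← resEmb_apply] at h2
      have := mul_nonneg hS0 hCε
      linarith
    · refine (tsum_nonresonant_le _ (bp, bm)).trans ?_
      have : S * ‖(ψ (θ ε)).1 - resEmb d (bp, bm)‖ ≤ S * (C * ε) := by gcongr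
      linarith
    · have hεC : (ε : ℂ) ≠ 0 := by exact_mod_cast hε0.ne'
      -- In the variable μ/ε - Λ the disc of radius δε becomes the fixed disc of radius δ.
      have hmu' : mu = ε * (Lam + (mu / ε - Lam)) := by field_simp; ring
      obtain ⟨hD0, hDs⟩ := (isFloquetEigenpair_iff hε0.ne' hσ hmu' (A ε) D).mp hD
      have hsm : ‖mu / ε - Lam‖ ≤ δ := by
        have e : mu / ε - Lam = (mu - ε * Lam) / ε := by field_simp
        rw [e, norm_div, Complex.norm_real, Real.norm_of_nonneg hε0.le, div_le_iff₀ hε0]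
        exact hmu
      obtain ⟨h1, c, h2⟩ := huniq _ _ hD0 hsm hDs
      refine ⟨by simpa only [h1] using hmu', c, ?_⟩
      rw [← map_smul, ← h2, LinearIsometryEquiv.symm_apply_apply]

/-! ### Symmetries -/

section Symmetry

variable {d : ℕ} {T : Harm d → Harm d} {χ : ℂ →+* ℂ} {e : ℤ ≃+ ℤ}

/-- The maps T y m n = χ(y (e m) n) treat two symmetries at once: reflection (χ the identity, e
negation) and complex conjugation (e the identity). -/
theorem winv_symm (he : ∀ m, e m ^ 2 = m ^ 2) (m : ℤ) : winv (e m) = winv m := by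
  have h : ((e m : ℤ) : ℝ) ^ 2 = (m : ℝ) ^ 2 := by exact_mod_cast he m
  rw [winv, winv, h]

theorem resonant_symm (he : ∀ m, e m ^ 2 = m ^ 2) (m : ℤ) :
    (e m = 1 ∨ e m = -1) ↔ (m = 1 ∨ m = -1) := by
  rw [← sq_eq_one_iff, ← sq_eq_one_iff, he]

theorem symm_jOp (hT : ∀ y m n, T y m n = χ (y (e m) n)) (hχr : ∀ r : ℝ, χ r = r)
    (he : ∀ m, e m ^ 2 = m ^ 2) (y : Harm d) : T (jOp d y) = jOp d (T y) := by
  refine harm_ext fun m n => ?_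
  rw [hT, jOp_apply_apply, jOp_apply_apply, map_mul, hχr, winv_symm he, hT]

theorem symm_conv (hT : ∀ y m n, T y m n = χ (y (e m) n)) (hχ : Continuous χ)
    (hχr : ∀ r : ℝ, χ r = r) (he : ∀ m, e m ^ 2 = m ^ 2) (y z : Harm d) :
    T (conv d y z) = conv d (T y) (T z) := by
  refine harm_ext fun m n => ?_
  rw [hT]
  have h1 := (hasSum_conv_apply y z (e m) n).map χ hχ
  have h2 := e.toEquiv.hasSum_iff.mpr h1
  refine h2.unique ?_
  convert! hasSum_conv_apply (T y) (T z) m n using 1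
  funext k
  simp only [Function.comp_apply]
  have hk : e.toEquiv k = e k := rfl
  rw [hk, map_mul, map_mul, hχr, winv_symm he, hT, hT, map_sub e]

theorem symm_conv_pow (hT : ∀ y m n, T y m n = χ (y (e m) n)) (hχ : Continuous χ)
    (hχr : ∀ r : ℝ, χ r = r) (he : ∀ m, e m ^ 2 = m ^ 2) (y z : Harm d) (k : ℕ) :
    T (((conv d y) ^ k) z) = ((conv d (T y)) ^ k) (T z) := by
  induction k with
  | zero => rfl
  | succ k ih =>
    rw [pow_succ', pow_succ']
    change T (conv d y (((conv d y) ^ k) z)) = conv d (T y) (((conv d (T y)) ^ k) (T z))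
    rw [symm_conv hT hχ hχr he, ih]

theorem map_lap (χ : ℂ →+* ℂ) (u : (Fin d → ℤ) → ℂ) (n : Fin d → ℤ) :
    χ (lap u n) = lap (fun k => χ (u k)) n := by
  simp only [lap, map_sum, map_sub, map_add, map_mul, map_ofNat]

/-- At η = 0 the symbol 1 - m²ω² is even in m and has no imaginary coefficient; the term 2imηω would
break both symmetries. -/
theorem symm_floq (hT : ∀ y m n, T y m n = χ (y (e m) n))
    (hχr : ∀ r : ℝ, χ r = r) (he : ∀ m, e m ^ 2 = m ^ 2) {ε ω σ : ℂ} (hε : χ ε = ε)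
    (hω : χ ω = ω) (hσ : χ σ = σ) {W W' : Harm d →L[ℂ] Harm d} (hW : ∀ z, T (W z) = W' (T z))
    (y : Harm d) : T (floq d ε ω σ 0 W y) = floq d ε ω σ 0 W' (T y) := by
  have hlap : ∀ z : Harm d, ∀ m n, χ (lapOp d (z (e m)) n) = lapOp d (T z m) n := by
    intro z m n
    rw [lapOp_apply, lapOp_apply, map_lap]
    congr 1
    funext k
    rw [hT]
  refine harm_ext fun m n => ?_
  rw [hT]
  by_cases hm : m = 1 ∨ m = -1
  · rw [floq_apply_of _ _ _ _ _ _ hm, floq_apply_of _ _ _ _ _ _ ((resonant_symm he m).mpr hm),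
      ← symm_jOp hT hχr he, ← hW]
    simp only [lp.coeFn_sub, lp.coeFn_add, lp.coeFn_smul, Pi.sub_apply, Pi.add_apply,
        Pi.smul_apply, smul_eq_mul, mul_zero, zero_mul, add_zero, ne_eq, OfNat.ofNat_ne_zero,
        not_false_eq_true, zero_pow]
    rw [map_sub, map_add, map_mul, hσ, hlap, hT, hT]
  · rw [floq_apply_of_not _ _ _ _ _ _ hm,
      floq_apply_of_not _ _ _ _ _ _ (fun h => hm ((resonant_symm he m).mp h)),
      ← symm_jOp hT hχr he, ← hW]
    have e1 : ∀ k : ℤ, (1 + (ε * 0 + Complex.I * k * ω) ^ 2) = 1 - ((k ^ 2 : ℤ) : ℂ) * ω ^ 2 := by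
      intro k
      push_cast
      linear_combination (k * ω) ^ 2 * Complex.I_mul_I
    rw [e1, e1, he]
    simp only [lp.coeFn_sub, lp.coeFn_add, lp.coeFn_smul, Pi.sub_apply, Pi.add_apply,
        Pi.smul_apply, smul_eq_mul]
    rw [map_add, map_mul, map_mul, map_sub, map_sub, map_one, map_mul, map_pow, hω, hε, hlap, hT,
      hT, map_intCast]

end Symmetry

/-- The reflection `(y_m) ↦ (y_{-m})`. -/
def reflOp (d : ℕ) : Harm d →L[ℂ] Harm d := reindexOp d (Equiv.neg ℤ)

theorem reflOp_apply {d : ℕ} (y : Harm d) (m : ℤ) : reflOp d y m = y (-m) := rfl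

theorem reflOp_reflOp {d : ℕ} (y : Harm d) : reflOp d (reflOp d y) = y := by
  ext1
  funext m
  rw [reflOp_apply, reflOp_apply, neg_neg]

theorem reflOp_symm {d : ℕ} (y : Harm d) (m : ℤ) (n : Fin d → ℤ) :
    reflOp d y m n = RingHom.id ℂ (y (AddEquiv.neg ℤ m) n) := rfl

theorem reflOp_conv_pow {d : ℕ} (y z : Harm d) (k : ℕ) :
    reflOp d (((conv d y) ^ k) z) = ((conv d (reflOp d y)) ^ k) (reflOp d z) :=
  symm_conv_pow (T := reflOp d) reflOp_symm continuous_id (fun _ => rfl)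
    (fun m => neg_sq m) y z k

theorem reflOp_floq {d : ℕ} (ε ω σ : ℂ) {W W' : Harm d →L[ℂ] Harm d}
    (hW : ∀ z, reflOp d (W z) = W' (reflOp d z)) (y : Harm d) :
    reflOp d (floq d ε ω σ 0 W y) = floq d ε ω σ 0 W' (reflOp d y) :=
  symm_floq (T := reflOp d) reflOp_symm (fun _ => rfl) (fun m => neg_sq m) rfl rfl rfl hW y

theorem star_symm {d : ℕ} (y : Harm d) (m : ℤ) (n : Fin d → ℤ) :
    (star y) m n = starRingEnd ℂ (y (AddEquiv.refl ℤ m) n) := rfl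

theorem star_floq_conv_pow {d : ℕ} (ε ω σ : ℝ) (k : ℕ) (y : Harm d) :
    star (floq d ε ω σ 0 ((conv d y) ^ k) y)
      = floq d ε ω σ 0 ((conv d (star y)) ^ k) (star y) :=
  symm_floq (T := star) star_symm (fun r => Complex.conj_ofReal r) (fun _ => rfl)
    (Complex.conj_ofReal ε) (Complex.conj_ofReal ω) (Complex.conj_ofReal σ)
    (fun z => symm_conv_pow (T := star) star_symm Complex.continuous_conj
      (fun r => Complex.conj_ofReal r) (fun _ => rfl) y z k) y

/-! ### The derivative of the nonlinearity -/

theorem commute_convTerm {d : ℕ} (y z : Harm d) (k l : ℤ) :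
    Commute (convTerm y k) (convTerm z l) := by
  refine ContinuousLinearMap.ext fun x => harm_ext fun m n => ?_
  change convTerm y k (convTerm z l x) m n = convTerm z l (convTerm y k x) m n
  rw [convTerm_apply, convTerm_apply, convTerm_apply, convTerm_apply, sub_right_comm]
  ring

theorem commute_conv {d : ℕ} (y z : Harm d) : Commute (conv d y) (conv d z) := by
  change Commute (∑' k, convTerm y k) (∑' l, convTerm z l)
  exact Commute.tsum_right _ fun l => Commute.tsum_left _ fun k => commute_convTerm y z k l

/-- Once both arguments are unweighted, convolution is symmetric under k ↦ m - k. -/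
theorem conv_jOp_comm {d : ℕ} (y z : Harm d) : conv d y (jOp d z) = conv d z (jOp d y) := by
  refine harm_ext fun m n => ?_
  rw [conv_apply_eq, conv_apply_eq, ← (Equiv.subLeft m).tsum_eq]
  refine tsum_congr fun k => ?_
  rw [Equiv.subLeft_apply, sub_sub_cancel, mul_comm]

/-- The rule (U^{k+1})' = (k+1)U^k; commutativity moves the increment to the last place. For k = 2p
it produces the Floquet factor 1 + 2p. -/
theorem hasFDerivAt_conv_pow {d : ℕ} (k : ℕ) (y : Harm d) :
    HasFDerivAt (fun y : Harm d => ((conv d y) ^ k) (jOp d y))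
      ((k + 1 : ℂ) • ((conv d y) ^ k * jOp d)) y := by
  induction k with
  | zero =>
    have : HasFDerivAt (fun y : Harm d => jOp d y) (jOp d) y := (jOp d).hasFDerivAt
    simpa using this
  | succ k ih =>
    have e : (fun y : Harm d => ((conv d y) ^ (k + 1)) (jOp d y))
        = fun y => conv d y (((conv d y) ^ k) (jOp d y)) := by
      funext y
      rw [pow_succ']
      rfl
    rw [e]
    refine ((conv d).hasFDerivAt.clm_apply ih).congr_fderiv ?_
    ext1 h
    have h1 : conv d h (((conv d y) ^ k) (jOp d y)) = ((conv d y) ^ (k + 1)) (jOp d h) := by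
      have hc : conv d h * (conv d y) ^ k = (conv d y) ^ k * conv d h :=
        (commute_conv h y).pow_right k
      calc conv d h (((conv d y) ^ k) (jOp d y)) = (conv d h * (conv d y) ^ k) (jOp d y) := rfl
        _ = ((conv d y) ^ k) (conv d h (jOp d y)) := by rw [hc]; rfl
        _ = ((conv d y) ^ k) (conv d y (jOp d h)) := by rw [conv_jOp_comm]
        _ = ((conv d y) ^ (k + 1)) (jOp d h) := by rw [pow_succ]; rfl
    have h2 : conv d y (((k : ℂ) + 1) • ((conv d y) ^ k) (jOp d h))
        = ((k : ℂ) + 1) • ((conv d y) ^ (k + 1)) (jOp d h) := by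
      rw [map_smul, pow_succ']
      rfl
    change conv d y (((k : ℂ) + 1) • ((conv d y) ^ k) (jOp d h))
        + conv d h (((conv d y) ^ k) (jOp d y))
      = (((k + 1 : ℕ) : ℂ) + 1) • ((conv d y) ^ (k + 1)) (jOp d h)
    rw [h1, h2]
    push_cast
    module

theorem floq_eq_add {d : ℕ} (ε ω σ η : ℂ) (W : Harm d →L[ℂ] Harm d) :
    floq d ε ω σ η W = floq d ε ω σ η 0 + (piOp d + ε • (1 - piOp d)) * (W * jOp d) := by
  simp only [floq, sub_mul, mul_sub, zero_mul, mul_zero]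
  abel

/-! ### Existence of breathers -/

theorem reflOp_pairEmb {d : ℕ} (u v : L2Z d) : reflOp d (pairEmb d (u, v)) = pairEmb d (v, u) := by
  ext1
  funext m
  rw [reflOp_apply]
  by_cases hm : m = 1 ∨ m = -1
  · rcases hm with rfl | rfl
    · rw [pairEmb_one, pairEmb_neg_one]
    · rw [neg_neg, pairEmb_one, pairEmb_neg_one]
  · rw [pairEmb_of_not _ _ hm, pairEmb_of_not _ _ (by omega)]

theorem reflOp_solitonHarm {d : ℕ} (A : L2Z d) : reflOp d (solitonHarm A) = solitonHarm A :=
  reflOp_pairEmb _ _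

theorem star_solitonHarm {d : ℕ} {A : L2Z d} (hA : ∀ n, (A n).im = 0) :
    star (solitonHarm A) = solitonHarm A := by
  have hs : star ((2 : ℂ) • A) = (2 : ℂ) • A := by
    ext n
    change starRingEnd ℂ (2 * A n) = 2 * A n
    rw [map_mul, Complex.conj_ofNat, Complex.conj_eq_iff_im.mpr (hA n)]
  ext1
  funext m
  rw [lp.star_apply]
  by_cases hm : m = 1 ∨ m = -1
  · rcases hm with rfl | rfl
    · rw [solitonHarm, pairEmb_one, hs]
    · rw [solitonHarm, pairEmb_neg_one, hs]
  · rw [solitonHarm, pairEmb_of_not _ _ hm, star_zero]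

theorem reflOp_solitonPot {d p : ℕ} (A : L2Z d) (z : Harm d) :
    reflOp d (solitonPot p A z) = solitonPot p A (reflOp d z) := by
  change reflOp d ((1 + 2 * p : ℂ) • ((conv d (solitonHarm A)) ^ (2 * p)) z)
    = (1 + 2 * p : ℂ) • ((conv d (solitonHarm A)) ^ (2 * p)) (reflOp d z)
  rw [map_smul, reflOp_conv_pow, reflOp_solitonHarm]

/-- The coefficient of e^{±iτ} in (e^{iτ} + e^{-iτ})^{2p+1} is γ_p by Pascal's rule, so both
resonant rows are the stationary dNLS equation. -/
theorem floq_zero_solitonHarm {d p : ℕ} (hp : 1 ≤ p) {Ω : ℝ} {A : L2Z d}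
    (hA : ∀ n, (A n).im = 0) (hsol : IsSoliton p Ω A) :
    floq d 0 1 Ω 0 ((conv d (solitonHarm A)) ^ (2 * p)) (solitonHarm A) = 0 := by
  have hs : (Ω : ℂ) • A + (gam p : ℂ) • potOp p A A - lapOp d A = 0 := by
    ext n
    have h := hsol n
    simp only [lp.coeFn_sub, lp.coeFn_add, lp.coeFn_smul, Pi.sub_apply, Pi.add_apply,
        Pi.smul_apply, smul_eq_mul, potOp_apply, lapOp_apply, ← h]
    change _ = (0 : ℂ)
    ring
  ext1
  funext m
  by_cases hm : m = 1 ∨ m = -1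
  · rw [floq_apply_of _ _ _ _ _ _ hm, conv_pow_pairEmb_apply hA]
    have hj : jOp d (solitonHarm A) = pairEmb d (A, A) := jOp_pairEmb A A
    have e : ((Ω : ℂ) + 0 * 0 ^ 2 + 2 * Complex.I * 0 * 1 * m) = Ω := by ring
    rw [hj, e]
    rcases hm with rfl | rfl
    · rw [sum_choose_pairEmb_one hp, pairEmb_one, ← add_smul, map_smul, ← gam_eq_choose_add, hs]
      rfl
    · rw [sum_choose_pairEmb_neg_one hp, pairEmb_neg_one, ← add_smul, map_smul, add_comm
        ((2 * p).choose (p + 1) : ℂ), ← gam_eq_choose_add, hs]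
      rfl
  · rw [floq_zero_apply_of_not _ _ _ _ hm, solitonHarm, pairEmb_of_not _ _ hm, smul_zero]
    rfl

/-- The rescaled breather equation with frequency `ω = 1 - ε Ω / 2`. -/
def breatherEq (d p : ℕ) (Ω : ℝ) (v : ℂ × Harm d) : Harm d :=
  -- The third entry is (1 - ω²)/ε for this ω, already divided and regular at ε = 0.
  floq d v.1 (1 - v.1 * Ω / 2) (Ω - v.1 * Ω ^ 2 / 4) 0 ((conv d v.2) ^ (2 * p)) v.2

theorem contDiff_breatherEq {d p : ℕ} {Ω : ℝ} : ContDiff ℂ ⊤ (breatherEq d p Ω) := by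
  unfold breatherEq floq
  fun_prop

theorem reflOp_breatherEq {d p : ℕ} {Ω : ℝ} (ε : ℂ) (y : Harm d) :
    reflOp d (breatherEq d p Ω (ε, y)) = breatherEq d p Ω (ε, reflOp d y) :=
  reflOp_floq _ _ _ (fun z => reflOp_conv_pow y z (2 * p)) y

theorem star_breatherEq {d p : ℕ} {Ω : ℝ} (ε : ℝ) (y : Harm d) :
    star (breatherEq d p Ω ((ε : ℂ), y)) = breatherEq d p Ω ((ε : ℂ), star y) := by
  have h := star_floq_conv_pow ε (1 - ε * Ω / 2) (Ω - ε * Ω ^ 2 / 4) (2 * p) y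
  push_cast at h
  exact h

theorem hasFDerivAt_breatherEq {d p : ℕ} {Ω : ℝ} (A : L2Z d) :
    HasFDerivAt (fun y => breatherEq d p Ω (0, y)) (floq d 0 1 Ω 0 (solitonPot p A))
      (solitonHarm A) := by
  have e : (fun y => breatherEq d p Ω (0, y)) = fun y => floq d 0 1 Ω 0 0 y
      + (piOp d + (0 : ℂ) • (1 - piOp d)) (((conv d y) ^ (2 * p)) (jOp d y)) := by
    funext y
    rw [breatherEq]
    simp only [zero_mul, zero_div, sub_zero]
    rw [floq_eq_add]
    rfl
  rw [e]
  have h := (floq d 0 1 Ω 0 (0 : Harm d →L[ℂ] Harm d)).hasFDerivAt (x := solitonHarm A) |>.add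
    ((piOp d + (0 : ℂ) • (1 - piOp d)).hasFDerivAt.comp (solitonHarm A)
      (hasFDerivAt_conv_pow (2 * p) (solitonHarm A)))
  refine h.congr_fderiv ?_
  rw [floq_eq_add (W := solitonPot p A)]
  congr 1
  change (piOp d + (0 : ℂ) • (1 - piOp d))
    * ((((2 * p : ℕ) : ℂ) + 1) • ((conv d (solitonHarm A)) ^ (2 * p) * jOp d)) = _
  rw [solitonPot, smul_mul_assoc]
  congr 2
  push_cast
  ring

/-- The symmetrized derivative of the breather equation at the soliton is bijective. -/
theorem symmetrized_bijective {d p : ℕ} (hp : 1 ≤ p) {Ω : ℝ} {A : L2Z d}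
    (hA : ∀ n, (A n).im = 0) (hunit : IsUnit (Lplus p Ω A)) :
    Function.Bijective ((floq d 0 1 Ω 0 (solitonPot p A)
      + reflOp d * floq d 0 1 Ω 0 (solitonPot p A) + (1 - reflOp d) :
        Harm d →L[ℂ] Harm d)) := by
  obtain ⟨hLi, hLs⟩ := ContinuousLinearMap.isUnit_iff_bijective.mp hunit
  set L := floq d 0 1 Ω 0 (solitonPot p A) with hL
  set R := reflOp d with hR
  have hLR : ∀ y, R (L y) = L (R y) := fun y =>
    reflOp_floq 0 1 Ω (fun z => reflOp_solitonPot A z) y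
  have hRR : ∀ y, R (R y) = y := reflOp_reflOp
  have hap : ∀ y, (L + R * L + (1 - R)) y = L y + R (L y) + (y - R y) := fun _ => rfl
  have hres : ∀ x : L2Z d, L (resEmb d (x, 0)) = rowEmb d (0, Lplus p Ω A x) := by
    intro x
    rw [hL, floq_zero_resEmb hp Ω hA, JH_apply]
    simp
  have h2 : ∀ y : Harm d, (2 : ℂ) • y = 0 → y = 0 := fun y h =>
    (smul_eq_zero.mp h).resolve_left two_ne_zero
  constructor
  · rw [injective_iff_map_eq_zero]
    intro h h0
    rw [hap] at h0
    -- L commutes with R, so L + RL takes even values and 1 - R odd ones; applying R and subtracting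
    -- separates the two.
    have h0R := congrArg R h0
    rw [map_add, map_add, map_sub, hRR, hRR, map_zero] at h0R
    have heven : R h = h := by
      have : (2 : ℂ) • (h - R h) = 0 := by linear_combination (norm := module) h0 - h0R
      exact (sub_eq_zero.mp (h2 _ this)).symm
    have hL0 : L h = 0 := by
      rw [hLR, heven, sub_self, add_zero] at h0
      apply h2
      linear_combination (norm := module) h0
    have hsupp : ∀ m, ¬(m = 1 ∨ m = -1) → h m = 0 := by
      intro m hm
      have e3 : L h m = 0 := congrArg (fun y : Harm d => y m) hL0
      rw [hL, floq_zero_apply_of_not _ _ _ _ hm] at e3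
      exact (smul_eq_zero.mp e3).resolve_left (nonres_symbol_ne_zero hm)
    -- Evenness means b₋ = 0, so only L₊ is left.
    have h11 : h (-1) = h 1 := congrArg (fun y : Harm d => y 1) heven
    have hpr : resProj d h = ((2 : ℂ)⁻¹ • h 1, 0) := by
      rw [resProj_apply, h11, sub_self, smul_zero]
      congr 1
      module
    have hh := resEmb_resProj hsupp
    rw [hpr] at hh
    rw [← hh, hres] at hL0
    have h3 : Lplus p Ω A ((2 : ℂ)⁻¹ • h 1) = 0 := congrArg Prod.snd (rowEmb_injective hL0)
    have h4 : (2 : ℂ)⁻¹ • h 1 = 0 := by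
      apply hLi
      rw [h3, map_zero]
    rw [← hh, h4]
    exact map_zero _
  · intro z
    -- L + RL equals 2L on even vectors and 1 - R doubles odd ones, so each solves for half the
    -- matching component (z ± Rz)/2 of z.
    set ze := (4 : ℂ)⁻¹ • (z + R z) with hze
    have hzeR : R ze = ze := by
      rw [hze, map_smul, map_add, hRR, add_comm]
    set h' := nonresInv d ze with hh'
    have hh'R : R h' = h' := by
      ext1
      funext m
      have h5 : ze (-m) = ze m := congrArg (fun y : Harm d => y m) hzeR
      have h6 : (-m = 1 ∨ -m = -1) ↔ (m = 1 ∨ m = -1) := by omega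
      rw [hR, reflOp_apply, hh', nonresInv, multOp_apply, multOp_apply, h5]
      congr 1
      simp only [h6, winv_neg]
      push_cast
      rw [neg_sq]
    set r := ze - L h' with hr
    have hrR : R r = r := by rw [hr, map_sub, hLR, hzeR, hh'R]
    have hsupp : ∀ m, ¬(m = 1 ∨ m = -1) → r m = 0 := by
      intro m hm
      rw [hr, lp.coeFn_sub, Pi.sub_apply, hh', hL, floq_zero_nonresInv _ _ _ _ hm, sub_self]
    have hr1 : r (-1) = r 1 := congrArg (fun y : Harm d => y 1) hrR
    obtain ⟨x, hx⟩ := hLs (r 1)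
    have hLx : L (resEmb d (x, 0)) = r := by
      rw [hres, hx, rowEmb_apply]
      conv_rhs => rw [eq_pairEmb hsupp, hr1]
      simp
    have hxR : R (resEmb d (x, 0)) = resEmb d (x, 0) := by
      rw [resEmb_apply, hR, reflOp_pairEmb]
      simp
    refine ⟨h' + resEmb d (x, 0) + (4 : ℂ)⁻¹ • (z - R z), ?_⟩
    rw [hap, hLR]
    have e1 : L (h' + resEmb d (x, 0)) = ze := by
      rw [map_add, hLx, hr]
      abel
    have e2 : R (h' + resEmb d (x, 0)) = h' + resEmb d (x, 0) := by
      rw [map_add, hh'R, hxR]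
    rw [map_add R, e2, map_add L, e1, map_add L, e1, map_smul, map_smul, map_smul, hze]
    simp only [map_sub, hRR]
    module

theorem exists_breather_solution {d p : ℕ} (hp : 1 ≤ p) {Ω : ℝ}
    (hΩ : Ω ∉ Set.Icc (-(4 * (d : ℝ))) 0) {A : L2Z d} (hA : ∀ n, (A n).im = 0)
    (hsol : IsSoliton p Ω A) (hker : ∀ f : L2Z d, Lplus p Ω A f = 0 → f = 0) :
    ∃ ψ : ℂ → Harm d, AnalyticAt ℂ ψ 0 ∧ ψ 0 = solitonHarm A ∧
      ∀ᶠ ε : ℝ in 𝓝 0, breatherEq d p Ω ((ε : ℂ), ψ ε) = 0 ∧ reflOp d (ψ ε) = ψ ε ∧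
        star (ψ ε) = ψ ε := by
  set R := reflOp d with hR
  set y₀ := solitonHarm A with hy₀
  have hRR : ∀ y, R (R y) = y := reflOp_reflOp
  -- Adding v - Rv removes the odd kernel direction b = (0, A) and forces solutions to be even.
  set F : ℂ × Harm d → Harm d := fun v =>
    breatherEq d p Ω v + R (breatherEq d p Ω v) + (v.2 - R v.2) with hF
  have hFc : ContDiff ℂ ⊤ F := by
    have h1 : ContDiff ℂ ⊤ (breatherEq d p Ω) := contDiff_breatherEq
    rw [hF]
    fun_prop
  have hb0 : breatherEq d p Ω (0, y₀) = 0 := by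
    rw [breatherEq]
    simp only [zero_mul, zero_div, sub_zero]
    exact floq_zero_solitonHarm hp hA hsol
  have hF0 : F (0, y₀) = 0 := by
    simp only [hF]
    rw [hb0, map_zero, hy₀, hR, reflOp_solitonHarm, sub_self, add_zero, add_zero]
  have hF₂ : HasFDerivAt (fun y => F (0, y)) (floq d 0 1 Ω 0 (solitonPot p A)
      + R * floq d 0 1 Ω 0 (solitonPot p A) + (1 - R)) y₀ := by
    have h1 := hasFDerivAt_breatherEq (p := p) (Ω := Ω) A
    exact (h1.add (R.hasFDerivAt.comp y₀ h1)).add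
      ((hasFDerivAt_id y₀).sub R.hasFDerivAt)
  obtain ⟨ψ, hψa, hψ0, hψ⟩ := exists_implicitFunction hFc.contDiffAt hF0 hF₂
    (symmetrized_bijective hp hA (isUnit_Lplus hp hΩ hA hker))
  refine ⟨ψ, hψa, hψ0, ?_⟩
  have hof : Filter.Tendsto (fun ε : ℝ => (ε : ℂ)) (𝓝 0) (𝓝 0) := by
    simpa using Complex.continuous_ofReal.tendsto 0
  have hψc : Filter.Tendsto (fun ε : ℝ => ψ ε) (𝓝 0) (𝓝 y₀) := by
    rw [← hψ0]
    exact hψa.continuousAt.tendsto.comp hof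
  have hst : Filter.Tendsto (fun ε : ℝ => star (ψ ε)) (𝓝 0) (𝓝 y₀) := by
    have := (continuous_star.tendsto y₀).comp hψc
    rwa [hy₀, star_solitonHarm hA, ← hy₀] at this
  filter_upwards [(hof.prodMk_nhds hψc).eventually hψ, (hof.prodMk_nhds hst).eventually hψ]
    with ε h1 h2
  have hz : F ((ε : ℂ), ψ ε) = 0 := h1.mpr rfl
  have hz1 : breatherEq d p Ω ((ε : ℂ), ψ ε) + R (breatherEq d p Ω ((ε : ℂ), ψ ε))
      + (ψ ε - R (ψ ε)) = 0 := hz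
  have hcan : ∀ y : Harm d, (2 : ℂ) • y = 0 → y = 0 := fun y h =>
    (smul_eq_zero.mp h).resolve_left two_ne_zero
  have hz2 := congrArg R hz1
  rw [map_add, map_add, map_sub, hRR, hRR, map_zero] at hz2
  have heven : R (ψ ε) = ψ ε := by
    have : (2 : ℂ) • (ψ ε - R (ψ ε)) = 0 := by linear_combination (norm := module) hz1 - hz2
    exact (sub_eq_zero.mp (hcan _ this)).symm
  have hsolved : breatherEq d p Ω ((ε : ℂ), ψ ε) = 0 := by
    have h3 : R (breatherEq d p Ω ((ε : ℂ), ψ ε)) = breatherEq d p Ω ((ε : ℂ), R (ψ ε)) :=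
      reflOp_breatherEq _ _
    rw [h3, heven, sub_self, add_zero] at hz1
    apply hcan
    linear_combination (norm := module) hz1
  refine ⟨hsolved, heven, ?_⟩
  -- For real ε the conjugate solves the same equation near the real soliton, so uniqueness makes it
  -- equal to ψ(ε).
  refine (h2.mp ?_).symm
  have h4 : breatherEq d p Ω ((ε : ℂ), star (ψ ε)) = 0 := by
    rw [← star_breatherEq, hsolved, star_zero]
  have h5 : R (star (ψ ε)) = star (ψ ε) := by
    have h6 : R (star (ψ ε)) = star (R (ψ ε)) := rfl
    rw [h6, heven]
  simp only [hF]
  rw [h4, h5, map_zero, sub_self, add_zero, add_zero]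

theorem exists_breather_branch {d p : ℕ} (hp : 1 ≤ p) {Ω : ℝ}
    (hΩ : Ω ∉ Set.Icc (-(4 * (d : ℝ))) 0) {A₀ : L2Z d} (hreal : ∀ n, (A₀ n).im = 0)
    (hsol : IsSoliton p Ω A₀) (hker : ∀ f : L2Z d, Lplus p Ω A₀ f = 0 → f = 0) :
    ∃ (ε₁ C₁ : ℝ) (ω : ℝ → ℝ) (A : ℝ → X2 d), 0 < ε₁ ∧
      IsBreatherBranch p Ω A₀ ε₁ C₁ ω A ∧ AnalyticAt ℝ ω 0 ∧ AnalyticAt ℝ A 0 := by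
  obtain ⟨ψ, hψa, hψ0, hψ⟩ := exists_breather_solution hp hΩ hreal hsol hker
  have hof : Filter.Tendsto (fun ε : ℝ => (ε : ℂ)) (𝓝 0) (𝓝 0) := by
    simpa using Complex.continuous_ofReal.tendsto 0
  have hO : (fun ε : ℝ => ψ ε - solitonHarm A₀) =O[𝓝 0] fun ε : ℝ => ε := by
    have h1 : (fun z : ℂ => ψ z - solitonHarm A₀) =O[𝓝 0] fun z : ℂ => z := by
      have h2 := hψa.differentiableAt.isBigO_sub
      simpa only [hψ0, sub_zero] using h2
    refine (h1.comp_tendsto hof).trans (Asymptotics.IsBigO.of_norm_left ?_)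
    simpa only [Function.comp_apply, Complex.norm_real] using
      (Asymptotics.isBigO_refl (fun ε : ℝ => ε) (𝓝 0)).norm_left
  obtain ⟨C, hC0, hC⟩ := hO.exists_pos
  rw [Asymptotics.isBigOWith_iff] at hC
  have hAan : ∀ ε : ℝ, AnalyticAt ℂ ψ ε →
      AnalyticAt ℝ (fun x : ℝ => (weightEquiv d).symm (ψ x)) ε := by
    intro ε h
    have h1 : AnalyticAt ℂ (fun z => (weightEquiv d).symm (ψ z)) (ε : ℂ) :=
      (((weightEquiv d).symm : Harm d →L[ℂ] X2 d).analyticAt _).comp h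
    exact h1.restrictScalars.comp (Complex.ofRealCLM.analyticAt ε)
  have hωan : ∀ ε : ℝ, AnalyticAt ℝ (fun x : ℝ => 1 - x * Ω / 2) ε := by
    intro ε
    fun_prop
  obtain ⟨r, hr0, hr⟩ := Metric.eventually_nhds_iff.mp
    (hψ.and (hC.and (hof.eventually hψa.eventually_analyticAt)))
  have hmem : ∀ ε ∈ Set.Ioo 0 r, dist ε (0 : ℝ) < r := by
    intro ε hε
    rw [Real.dist_eq, sub_zero, abs_of_pos hε.1]
    exact hε.2
  set S := ∑' k, winv k with hS
  -- The 2 covers the harmonics 0 and 1, and S covers those with m ≥ 2. The frequency error vanishes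
  -- identically.
  refine ⟨r, (S + 2) * C, fun x => 1 - x * Ω / 2, fun x => (weightEquiv d).symm (ψ x), hr0,
    ⟨fun ε _ => hωan ε, fun ε hε => hAan ε (hr (hmem ε hε)).2.2, fun ε hε => ?_, fun ε hε => ?_,
      fun ε hε => ?_⟩, hωan 0, hAan 0 (by simpa using hψa)⟩
  · obtain ⟨⟨hsolved, heven, hstar⟩, -, -⟩ := hr (hmem ε hε)
    refine ⟨fun m n => ?_, fun m => ?_, ?_⟩
    · rw [harm_symm]
      change ((winv m : ℂ) * ψ ε m n).im = 0
      have h1 : starRingEnd ℂ (ψ ε m n) = ψ ε m n := congrArg (fun y : Harm d => y m n) hstar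
      rw [Complex.im_ofReal_mul, Complex.conj_eq_iff_im.mp h1, mul_zero]
    · have h1 : ψ ε (-m) = ψ ε m := congrArg (fun y : Harm d => y m) heven
      rw [harm_symm, harm_symm, h1, winv_neg]
    · rw [breather_eq_iff (σ := Ω - ε * Ω ^ 2 / 4) hε.1.ne' (by push_cast; ring),
        LinearIsometryEquiv.apply_symm_apply]
      push_cast
      exact hsolved
  · have e : (1 - ε * Ω / 2) - 1 + ε * Ω / 2 = 0 := by ring
    rw [e, abs_zero]
    have hS0 : 0 ≤ S := tsum_nonneg fun k => (winv_pos k).le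
    positivity
  · obtain ⟨-, hb, -⟩ := hr (hmem ε hε)
    rw [Real.norm_of_nonneg hε.1.le] at hb
    have hs : solitonHarm A₀ = resEmb d (A₀, 0) := by
      rw [resEmb_apply, smul_zero, add_zero, sub_zero]
      rfl
    have h0 := norm_harm_symm_sub_le (ψ ε) (solitonHarm A₀) 0
    have h1 := norm_harm_symm_sub_le (ψ ε) (solitonHarm A₀) 1
    rw [solitonHarm, pairEmb_of_not _ _ (by norm_num), smul_zero, sub_zero, ← solitonHarm] at h0
    rw [solitonHarm, pairEmb_one, winv_one, smul_smul, ← solitonHarm] at h1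
    have e2 : (((2⁻¹ : ℝ) : ℂ) * 2) = 1 := by norm_num
    rw [e2, one_smul] at h1
    have h2 : ∑' m : ℕ, ‖((weightEquiv d).symm (ψ ε)).harm (m + 2)‖
        ≤ S * ‖ψ ε - solitonHarm A₀‖ := by
      have e3 : ∀ m : ℕ, ‖((weightEquiv d).symm (ψ ε)).harm (m + 2)‖
          = winv (m + 2) * ‖(ψ ε - solitonHarm A₀) ((m : ℤ) + 2)‖ := by
        intro m
        have h4 : solitonHarm A₀ ((m : ℤ) + 2) = 0 := pairEmb_of_not _ _ (by omega)
        rw [harm_symm, norm_smul, norm_winv, lp.coeFn_sub, Pi.sub_apply, h4, sub_zero]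
      simp only [e3]
      refine le_trans ?_ (tsum_winv_mul_norm_le (ψ ε - solitonHarm A₀))
      exact tsum_comp_le_tsum_of_inj (summable_winv_mul_norm (ψ ε - solitonHarm A₀))
        (fun k => mul_nonneg (winv_pos k).le (norm_nonneg _))
        (i := fun m : ℕ => (m : ℤ) + 2) (fun a b h => by simpa using h)
    have hS0 : 0 ≤ S := tsum_nonneg fun k => (winv_pos k).le
    have h5 : S * ‖ψ ε - solitonHarm A₀‖ ≤ S * (C * ε) := by gcongr
    have e5 : (S + 2) * C * ε = S * (C * ε) + 2 * (C * ε) := by ring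
    rw [e5]
    linarith

end KGBreather

end

theorem theorem2 (d p : ℕ) (hd : 1 ≤ d) (hp : 1 ≤ p)
    (Ω : ℝ) (hΩ : Ω ∉ Set.Icc (-(4 * (d : ℝ))) 0)
    (A₀ : KGBreather.L2Z d) (hreal : ∀ n, (A₀ n).im = 0)
    (hsol : KGBreather.IsSoliton p Ω A₀)
    (hker : ∀ f : KGBreather.L2Z d, KGBreather.Lplus p Ω A₀ f = 0 → f = 0)
    (Lam : ℂ) (bp bm : KGBreather.L2Z d)
    (heig : KGBreather.IsSimpleIsolatedEigenpair p Ω A₀ Lam (bp, bm))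
    (hcont : 2 * Lam ∉ KGBreather.contSpectrum d Ω) :
    (∃ (ε₁ C₁ : ℝ) (ω : ℝ → ℝ) (A : ℝ → KGBreather.X2 d), 0 < ε₁ ∧
      KGBreather.IsBreatherBranch p Ω A₀ ε₁ C₁ ω A ∧
      AnalyticAt ℝ ω 0 ∧ AnalyticAt ℝ A 0) ∧
    ∀ (ε₁ C₁ : ℝ) (ω : ℝ → ℝ) (A : ℝ → KGBreather.X2 d), 0 < ε₁ →
      KGBreather.IsBreatherBranch p Ω A₀ ε₁ C₁ ω A →
      ∃ (ε₀ C₀ δ : ℝ) (lam : ℝ → ℂ) (B : ℝ → KGBreather.X2 d),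
        0 < ε₀ ∧ ε₀ ≤ ε₁ ∧ 0 < C₀ ∧ C₀ * ε₀ ≤ δ ∧
        AnalyticOnNhd ℝ lam (Set.Ioo 0 ε₀) ∧ AnalyticOnNhd ℝ B (Set.Ioo 0 ε₀) ∧
        (AnalyticAt ℝ ω 0 → AnalyticAt ℝ A 0 → AnalyticAt ℝ lam 0 ∧ AnalyticAt ℝ B 0) ∧
        ∀ ε ∈ Set.Ioo 0 ε₀,
          KGBreather.IsFloquetEigenpair p ε (ω ε) (A ε) (lam ε) (B ε) ∧
          ‖lam ε - ε * Lam‖ ≤ C₀ * ε ^ 2 ∧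
          ‖(B ε).harm 1 - bp - Complex.I • bm‖ + ‖(B ε).harm (-1) - bp + Complex.I • bm‖
            ≤ C₀ * ε ∧
          ∑' m : {m : ℤ // m ≠ 1 ∧ m ≠ -1}, ‖(B ε).harm m‖ ≤ C₀ * ε ∧
          ∀ (mu : ℂ) (D : KGBreather.X2 d),
            KGBreather.IsFloquetEigenpair p ε (ω ε) (A ε) mu D →
            ‖mu - ε * Lam‖ ≤ δ * ε → mu = lam ε ∧ ∃ c : ℂ, D = c • B ε :=
  ⟨KGBreather.exists_breather_branch hp hΩ hreal hsol hker, fun _ _ _ _ hε₁ hbr =>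
    KGBreather.exists_floquet_branch hp hreal heig hcont hε₁ hbr⟩
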